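/- **Setting.** Let $\mathcal O,\mathcal A$ be finite non-empty sets, $H\ge 1$, and let $o_{\mathrm{dummy}}\in\mathcal O$. A *system* (model) $f$ gives a conditional law $\mathbb P_f(o_{h}\mid\tau_{h-1})$ of the next observation given each history $\tau_{h-1}=(o_1,a_1,\dots,o_{h-1},a_{h-1})$; after $H$ actions only $o_{\mathrm{dummy}}$ is generated. A policy $\pi$ gives the law of $a_h$ given $(\tau_{h-1},o_h)$; $\mathbb P^\pi_f(\tau)$ is the resulting probability of $\tau$. The rewards are known functions $r_h(o_h,a_h)\in[0,1]$, $h=1,\dots,H$; $V^\pi_f$ is the expected total reward, and $V^\pi=V^\pi_{f^*}$, $V^*=\sup_\pi V^\pi$ for the true model $f^*$. For a test $t=(o_{h+1:h+W},a_{h+1:h+W-1})$, $W\ge1$, let $\mathbb P_f(t\mid\tau_h)=\prod_{j=1}^{W}\mathbb P_f(o_{h+j}\mid\tau_h,o_{h+1},a_{h+1},\dots,o_{h+j-1},a_{h+j-1})$ if $\tau_h$ is reachable (has positive probability under some policy) and $0$ otherwise. For $0\le h\le H-1$ let $D_{h;f}$ be the matrix $(\mathbb P_f(t\mid\tau_h))_{t,\tau_h}$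 over all tests and all histories of length $h$. Put $d_{\mathrm{PSR}}=\max_h\operatorname{rank}D_{h;f^*}$. A finite set $\mathcal U_{h+1}$ of tests is a *core test set* of $f$ at step $h+1$ if the rows of $D_{h;f}$ indexed by $\mathcal U_{h+1}$ have the same rank as $D_{h;f}$; the predictive state of $\tau_h$ is $q_{\tau_h;f}=[\mathbb P_f(u\mid\tau_h)]_{u\in\mathcal U_{h+1}}$. A core matrix has as columns $\operatorname{rank}D_{h;f}$ predictive states that span all predictive states of length-$h$ histories; $K_{h;f}$ is a core matrix for which $\|K_{h;f}^\dagger\|_{1\mapsto1}$ is smallest ($\dagger$ is the Moore–Penrose pseudoinverse). $\mathcal U_{A,h}$ is the set of action sequences of tests in $\mathcal U_h$ and $|\mathcal U_A|=\max_{h\in[H]}|\mathcal U_{A,h}|$. For a model class $\mathcal F$, $\mathcal N_{\mathcal F}(\epsilon)$ is the least $N$ for which there are real functions $g_1^i,g_2^i$ ($i\le N$) of policies and trajectories with $\sum_{\tau_H}|g^i_1(\pi,\tau_H)-g^i_2(\pi,\tau_H)|\le\epsilon$ for all $i,\pi$, and such that every $f\in\mathcal F$ has an $i$ with $g_1^i(\pi,\tau_H)\le\mathbb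 P_f^\pi(\tau_H)\le g_2^i(\pi,\tau_H)$ for all $\pi,\tau_H$. **Algorithm (CRANE with slackness $\beta$).** Start with $\mathcal D=\emptyset$, $\mathcal B^1=\mathcal F$. For $k=1,\dots,K$: pick $(f^k,\pi^k)\in\arg\max_{f\in\mathcal B^k,\pi}V^\pi_f$ (the maxima are assumed to exist; ties are broken arbitrarily); for every $0\le h\le H-1$ and $u\in\mathcal U_{A,h+1}$ execute for one episode in $f^*$ the policy that follows $\pi^k$ at steps $1,\dots,h-1$, acts uniformly at step $h$ (if $h\geq 1$), then takes the actions of $u$, and is uniform afterwards; add the policy with its trajectory $\tau_H$ to $\mathcal D$; let $\mathcal B^{k+1}$ be the set of $f\in\mathcal F$ with $\sum_{(\pi,\tau_H)\in\mathcal D}\log\mathbb P^\pi_f(\tau_H)\ge\sup_{f'\in\mathcal F}\sum_{(\pi,\tau_H)\in\mathcal D}\log\mathbb P^\pi_{f'}(\tau_H)-\beta$. Let $\widehat\pi=\mathrm{Unif}(\{\pi^k\}_{k=1}^K)$, i.e. draw $k\in[K]$ uniformly and execute $\pi^k$ for the whole episode. **Statement.** There are an absolute constant $c>0$ and a fixed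 real polynomial $\mathrm{poly}$ in nine variables such that the following holds for all data as above. Assume $\alpha>0$; every single observation $o\in\mathcal O$ (as a test of length one) belongs to $\mathcal U_H$; $f^*\in\mathcal F$; and for every $f\in\mathcal F$ and $0\le h\le H-1$, $\mathcal U_{h+1}$ is a core test set of $f$ and $\|K_{h;f}^\dagger\|_{1\mapsto1}\le1/\alpha$. Let $\delta\in(0,1]$, $\epsilon>0$, let $K\ge1$ be an integer, put $\epsilon_{\mathrm b}=1/(KH|\mathcal U_A|)$, and suppose that $$K\ \ge\ \frac1{\epsilon^2}\,\mathrm{poly}\Big(d_{\mathrm{PSR}},|\mathcal U_A|,\tfrac1\alpha,\log\mathcal N_{\mathcal F}(\epsilon_{\mathrm b}),H,|\mathcal A|,\log|\mathcal O|,\log\tfrac1\delta,\log\tfrac1\epsilon\Big).$$ Run CRANE for $K$ iterations with $\beta=c\log(\mathcal N_{\mathcal F}(\epsilon_{\mathrm b})KH|\mathcal U_A|/\delta)$. Then with probability at least $1-\delta$ we have $V^{\widehat\pi}\ge V^*-\epsilon$, and at most $KH|\mathcal U_A|$ episodes are executed. In particular, the sample complexity has no polynomial dependence on $|\mathcal O|$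 apart from the dependence through $\log\mathcal N_{\mathcal F}(\epsilon_{\mathrm b})$. -/

import Mathlib

open scoped ENNReal

noncomputable section

/-- A partially observable system of horizon `H`.  `obs τ` is the law of the next observation after
the history `τ = [(o₁, a₁), …, (o_h, a_h)]`; `obs []` is the law of the first observation.  Once `H`
actions have been taken, only the dummy observation `oDum` is generated. -/
structure System (O A : Type*) (H : ℕ) (oDum : O) where
  obs : List (O × A) → PMF O
  obs_after : ∀ τ : List (O × A), H ≤ τ.length → obs τ = PMF.pure oDum

/-- A policy: the law of the next action given the history `τ_{h-1}` and the observation `o_h`.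
Only its values at histories of length less than `H` matter. -/
abbrev Policy (O A : Type*) := List (O × A) → O → PMF A

/-- A test `(o₁, a₁, …, o_{W-1}, a_{W-1}, o_W)`: the first `W - 1` observation-action pairs and the
last observation. -/
abbrev Test (O A : Type*) := List (O × A) × O

/-- The action sequence of a test. -/
def Test.actions {O A : Type*} (t : Test O A) : List A := t.1.map Prod.snd

namespace System

variable {O A : Type*} {H : ℕ} {oDum : O}

/-- The law of the trajectory `τ_n` of the first `n` steps when `π` is executed. -/
def traj (M : System O A H oDum) (π : Policy O A) : ℕ → PMF (List (O × A))
  | 0 => PMF.pure []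
  | n + 1 => (M.traj π n).bind fun τ => (M.obs τ).bind fun o => (π τ o).bind fun a =>
      PMF.pure (τ ++ [(o, a)])

/-- `ℙ^π(τ_H)`, the probability of a full trajectory. -/
def prob (M : System O A H oDum) (π : Policy O A) (τ : Fin H → O × A) : ℝ :=
  (M.traj π H (List.ofFn τ)).toReal

/-- A history is reachable if some policy reaches it with positive probability. -/
def Reachable (M : System O A H oDum) (τ : List (O × A)) : Prop :=
  ∃ π : Policy O A, M.traj π τ.length τ ≠ 0

/-- The probability of observing `o₁, …, o_W` after the history `τ` when the actions
`a₁, …, a_{W-1}` are actively executed (the do-operator). -/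
def doProb (M : System O A H oDum) : List (O × A) → List (O × A) → O → ℝ
  | τ, [], o => (M.obs τ o).toReal
  | τ, x :: xs, o => (M.obs τ x.1).toReal * M.doProb (τ ++ [x]) xs o

open Classical in
/-- `ℙ(t | τ)`, which is `0` by convention when `τ` is unreachable. -/
def testProb (M : System O A H oDum) (τ : List (O × A)) (t : Test O A) : ℝ :=
  if M.Reachable τ then M.doProb τ t.1 t.2 else 0

/-- The one-step system dynamics matrix `D_h`: rows are all tests, columns are all histories of
length `h`. -/
def dynMatrix (M : System O A H oDum) (h : ℕ) : Matrix (Test O A) (Fin h → O × A) ℝ :=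
  Matrix.of fun t τ => M.testProb (List.ofFn τ) t

/-- The submatrix of `D_h` with the rows in `U`; its columns are the predictive states `q_τ`. -/
def predMatrix (M : System O A H oDum) (h : ℕ) (U : Finset (Test O A)) :
    Matrix U (Fin h → O × A) ℝ :=
  (M.dynMatrix h).submatrix Subtype.val id

variable [Fintype O] [Fintype A]

/-- `d_{PSR,h} = rank D_h`. -/
def rankAt (M : System O A H oDum) (h : ℕ) : ℕ := (M.dynMatrix h).rank

/-- `d_PSR = max_{0 ≤ h ≤ H - 1} rank D_h`. -/
def psrRank (M : System O A H oDum) : ℕ := (Finset.range H).sup M.rankAt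

/-- `U` is a core test set for the step after histories of length `h`. -/
def IsCoreTestSet (M : System O A H oDum) (h : ℕ) (U : Finset (Test O A)) : Prop :=
  (M.predMatrix h U).rank = M.rankAt h

/-- The histories `σ 1, …, σ d`, `d = rank D_h`, are minimum core histories: every predictive state
`q_τ` is a linear combination of `q_{σ 1}, …, q_{σ d}`. -/
def IsCoreHistories (M : System O A H oDum) (h : ℕ) (U : Finset (Test O A))
    (σ : Fin (M.rankAt h) → Fin h → O × A) : Prop :=
  ∀ τ, (M.predMatrix h U).col τ ∈ Submodule.span ℝ (Set.range fun j => (M.predMatrix h U).col (σ j))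

/-- The matrix with columns `q_{σ 1}, …, q_{σ d}`; a core matrix if `σ` are core histories. -/
def coreMatrix (M : System O A H oDum) (h : ℕ) (U : Finset (Test O A))
    (σ : Fin (M.rankAt h) → Fin h → O × A) : Matrix U (Fin (M.rankAt h)) ℝ :=
  (M.predMatrix h U).submatrix id σ

end System

/-- `X` is the (unique) Moore–Penrose pseudoinverse of the real matrix `K`. -/
structure IsPseudoInverse {m n : Type*} [Fintype m] [Fintype n]
    (K : Matrix m n ℝ) (X : Matrix n m ℝ) : Prop where
  mul_mul : K * X * K = K
  mul_mul' : X * K * X = X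
  symm_left : (K * X).transpose = K * X
  symm_right : (X * K).transpose = X * K

/-- The norm `‖X‖_{1 ↦ 1} = sup_{‖x‖₁ = 1} ‖X x‖₁`. -/
def l1OpNorm {m n : Type*} [Fintype m] [Fintype n] (X : Matrix n m ℝ) : ℝ :=
  ⨆ x : {x : m → ℝ // ∑ i, |x i| = 1}, ∑ j, |X.mulVec x.1 j|

section

variable {O A : Type*} [Fintype O] [Fintype A] {H : ℕ} {oDum : O}

/-- `‖K_h†‖_{1 ↦ 1} ≤ 1 / α`, where `K_h` is the core matrix for which this norm is smallest (there
are finitely many choices of core histories, so this says that some choice satisfies the bound). -/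
def System.RegularAt (M : System O A H oDum) (α : ℝ) (h : ℕ) (U : Finset (Test O A)) : Prop :=
  ∃ σ, M.IsCoreHistories h U σ ∧
    ∃ X, IsPseudoInverse (M.coreMatrix h U σ) X ∧ l1OpNorm X ≤ 1 / α

/-- The `ε`-bracket number of a class of models. -/
def bracketNumber (F : Set (System O A H oDum)) (ε : ℝ) : ℕ :=
  sInf {N | ∃ g₁ g₂ : Fin N → Policy O A → (Fin H → O × A) → ℝ,
    (∀ i π, ∑ τ, |g₁ i π τ - g₂ i π τ| ≤ ε) ∧
    ∀ f ∈ F, ∃ i, ∀ π τ, g₁ i π τ ≤ f.prob π τ ∧ f.prob π τ ≤ g₂ i π τ}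

/-- The expected total reward `∑_h r_h(o_h, a_h)` when trajectories have the law `p`. -/
def expectedReturn (r : Fin H → O → A → ℝ) (p : (Fin H → O × A) → ℝ) : ℝ :=
  ∑ τ, p τ * ∑ h, r h (τ h).1 (τ h).2

/-- The value `V^π`. -/
def System.value (M : System O A H oDum) (r : Fin H → O → A → ℝ) (π : Policy O A) : ℝ :=
  expectedReturn r (M.prob π)

/-- The optimal value `V* = sup_π V^π`. -/
def System.optValue (M : System O A H oDum) (r : Fin H → O → A → ℝ) : ℝ :=
  ⨆ π : Policy O A, M.value r π

/-- The value of the uniform mixture of a list of policies: one of them is drawn uniformly and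
executed for the whole episode, so the law of the trajectory is the average of the laws. -/
def System.mixValue (M : System O A H oDum) (r : Fin H → O → A → ℝ) (πs : List (Policy O A)) : ℝ :=
  expectedReturn r fun τ => (πs.map fun π => M.prob π τ).sum / πs.length

/-- A data set: executed policies with the trajectories `τ_H` that they produced. -/
abbrev Data (O A : Type*) := List (Policy O A × List (O × A))

open Classical in
/-- The set of action sequences of a set of tests. -/
def actionSeqs (U : Finset (Test O A)) : Finset (List A) := U.image Test.actions

/-- `|𝒰_A|`, the maximum over the steps of the number of action sequences in the core test set.
Here and below `U h` is the core test set that follows histories of length `h < H`. -/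
def numActionSeqs (U : Fin H → Finset (Test O A)) : ℕ :=
  Finset.univ.sup fun h => (actionSeqs (U h)).card

/-- The policy `π_{1:h-1} ∘ Unif(𝒜) ∘ u`, uniform after `u` is exhausted: the first `h - 1` actions
are chosen by `π`, the `h`-th one (if `h ≥ 1`) is uniform, and then the actions in `u` are taken. -/
def explore [Nonempty A] (π : Policy O A) (h : ℕ) (u : List A) : Policy O A := fun τ o =>
  if τ.length + 1 < h then π τ o
  else if τ.length < h then PMF.uniformOfFintype A
  else match u[τ.length - h]? with
    | some a => PMF.pure a
    | none => PMF.uniformOfFintype A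

/-- All the policies executed in one iteration with planned policy `π`, one for every
`h ∈ {0, …, H - 1}` and every action sequence in the core test set that follows `h`. -/
def exploreAll [Nonempty A] (U : Fin H → Finset (Test O A)) (π : Policy O A) : List (Policy O A) :=
  (List.finRange H).flatMap fun h => (actionSeqs (U h)).toList.map fun u => explore π h u

/-- Execute the given policies in the system `M`, one episode each, and append the results to the
data set. -/
def collect (M : System O A H oDum) : List (Policy O A) → Data O A → PMF (Data O A)
  | [], D => PMF.pure D
  | π :: πs, D => (M.traj π H).bind fun τ => collect M πs (D ++ [(π, τ)])

/-- The log-likelihood `∑_{(π, τ) ∈ D} log ℙ_f^π(τ)`, with `log 0 = -∞`. -/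
def logLik (f : System O A H oDum) (D : Data O A) : EReal :=
  (D.map fun x => ENNReal.log (f.traj x.1 H x.2)).sum

/-- The confidence set with slackness `β`.  For the empty data set and `β ≥ 0` this is `F`. -/
def confSet (F : Set (System O A H oDum)) (β : ℝ) (D : Data O A) : Set (System O A H oDum) :=
  {f | f ∈ F ∧ (⨆ f' ∈ F, logLik f' D) - (β : EReal) ≤ logLik f D}

/-- `(f, π)` maximizes the value `V_f^π` over all models in `B` and all policies. -/
def IsOptimistic (r : Fin H → O → A → ℝ) (B : Set (System O A H oDum))
    (x : System O A H oDum × Policy O A) : Prop :=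
  x.1 ∈ B ∧ ∀ f ∈ B, ∀ π, f.value r π ≤ x.1.value r x.2

/-- The state of the algorithm: the data set, and the pairs `(f^k, π^k)` planned so far. -/
structure CraneState (O A : Type*) (H : ℕ) (oDum : O) where
  data : Data O A
  plans : List (System O A H oDum × Policy O A)

/-- The law of the state of the algorithm after `k` iterations in the true system `M`, when the
planning step picks `(f^k, π^k)` by the (possibly randomized) rule `plan`. -/
def craneRun [Nonempty A] (M : System O A H oDum) (U : Fin H → Finset (Test O A))
    (plan : CraneState O A H oDum → PMF (System O A H oDum × Policy O A)) :
    ℕ → PMF (CraneState O A H oDum)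
  | 0 => PMF.pure ⟨[], []⟩
  | k + 1 => (craneRun M U plan k).bind fun s => (plan s).bind fun x =>
      (collect M (exploreAll U x.2) s.data).map fun D => ⟨D, s.plans ++ [x]⟩

/-- In the first `K` iterations the rule `plan` always picks a maximizer of `V_f^π` over the current
confidence set and all policies. -/
def IsCranePlanner [Nonempty A] (M : System O A H oDum) (U : Fin H → Finset (Test O A))
    (r : Fin H → O → A → ℝ) (F : Set (System O A H oDum)) (β : ℝ) (K : ℕ)
    (plan : CraneState O A H oDum → PMF (System O A H oDum × Policy O A)) : Prop :=
  ∀ k < K, ∀ s ∈ (craneRun M U plan k).support, ∀ x ∈ (plan s).support,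
    IsOptimistic r (confSet F β s.data) x

end

end

/-!
CRANE is optimistic, so the regret of the policy planned in round `k` is at most the horizon times
the `ℓ₁` distance of the trajectory laws of the model `f^k` and of the true system under `π^k`. The
proof bounds the sum of these distances by `√K` up to polynomial and logarithmic factors.

*Likelihood.* For every upper bracket `G` of the model class, the products over the data of
`G / ℙ` and of `√(G / ℙ) * exp (hellinger / 2)`, suitably normalized, are nonnegative
supermartingales started at one. By Markov's inequality, with probability at least `1 - δ` all of
them stay below `2 N K / δ`, for all brackets and rounds (`expect_ratioSum_le`,
`PMF.ofReal_le_toOuterMeasure`). Then the true system is in all confidence sets, and all models of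
the confidence sets are close to it, in summed squared `ℓ₁` distance, under the policies executed
before (`mem_confSet_of_prod_le`, `sum_sq_trajDist_le_of_prod_le`).

*Prediction.* The pseudoinverse of a core matrix turns the predictive state of a history into
coefficients that express all test probabilities after this history through those after the core
histories, with `ℓ₁` norm at most `1 / α` (`System.RegularAt.nonempty_predictor`). A predictor of
one system, applied to the states of another, has an error at each step; the distance of trajectory
laws telescopes into these errors (`trajDist_le_sum_predError`), and conversely the errors under a
policy are observed by its exploration policies (`predError_le`).

*Elimination of the number of observations.* The error of step `n` is the expectation, over the
history, of a sum of absolute values of linear functionals of the predictive state. Predictive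
states span a space of dimension at most `d_PSR`. In the coordinates of a barycentric spanner both
the expectation and the sum can be replaced by sums of at most `d_PSR` terms, up to a factor
polynomial in `d_PSR`, and the elliptical potential lemma shows that small errors on the earlier
rounds force small errors on average in the current one (`sum_average_abs_le`).

Summing up, the average regret is at most `ε` once `K * ε ^ 2` dominates a polynomial times
`(log K) ^ 2`, which a sample size polynomial in `log (1 / ε)` guarantees (`mul_sq_log_le`). If `ε`
is at least the horizon there is nothing to prove.
-/

/-! ### Barycentric spanners -/

/-- A finite family has a barycentric spanner: some subfamily, of length the dimension of the span,
expresses every member with coefficients in `[-1, 1]`.  A subfamily of largest determinant will do,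
by Cramer's rule. -/
theorem exists_barycentric_spanner {ι V : Type*} [Finite ι] [AddCommGroup V] [Module ℝ V]
    (x : ι → V) {r : ℕ} (hr : Module.finrank ℝ (Submodule.span ℝ (Set.range x)) = r) :
    ∃ (σ : Fin r → ι) (c : ι → Fin r → ℝ), (∀ i j, |c i j| ≤ 1) ∧
      ∀ i, x i = ∑ j, c i j • x (σ j) := by
  classical
  subst hr
  set W := Submodule.span ℝ (Set.range x) with hW
  have : Module.Finite ℝ W := FiniteDimensional.span_of_finite ℝ (Set.finite_range x)
  let x' : ι → W := fun i => ⟨x i, Submodule.subset_span ⟨i, rfl⟩⟩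
  let e := Module.finBasis ℝ W
  obtain ⟨f, hf, hspan, hli⟩ := Submodule.exists_fun_fin_finrank_span_eq ℝ (Set.range x)
  choose s₀ hs₀ using hf
  have hne : e.det (x' ∘ s₀) ≠ 0 := by
    refine ((Module.Basis.is_basis_iff_det e).1 ?_).ne_zero
    have hli' : LinearIndependent ℝ (x' ∘ s₀) := by
      refine LinearIndependent.of_comp W.subtype ?_
      have h : (W.subtype ∘ (x' ∘ s₀) : _ → V) = f := funext fun j => hs₀ j
      rw [h]
      exact hli
    exact ⟨hli', hli'.span_eq_top_of_card_eq_finrank' (by rw [Fintype.card_fin])⟩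
  have : Nonempty (Fin (Module.finrank ℝ W) → ι) := ⟨s₀⟩
  obtain ⟨s, hs⟩ := Finite.exists_max fun s : Fin (Module.finrank ℝ W) → ι => |e.det (x' ∘ s)|
  have hpos : 0 < |e.det (x' ∘ s)| := (abs_pos.2 hne).trans_le (hs s₀)
  obtain ⟨hli, hsp⟩ := (Module.Basis.is_basis_iff_det e).2 (abs_pos.1 hpos).isUnit
  let b := Module.Basis.mk hli hsp.ge
  refine ⟨s, fun i j => b.coord j (x' i), fun i j => ?_, fun i => ?_⟩
  · have h := congrArg (fun l => l (x' i)) (e.det_smul_mk_coord_eq_det_update hli hsp.ge j)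
    have h1 : e.det (x' ∘ s) * b.coord j (x' i) = e.det (x' ∘ Function.update s j i) := by
      rw [Function.comp_update]
      exact h
    have h2 := hs (Function.update s j i)
    rw [← h1, abs_mul] at h2
    exact (mul_le_iff_le_one_right hpos).1 h2
  · have h := congrArg W.subtype (b.sum_repr (x' i))
    rw [map_sum] at h
    refine h.symm.trans (Finset.sum_congr rfl fun j _ => ?_)
    rw [map_smul, Module.Basis.mk_apply]
    rfl

/-- A sum of absolute values of linear functionals on `ℝ^r` is equivalent, up to the factor `r`, to
one with only `r` terms: spread a barycentric spanner of the vectors `∑ ± z i`. -/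
theorem exists_dominating_functionals {ι : Type*} [Fintype ι] {r : ℕ} (z : ι → Fin r → ℝ) :
    ∃ y : Fin r → Fin r → ℝ, ∀ w : Fin r → ℝ,
      (∀ j, |y j ⬝ᵥ w| ≤ ∑ i, |z i ⬝ᵥ w|) ∧ ∑ i, |z i ⬝ᵥ w| ≤ ∑ j, |y j ⬝ᵥ w| := by
  classical
  let Y : (ι → Bool) → Fin r → ℝ := fun s => ∑ i, (if s i then (1 : ℝ) else -1) • z i
  set m := Module.finrank ℝ (Submodule.span ℝ (Set.range Y)) with hm
  obtain ⟨σ, c, hc, hY⟩ := exists_barycentric_spanner Y hm.symm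
  have hmr : m ≤ r := by
    simpa using Submodule.finrank_le (Submodule.span ℝ (Set.range Y))
  have hYw : ∀ s w, Y s ⬝ᵥ w = ∑ i, (if s i then (1 : ℝ) else -1) * (z i ⬝ᵥ w) := by
    intro s w
    simp only [Y, sum_dotProduct, smul_dotProduct, smul_eq_mul]
  have hle : ∀ s w, |Y s ⬝ᵥ w| ≤ ∑ i, |z i ⬝ᵥ w| := by
    intro s w
    rw [hYw]
    refine (Finset.abs_sum_le_sum_abs _ _).trans (Finset.sum_le_sum fun i _ => ?_)
    split_ifs <;> simp
  refine ⟨fun j => if h : (j : ℕ) < m then Y (σ ⟨j, h⟩) else 0, fun w => ⟨fun j => ?_, ?_⟩⟩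
  · by_cases h : (j : ℕ) < m
    · simpa [h] using hle (σ ⟨j, h⟩) w
    · simpa [h] using Finset.sum_nonneg fun i _ => abs_nonneg _
  · have h1 : ∑ i, |z i ⬝ᵥ w| = Y (fun i => decide (0 ≤ z i ⬝ᵥ w)) ⬝ᵥ w := by
      rw [hYw]
      refine Finset.sum_congr rfl fun i _ => ?_
      by_cases h : 0 ≤ z i ⬝ᵥ w
      · simp [h, abs_of_nonneg]
      · simp [h, abs_of_neg (not_le.1 h)]
    rw [h1, hY, sum_dotProduct]
    have h2 : ∑ j : Fin m, c (fun i => decide (0 ≤ z i ⬝ᵥ w)) j • Y (σ j) ⬝ᵥ w ≤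
        ∑ j : Fin m, |Y (σ j) ⬝ᵥ w| := by
      refine Finset.sum_le_sum fun j _ => ?_
      rw [smul_dotProduct, smul_eq_mul]
      refine (le_abs_self _).trans ?_
      rw [abs_mul]
      exact mul_le_of_le_one_left (abs_nonneg _) (hc _ _)
    refine h2.trans ?_
    calc ∑ j : Fin m, |Y (σ j) ⬝ᵥ w|
        = ∑ j ∈ Finset.univ.map (Fin.castLEEmb hmr),
            |(if h : (j : ℕ) < m then Y (σ ⟨j, h⟩) else 0) ⬝ᵥ w| := by
          rw [Finset.sum_map]
          simp
      _ ≤ _ := Finset.sum_le_sum_of_subset_of_nonneg (Finset.subset_univ _)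
          fun _ _ _ => abs_nonneg _

/-- Cauchy–Schwarz for the inner product of a positive definite matrix and its dual. -/
theorem sq_dotProduct_le_of_posDef {r : ℕ} {L : Matrix (Fin r) (Fin r) ℝ} (hL : L.PosDef)
    (v y : Fin r → ℝ) : (v ⬝ᵥ y) ^ 2 ≤ (v ⬝ᵥ L.mulVec v) * (y ⬝ᵥ L⁻¹.mulVec y) := by
  have hdet : IsUnit L.det := hL.det_pos.ne'.isUnit
  set z := L⁻¹.mulVec y with hz
  have hLz : L.mulVec z = y := by
    rw [hz, Matrix.mulVec_mulVec, Matrix.mul_nonsing_inv _ hdet, Matrix.one_mulVec]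
  have hsym : ∀ a b : Fin r → ℝ, a ⬝ᵥ L.mulVec b = b ⬝ᵥ L.mulVec a := by
    intro a b
    have hT : L.transpose = L := by simpa using hL.isHermitian.eq
    rw [Matrix.dotProduct_mulVec, ← Matrix.mulVec_transpose, hT, dotProduct_comm]
  have hnn : ∀ a : Fin r → ℝ, 0 ≤ a ⬝ᵥ L.mulVec a := fun a => by
    simpa using hL.posSemidef.dotProduct_mulVec_nonneg a
  have hq : ∀ t : ℝ, 0 ≤ (v ⬝ᵥ L.mulVec v) * (t * t) + (-2 * (v ⬝ᵥ y)) * t +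
      y ⬝ᵥ z := by
    intro t
    have h := hnn (t • v - z)
    have h2 : z ⬝ᵥ L.mulVec v = v ⬝ᵥ y := by rw [hsym, hLz]
    simp only [Matrix.mulVec_sub, Matrix.mulVec_smul, sub_dotProduct, dotProduct_sub,
      smul_dotProduct, dotProduct_smul, smul_eq_mul, hLz, h2] at h
    rw [dotProduct_comm z y] at h
    linarith
  have hd := discrim_le_zero hq
  rw [discrim] at hd
  nlinarith

/-! ### The elliptical potential -/

/-- The regularized Gram matrix `1 + ∑_{i < k} y_i y_iᵀ`. -/
noncomputable def gramMatrix {r : ℕ} (y : ℕ → Fin r → ℝ) (k : ℕ) : Matrix (Fin r) (Fin r) ℝ :=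
  1 + ∑ i ∈ Finset.range k, Matrix.vecMulVec (y i) (y i)

section gramMatrix

variable {r : ℕ} (y : ℕ → Fin r → ℝ)

theorem gramMatrix_posDef (k : ℕ) : (gramMatrix y k).PosDef := by
  refine Matrix.PosDef.one.add_posSemidef (Matrix.posSemidef_sum _ fun i _ => ?_)
  simpa using Matrix.posSemidef_vecMulVec_self_star (y i)

theorem dotProduct_gramMatrix_mulVec (k : ℕ) (v : Fin r → ℝ) :
    v ⬝ᵥ (gramMatrix y k).mulVec v = v ⬝ᵥ v + ∑ i ∈ Finset.range k, (v ⬝ᵥ y i) ^ 2 := by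
  rw [gramMatrix, Matrix.add_mulVec, Matrix.one_mulVec, dotProduct_add, Matrix.sum_mulVec,
    dotProduct_sum]
  congr 1
  refine Finset.sum_congr rfl fun i _ => ?_
  rw [Matrix.vecMulVec_mulVec, dotProduct_comm (y i) v]
  simp [sq]

/-- The elliptical norm of the next vector. -/
noncomputable def ellipticalNorm (k : ℕ) : ℝ := y k ⬝ᵥ (gramMatrix y k)⁻¹.mulVec (y k)

theorem det_gramMatrix_succ (k : ℕ) :
    (gramMatrix y (k + 1)).det = (gramMatrix y k).det * (1 + ellipticalNorm y k) := by
  have hdet : IsUnit (gramMatrix y k).det := (gramMatrix_posDef y k).det_pos.ne'.isUnit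
  have h1 : gramMatrix y (k + 1) = gramMatrix y k + Matrix.vecMulVec (y k) (y k) := by
    rw [gramMatrix, Finset.sum_range_succ, ← add_assoc, ← gramMatrix]
  rw [h1, Matrix.vecMulVec_eq Unit, Matrix.det_add_replicateCol_mul_replicateRow hdet]
  congr 1
  rw [Matrix.det_unique, Matrix.mul_assoc, Matrix.add_apply, Matrix.one_apply_eq,
    ← Matrix.replicateCol_mulVec, Matrix.replicateRow_mul_replicateCol_apply, ellipticalNorm]

theorem ellipticalNorm_mem (k : ℕ) (hy : ∀ j, |y k j| ≤ 1) :
    0 ≤ ellipticalNorm y k ∧ ellipticalNorm y k ≤ r := by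
  have hL := gramMatrix_posDef y k
  have hdet : IsUnit (gramMatrix y k).det := hL.det_pos.ne'.isUnit
  have h0 : 0 ≤ ellipticalNorm y k := by
    simpa [ellipticalNorm] using hL.inv.posSemidef.dotProduct_mulVec_nonneg (y k)
  refine ⟨h0, ?_⟩
  set z := (gramMatrix y k)⁻¹.mulVec (y k) with hz
  have hLz : (gramMatrix y k).mulVec z = y k := by
    rw [hz, Matrix.mulVec_mulVec, Matrix.mul_nonsing_inv _ hdet, Matrix.one_mulVec]
  have h1 : z ⬝ᵥ z ≤ ellipticalNorm y k := by
    have h := dotProduct_gramMatrix_mulVec y k z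
    rw [hLz, dotProduct_comm] at h
    rw [ellipticalNorm, h]
    have : 0 ≤ ∑ i ∈ Finset.range k, (z ⬝ᵥ y i) ^ 2 := Finset.sum_nonneg fun _ _ => sq_nonneg _
    linarith
  have h2 : (ellipticalNorm y k) ^ 2 ≤ (y k ⬝ᵥ y k) * (z ⬝ᵥ z) := by
    simpa [ellipticalNorm, dotProduct, sq, hz] using
      Finset.sum_mul_sq_le_sq_mul_sq Finset.univ (y k) z
  have h3 : y k ⬝ᵥ y k ≤ r := by
    calc y k ⬝ᵥ y k ≤ ∑ _j : Fin r, (1 : ℝ) := Finset.sum_le_sum fun j _ => by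
          have := abs_le.1 (hy j); nlinarith
      _ = r := by simp
  rcases h0.eq_or_lt with h | h
  · rw [← h]; positivity
  · have hzz : 0 ≤ z ⬝ᵥ z := Finset.sum_nonneg fun j _ => mul_self_nonneg (z j)
    have : ellipticalNorm y k ^ 2 ≤ r * ellipticalNorm y k :=
      h2.trans (mul_le_mul h3 h1 hzz (by positivity))
    nlinarith

theorem det_gramMatrix_le (k : ℕ) (hy : ∀ i < k, ∀ j, |y i j| ≤ 1) :
    (gramMatrix y k).det ≤ (r * (1 + k) : ℝ) ^ r := by
  have hL := gramMatrix_posDef y k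
  have htr : (gramMatrix y k).trace ≤ r * (1 + k) := by
    rw [gramMatrix, Matrix.trace_add, Matrix.trace_sum, Matrix.trace_one, Fintype.card_fin]
    have : ∑ i ∈ Finset.range k, (Matrix.vecMulVec (y i) (y i)).trace ≤
        ∑ i ∈ Finset.range k, (r : ℝ) := by
      refine Finset.sum_le_sum fun i hi => ?_
      rw [Matrix.trace_vecMulVec]
      calc y i ⬝ᵥ y i ≤ ∑ _j : Fin r, (1 : ℝ) := Finset.sum_le_sum fun j _ => by
            have := abs_le.1 (hy i (Finset.mem_range.1 hi) j); nlinarith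
        _ = r := by simp
    rw [Finset.sum_const, Finset.card_range, nsmul_eq_mul] at this
    linarith
  have h1 := hL.isHermitian.det_eq_prod_eigenvalues
  have h2 := hL.isHermitian.trace_eq_sum_eigenvalues
  simp only [RCLike.ofReal_real_eq_id, id] at h1 h2
  have h3 : ∀ i, hL.isHermitian.eigenvalues i ≤ r * (1 + k) := fun i => by
    refine le_trans ?_ (h2 ▸ htr)
    exact Finset.single_le_sum (f := hL.isHermitian.eigenvalues)
      (fun i _ => (hL.eigenvalues_pos i).le) (Finset.mem_univ i)
  rw [h1]
  calc _ ≤ ∏ _i : Fin r, (r * (1 + k) : ℝ) :=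
        Finset.prod_le_prod (fun i _ => (hL.eigenvalues_pos i).le) fun i _ => h3 i
    _ = _ := by simp

/-- The elliptical potential lemma. -/
theorem sum_ellipticalNorm_le (K : ℕ) (hy : ∀ i < K, ∀ j, |y i j| ≤ 1) :
    ∑ k ∈ Finset.range K, ellipticalNorm y k ≤ (1 + r) * (r * (r + Real.log (1 + K))) := by
  have hlog : Real.log (gramMatrix y K).det =
      ∑ k ∈ Finset.range K, Real.log (1 + ellipticalNorm y k) := by
    induction K with
    | zero => simp [gramMatrix]
    | succ k ih =>
      have h := ellipticalNorm_mem y k (hy k (Nat.lt_succ_self k))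
      rw [det_gramMatrix_succ, Real.log_mul (gramMatrix_posDef y k).det_pos.ne' (by linarith),
        ih fun i hi => hy i (by omega), Finset.sum_range_succ]
  have h1 : ∑ k ∈ Finset.range K, ellipticalNorm y k ≤
      ∑ k ∈ Finset.range K, (1 + r) * Real.log (1 + ellipticalNorm y k) := by
    refine Finset.sum_le_sum fun k hk => ?_
    obtain ⟨h0, hr⟩ := ellipticalNorm_mem y k (hy k (Finset.mem_range.1 hk))
    have h2 := Real.one_sub_inv_le_log_of_pos (show 0 < 1 + ellipticalNorm y k by linarith)
    have h3 : ellipticalNorm y k = (1 + ellipticalNorm y k) *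
        (1 - (1 + ellipticalNorm y k)⁻¹) := by
      field_simp; ring
    have h4 : 0 ≤ Real.log (1 + ellipticalNorm y k) := Real.log_nonneg (by linarith)
    calc ellipticalNorm y k = _ := h3
      _ ≤ (1 + ellipticalNorm y k) * Real.log (1 + ellipticalNorm y k) := by gcongr
      _ ≤ _ := by gcongr
  rw [← Finset.mul_sum, ← hlog] at h1
  refine h1.trans ?_
  gcongr
  rcases Nat.eq_zero_or_pos r with rfl | hr
  · simp
  have hr' : (0 : ℝ) < r := by exact_mod_cast hr
  calc Real.log (gramMatrix y K).det ≤ Real.log ((r * (1 + K) : ℝ) ^ r) :=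
        Real.log_le_log (gramMatrix_posDef y K).det_pos (det_gramMatrix_le y K hy)
    _ = r * (Real.log r + Real.log (1 + K)) := by
        rw [Real.log_pow, Real.log_mul hr'.ne' (by positivity)]
    _ ≤ _ := by
        gcongr
        exact Real.log_le_self hr'.le

end gramMatrix

/-- If each `v_k` is almost orthogonal to all earlier `y_i`, then the products `⟨v_k, y_k⟩` are
small on average. -/
theorem sum_abs_dotProduct_le {r : ℕ} (v y : ℕ → Fin r → ℝ) (K : ℕ) {R B : ℝ}
    (hy : ∀ i < K, ∀ j, |y i j| ≤ 1) (hv : ∀ i < K, ∀ j, |v i j| ≤ R)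
    (hB : ∀ k < K, ∑ i ∈ Finset.range k, (v k ⬝ᵥ y i) ^ 2 ≤ B) :
    ∑ k ∈ Finset.range K, |v k ⬝ᵥ y k| ≤
      √(K * ((r * R ^ 2 + B) * ((1 + r) * (r * (r + Real.log (1 + K)))))) := by
  rcases Nat.eq_zero_or_pos K with rfl | hK
  · simp
  have hB0 : 0 ≤ B := by simpa using hB 0 hK
  refine Real.le_sqrt_of_sq_le ?_
  refine sq_sum_le_card_mul_sum_sq.trans ?_
  rw [Finset.card_range]
  gcongr
  calc ∑ k ∈ Finset.range K, |v k ⬝ᵥ y k| ^ 2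
      ≤ ∑ k ∈ Finset.range K, (r * R ^ 2 + B) * ellipticalNorm y k := by
        refine Finset.sum_le_sum fun k hk => ?_
        have hk := Finset.mem_range.1 hk
        rw [sq_abs]
        refine (sq_dotProduct_le_of_posDef (gramMatrix_posDef y k) _ _).trans ?_
        refine mul_le_mul_of_nonneg_right ?_ (ellipticalNorm_mem y k (hy k hk)).1
        rw [dotProduct_gramMatrix_mulVec]
        refine add_le_add ?_ (hB k hk)
        calc v k ⬝ᵥ v k ≤ ∑ _j : Fin r, R ^ 2 := Finset.sum_le_sum fun j _ => by
              rw [← sq, ← sq_abs]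
              exact pow_le_pow_left₀ (abs_nonneg _) (hv k hk j) 2
          _ = _ := by simp
    _ ≤ _ := by
        rw [← Finset.mul_sum]
        exact mul_le_mul_of_nonneg_left (sum_ellipticalNorm_le y K hy) (by positivity)

/-! ### The `ℓ₁` eluder argument -/

/-- The generalized `ℓ₁` eluder lemma.  The functionals `w k l`, summed over `l`, are small on
average under each of the earlier distributions `p i` of the vectors `x τ`; then they are also small
under `p k`, up to a factor polynomial in the dimension `d` of the span of the vectors.  Neither the
number of vectors nor the number of functionals enters: in the coordinates of a barycentric
spanner of the vectors, both the sum over `l` and the average over `τ` are equivalent to sums of `d`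
terms, which leaves `d²` scalar problems for the elliptical potential. -/
theorem sum_average_abs_le {T L V : Type*} [Fintype T] [Fintype L] [AddCommGroup V] [Module ℝ V]
    (x : T → V) {d : ℕ} (hd : Module.finrank ℝ (Submodule.span ℝ (Set.range x)) ≤ d)
    (p : ℕ → T → ℝ) (hp : ∀ i τ, 0 ≤ p i τ) (hp1 : ∀ i, ∑ τ, p i τ ≤ 1)
    (w : ℕ → L → V →ₗ[ℝ] ℝ) (K : ℕ) {R B : ℝ} (hB0 : 0 ≤ B)
    (hR : ∀ k < K, ∀ τ, ∑ l, |w k l (x τ)| ≤ R)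
    (hB : ∀ k < K, ∑ i ∈ Finset.range k, (∑ τ, p i τ * ∑ l, |w k l (x τ)|) ^ 2 ≤ B) :
    ∑ k ∈ Finset.range K, ∑ τ, p k τ * ∑ l, |w k l (x τ)| ≤
      d ^ 2 * √(K * ((d * R ^ 2 + B) * ((1 + d) * (d * (d + Real.log (1 + K)))))) := by
  obtain ⟨r, hr⟩ : ∃ r, Module.finrank ℝ (Submodule.span ℝ (Set.range x)) = r := ⟨_, rfl⟩
  have hrd : r ≤ d := hr ▸ hd
  obtain ⟨σ, c, hc, hx⟩ := exists_barycentric_spanner x hr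
  let ω : ℕ → L → Fin r → ℝ := fun k l j => w k l (x (σ j))
  have hw : ∀ k l τ, w k l (x τ) = ω k l ⬝ᵥ c τ := by
    intro k l τ
    rw [hx τ, map_sum]
    simp only [map_smul, smul_eq_mul, ω, dotProduct]
    exact Finset.sum_congr rfl fun j _ => mul_comm _ _
  choose v hv using fun k => exists_dominating_functionals (ω k)
  choose y hy using fun i => exists_dominating_functionals fun τ => p i τ • c τ
  have hz : ∀ i τ u, |(p i τ • c τ) ⬝ᵥ u| = p i τ * |u ⬝ᵥ c τ| := by
    intro i τ u
    rw [smul_dotProduct, smul_eq_mul, abs_mul, abs_of_nonneg (hp i τ), dotProduct_comm]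
  simp only [hz] at hy
  simp only [hw] at hR hB ⊢
  set φ : ℕ → ℕ → ℝ := fun k i => ∑ τ, p i τ * ∑ l, |ω k l ⬝ᵥ c τ| with hφ
  have hφ_le : ∀ k i, φ k i ≤ ∑ j, ∑ m, |v k j ⬝ᵥ y i m| := by
    intro k i
    calc φ k i ≤ ∑ τ, p i τ * ∑ j, |v k j ⬝ᵥ c τ| :=
          Finset.sum_le_sum fun τ _ => mul_le_mul_of_nonneg_left (hv k (c τ)).2 (hp i τ)
      _ = ∑ j, ∑ τ, p i τ * |v k j ⬝ᵥ c τ| := by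
          rw [Finset.sum_comm]
          simp only [Finset.mul_sum]
      _ ≤ _ := Finset.sum_le_sum fun j _ => by
          simpa only [dotProduct_comm] using (hy i (v k j)).2
  have hle_φ : ∀ k i j m, |v k j ⬝ᵥ y i m| ≤ φ k i := by
    intro k i j m
    rw [dotProduct_comm]
    refine ((hy i (v k j)).1 m).trans ?_
    exact Finset.sum_le_sum fun τ _ => mul_le_mul_of_nonneg_left ((hv k (c τ)).1 j) (hp i τ)
  have hy1 : ∀ i m a, |y i m a| ≤ 1 := by
    intro i m a
    have h := (hy i (Pi.single a 1)).1 m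
    simp only [dotProduct_single_one, single_one_dotProduct] at h
    refine h.trans (le_trans ?_ (hp1 i))
    exact Finset.sum_le_sum fun τ _ => mul_le_of_le_one_right (hp i τ) (hc τ a)
  have hvR : ∀ k < K, ∀ j a, |v k j a| ≤ R := by
    intro k hk j a
    have h := (hv k (Pi.single a 1)).1 j
    simp only [dotProduct_single_one] at h
    refine h.trans (le_trans (le_of_eq ?_) (hR k hk (σ a)))
    exact Finset.sum_congr rfl fun l _ => by rw [← hw]
  have hscalar : ∀ j m : Fin r, ∑ k ∈ Finset.range K, |v k j ⬝ᵥ y k m| ≤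
      √(K * ((r * R ^ 2 + B) * ((1 + r) * (r * (r + Real.log (1 + K)))))) := by
    intro j m
    refine sum_abs_dotProduct_le (fun k => v k j) (fun k => y k m) K (fun i _ => hy1 i m)
      (fun k hk => hvR k hk j) fun k hk => le_trans ?_ (hB k hk)
    refine Finset.sum_le_sum fun i _ => ?_
    rw [← sq_abs]
    exact pow_le_pow_left₀ (abs_nonneg _) (hle_φ k i j m) 2
  have hrd' : (r : ℝ) ≤ d := by exact_mod_cast hrd
  have hlog : 0 ≤ Real.log (1 + K) := Real.log_nonneg (by simp)
  calc ∑ k ∈ Finset.range K, φ k k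
      ≤ ∑ k ∈ Finset.range K, ∑ j, ∑ m, |v k j ⬝ᵥ y k m| :=
        Finset.sum_le_sum fun k _ => hφ_le k k
    _ = ∑ j, ∑ m, ∑ k ∈ Finset.range K, |v k j ⬝ᵥ y k m| := by
        rw [Finset.sum_comm]
        exact Finset.sum_congr rfl fun j _ => Finset.sum_comm
    _ ≤ ∑ _j : Fin r, ∑ _m : Fin r,
          √(K * ((r * R ^ 2 + B) * ((1 + r) * (r * (r + Real.log (1 + K)))))) :=
        Finset.sum_le_sum fun j _ => Finset.sum_le_sum fun m _ => hscalar j m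
    _ = r ^ 2 * √(K * ((r * R ^ 2 + B) * ((1 + r) * (r * (r + Real.log (1 + K)))))) := by
        simp [← mul_assoc, sq]
    _ ≤ _ := by gcongr

/-! ### Sums over histories and the probabilities of trajectories -/

/-- The sum of `g` over all lists of length `n`. -/
def histSum {X : Type*} [Fintype X] (n : ℕ) (g : List X → ℝ) : ℝ :=
  ∑ τ : Fin n → X, g (List.ofFn τ)

section histSum

variable {X : Type*} [Fintype X]

@[simp]
theorem histSum_zero (g : List X → ℝ) : histSum 0 g = g [] := by
  simp [histSum]

theorem histSum_succ (n : ℕ) (g : List X → ℝ) :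
    histSum (n + 1) g = ∑ x, histSum n fun τ => g (x :: τ) := by
  simp only [histSum]
  rw [← Fintype.sum_prod_type', ← (Fin.consEquiv fun _ => X).sum_comp]
  simp [Fin.consEquiv]

theorem histSum_append (n m : ℕ) (g : List X → ℝ) :
    histSum (n + m) g = histSum n fun τ => histSum m fun ρ => g (τ ++ ρ) := by
  induction n generalizing g with
  | zero => simp
  | succ n ih =>
    rw [show n + 1 + m = n + m + 1 by omega, histSum_succ, histSum_succ]
    exact Finset.sum_congr rfl fun x _ => by rw [ih]; rfl

theorem histSum_one (g : List X → ℝ) : histSum 1 g = ∑ x, g [x] := by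
  rw [histSum_succ]; simp

theorem histSum_mono {n : ℕ} {g g' : List X → ℝ} (h : ∀ τ, τ.length = n → g τ ≤ g' τ) :
    histSum n g ≤ histSum n g' :=
  Finset.sum_le_sum fun τ _ => h _ (by simp)

theorem histSum_congr {n : ℕ} {g g' : List X → ℝ} (h : ∀ τ, τ.length = n → g τ = g' τ) :
    histSum n g = histSum n g' :=
  Finset.sum_congr rfl fun τ _ => h _ (by simp)

theorem histSum_nonneg {n : ℕ} {g : List X → ℝ} (h : ∀ τ, 0 ≤ g τ) : 0 ≤ histSum n g :=
  Finset.sum_nonneg fun _ _ => h _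

theorem mul_histSum (n : ℕ) (c : ℝ) (g : List X → ℝ) :
    c * histSum n g = histSum n fun τ => c * g τ :=
  Finset.mul_sum _ _ _

theorem histSum_add (n : ℕ) (g g' : List X → ℝ) :
    histSum n (fun τ => g τ + g' τ) = histSum n g + histSum n g' :=
  Finset.sum_add_distrib

theorem histSum_sub (n : ℕ) (g g' : List X → ℝ) :
    histSum n (fun τ => g τ - g' τ) = histSum n g - histSum n g' :=
  Finset.sum_sub_distrib _ _

theorem abs_histSum_le (n : ℕ) (g : List X → ℝ) : |histSum n g| ≤ histSum n fun τ => |g τ| :=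
  Finset.abs_sum_le_sum_abs _ _

theorem histSum_sum_comm {ι : Type*} (n : ℕ) (s : Finset ι) (g : ι → List X → ℝ) :
    histSum n (fun τ => ∑ i ∈ s, g i τ) = ∑ i ∈ s, histSum n (g i) :=
  Finset.sum_comm

end histSum

theorem PMF.sum_toReal {X : Type*} [Fintype X] (p : PMF X) : ∑ x, (p x).toReal = 1 := by
  rw [← ENNReal.toReal_sum fun x _ => p.apply_ne_top x, ← tsum_fintype (L := .unconditional X),
    p.tsum_coe, ENNReal.toReal_one]

theorem PMF.toReal_le_one {X : Type*} (p : PMF X) (x : X) : (p x).toReal ≤ 1 :=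
  ENNReal.toReal_le_of_le_ofReal zero_le_one (by simpa using p.coe_le_one x)

section trajectories

variable {O A : Type*} {H : ℕ} {oDum : O}

/-- The probability that `π`, after the history `τ`, takes the actions of the continuation `ρ` when
it sees the observations of `ρ`. -/
noncomputable def polWeight (π : Policy O A) : List (O × A) → List (O × A) → ℝ
  | _, [] => 1
  | τ, x :: ρ => (π τ x.1 x.2).toReal * polWeight π (τ ++ [x]) ρ

theorem polWeight_nonneg (π : Policy O A) (τ ρ : List (O × A)) : 0 ≤ polWeight π τ ρ := by
  induction ρ generalizing τ with
  | nil => simp [polWeight]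
  | cons x ρ ih => exact mul_nonneg ENNReal.toReal_nonneg (ih _)

theorem polWeight_append (π : Policy O A) (τ ρ ρ' : List (O × A)) :
    polWeight π τ (ρ ++ ρ') = polWeight π τ ρ * polWeight π (τ ++ ρ) ρ' := by
  induction ρ generalizing τ with
  | nil => simp [polWeight]
  | cons x ρ ih => simp [polWeight, ih, mul_assoc]

theorem polWeight_le_one (π : Policy O A) (τ ρ : List (O × A)) : polWeight π τ ρ ≤ 1 := by
  induction ρ generalizing τ with
  | nil => simp [polWeight]
  | cons x ρ ih =>
    exact mul_le_one₀ (PMF.toReal_le_one _ _) (polWeight_nonneg _ _ _) (ih _)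

theorem polWeight_congr {π π' : Policy O A} (τ ρ : List (O × A))
    (h : ∀ σ o, σ.length < τ.length + ρ.length → π σ o = π' σ o) :
    polWeight π τ ρ = polWeight π' τ ρ := by
  induction ρ generalizing τ with
  | nil => rfl
  | cons x ρ ih =>
    rw [polWeight, polWeight, h τ x.1 (by simp), ih (τ ++ [x]) fun σ o hσ => h σ o ?_]
    simp only [List.length_append, List.length_cons, List.length_nil] at hσ ⊢
    omega

namespace System

/-- The probability of the observations of `ρ` after the history `τ` when the actions of `ρ` are
actively executed. -/
noncomputable def doWeight (M : System O A H oDum) : List (O × A) → List (O × A) → ℝ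
  | _, [] => 1
  | τ, x :: ρ => (M.obs τ x.1).toReal * doWeight M (τ ++ [x]) ρ

variable (M : System O A H oDum)

theorem doWeight_nonneg (τ ρ : List (O × A)) : 0 ≤ M.doWeight τ ρ := by
  induction ρ generalizing τ with
  | nil => simp [doWeight]
  | cons x ρ ih => exact mul_nonneg ENNReal.toReal_nonneg (ih _)

theorem doWeight_le_one (τ ρ : List (O × A)) : M.doWeight τ ρ ≤ 1 := by
  induction ρ generalizing τ with
  | nil => simp [doWeight]
  | cons x ρ ih =>
    exact mul_le_one₀ (PMF.toReal_le_one _ _) (M.doWeight_nonneg _ _) (ih _)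

theorem doWeight_append (τ ρ ρ' : List (O × A)) :
    M.doWeight τ (ρ ++ ρ') = M.doWeight τ ρ * M.doWeight (τ ++ ρ) ρ' := by
  induction ρ generalizing τ with
  | nil => simp [doWeight]
  | cons x ρ ih => simp [doWeight, ih, mul_assoc]

theorem doProb_eq (τ ρ : List (O × A)) (o : O) :
    M.doProb τ ρ o = M.doWeight τ ρ * (M.obs (τ ++ ρ) o).toReal := by
  induction ρ generalizing τ with
  | nil => simp [doProb, doWeight]
  | cons x ρ ih => simp [doProb, doWeight, ih, mul_assoc]

theorem doProb_nonneg (τ ρ : List (O × A)) (o : O) : 0 ≤ M.doProb τ ρ o := by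
  rw [doProb_eq]
  exact mul_nonneg (M.doWeight_nonneg _ _) ENNReal.toReal_nonneg

theorem traj_succ_nil (π : Policy O A) (n : ℕ) : M.traj π (n + 1) [] = 0 := by
  simp [traj]

theorem traj_succ_append (π : Policy O A) (n : ℕ) (τ : List (O × A)) (x : O × A) :
    M.traj π (n + 1) (τ ++ [x]) = M.traj π n τ * (M.obs τ x.1 * π τ x.1 x.2) := by
  classical
  simp only [traj, PMF.bind_apply, PMF.pure_apply]
  rw [tsum_eq_single τ, tsum_eq_single x.1, tsum_eq_single x.2]
  · simp
  · intro a ha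
    rw [if_neg, mul_zero]
    intro h
    simp only [List.append_cancel_left_eq, List.cons.injEq, and_true] at h
    exact ha (by rw [h])
  · intro o ho
    rw [ENNReal.tsum_eq_zero.2 fun a => ?_, mul_zero]
    rw [if_neg, mul_zero]
    intro h
    simp only [List.append_cancel_left_eq, List.cons.injEq, and_true] at h
    exact ho (by rw [h])
  · intro σ hσ
    rw [ENNReal.tsum_eq_zero.2 fun o => ?_, mul_zero]
    rw [ENNReal.tsum_eq_zero.2 fun a => ?_, mul_zero]
    rw [if_neg, mul_zero]
    intro h
    exact hσ (List.append_inj_left' h rfl).symm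

theorem traj_toReal (π : Policy O A) (n : ℕ) (τ : List (O × A)) :
    (M.traj π n τ).toReal =
      if τ.length = n then M.doWeight [] τ * polWeight π [] τ else 0 := by
  induction n generalizing τ with
  | zero =>
    rcases eq_or_ne τ [] with rfl | h
    · simp [traj, doWeight, polWeight]
    · simp [traj, h]
  | succ n ih =>
    rcases List.eq_nil_or_concat' τ with rfl | ⟨σ, x, rfl⟩
    · simp [traj_succ_nil]
    · rw [traj_succ_append, ENNReal.toReal_mul, ENNReal.toReal_mul, ih, doWeight_append,
        polWeight_append]
      simp only [List.length_append, List.length_singleton, add_left_inj, doWeight, polWeight,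
        List.nil_append, mul_one]
      split_ifs <;> ring

theorem prob_eq (π : Policy O A) (τ : Fin H → O × A) :
    M.prob π τ = M.doWeight [] (List.ofFn τ) * polWeight π [] (List.ofFn τ) := by
  simp [prob, traj_toReal]

theorem traj_length {π : Policy O A} {n : ℕ} {τ : List (O × A)} (h : M.traj π n τ ≠ 0) :
    τ.length = n := by
  by_contra hn
  have := M.traj_toReal π n τ
  rw [if_neg hn, ENNReal.toReal_eq_zero_iff] at this
  exact this.elim h ((M.traj π n).apply_ne_top τ)

theorem reachable_of_doWeight_ne_zero [Fintype A] [Nonempty A] {τ : List (O × A)}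
    (h : M.doWeight [] τ ≠ 0) : M.Reachable τ := by
  refine ⟨fun _ _ => PMF.uniformOfFintype A, fun h0 => ?_⟩
  have h1 := M.traj_toReal (fun _ _ => PMF.uniformOfFintype A) τ.length τ
  rw [h0, if_pos rfl, ENNReal.toReal_zero, zero_eq_mul, or_iff_right h] at h1
  have h2 : ∀ σ ρ : List (O × A), 0 < polWeight (fun _ _ => PMF.uniformOfFintype A) σ ρ := by
    intro σ ρ
    induction ρ generalizing σ with
    | nil => simp [polWeight]
    | cons x ρ ih =>
      refine mul_pos ?_ (ih _)
      simp [Fintype.card_pos]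
  exact (h2 _ _).ne' h1

theorem doWeight_ne_zero_of_reachable {τ : List (O × A)} (h : M.Reachable τ) :
    M.doWeight [] τ ≠ 0 := by
  obtain ⟨π, hπ⟩ := h
  intro h0
  have h1 := M.traj_toReal π τ.length τ
  rw [if_pos rfl, h0, zero_mul, ENNReal.toReal_eq_zero_iff] at h1
  exact h1.elim hπ ((M.traj π _).apply_ne_top τ)

theorem doWeight_mul_testProb [Fintype A] [Nonempty A] (τ : List (O × A)) (t : Test O A) :
    M.doWeight [] τ * M.testProb τ t = M.doWeight [] τ * M.doProb τ t.1 t.2 := by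
  by_cases h : M.Reachable τ
  · rw [testProb, if_pos h]
  · have : M.doWeight [] τ = 0 := by
      by_contra h'
      exact h (M.reachable_of_doWeight_ne_zero h')
    rw [this, zero_mul, zero_mul]

theorem testProb_nonneg (τ : List (O × A)) (t : Test O A) : 0 ≤ M.testProb τ t := by
  unfold testProb
  split_ifs
  exacts [M.doProb_nonneg _ _ _, le_rfl]

theorem testProb_le_doProb (τ : List (O × A)) (t : Test O A) :
    M.testProb τ t ≤ M.doProb τ t.1 t.2 := by
  unfold testProb
  split_ifs
  exacts [le_rfl, M.doProb_nonneg _ _ _]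

/-- The probability of a test, peeled off after its first step. -/
theorem testProb_cons [Fintype A] [Nonempty A] (τ : List (O × A)) (x : O × A) (t : Test O A) :
    M.testProb τ (x :: t.1, t.2) = (M.obs τ x.1).toReal * M.testProb (τ ++ [x]) t := by
  have hw : M.doWeight [] (τ ++ [x]) = M.doWeight [] τ * (M.obs τ x.1).toReal := by
    rw [doWeight_append]; simp [doWeight]
  by_cases h : M.Reachable τ
  · rw [testProb, if_pos h, doProb]
    by_cases h0 : (M.obs τ x.1).toReal = 0
    · rw [h0, zero_mul, zero_mul]
    · have : M.Reachable (τ ++ [x]) := M.reachable_of_doWeight_ne_zero (by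
        rw [hw]; exact mul_ne_zero (M.doWeight_ne_zero_of_reachable h) h0)
      rw [testProb, if_pos this]
  · have : ¬ M.Reachable (τ ++ [x]) := fun h' => h (M.reachable_of_doWeight_ne_zero fun h0 =>
      M.doWeight_ne_zero_of_reachable h' (by rw [hw, h0, zero_mul]))
    rw [testProb, if_neg h, testProb, if_neg this, mul_zero]

variable [Fintype O] [Fintype A]

/-- The weights of the continuations of a given length sum to one, even if the system and the
policy start from different histories. -/
theorem histSum_polWeight_mul_doWeight (π : Policy O A) (m : ℕ) (σ τ : List (O × A)) :
    histSum m (fun ρ => polWeight π σ ρ * M.doWeight τ ρ) = 1 := by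
  induction m generalizing σ τ with
  | zero => simp [polWeight, doWeight]
  | succ m ih =>
    rw [histSum_succ]
    have : ∀ x : O × A, histSum m (fun ρ => polWeight π σ (x :: ρ) * M.doWeight τ (x :: ρ)) =
        (M.obs τ x.1).toReal * (π σ x.1 x.2).toReal := by
      intro x
      rw [← mul_one ((M.obs τ x.1).toReal * _), ← ih (σ ++ [x]) (τ ++ [x]), mul_histSum]
      exact histSum_congr fun ρ _ => by simp only [polWeight, doWeight]; ring
    simp only [this]
    rw [Fintype.sum_prod_type]
    simp only [← Finset.mul_sum, PMF.sum_toReal, mul_one]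

/-- The `ℓ₁` distance of the trajectory laws of two systems under the policy `π`. -/
noncomputable def trajDist (f g : System O A H oDum) (π : Policy O A) : ℝ :=
  ∑ τ, |f.prob π τ - g.prob π τ|

theorem trajDist_eq (f g : System O A H oDum) (π : Policy O A) :
    f.trajDist g π =
      histSum H fun τ => polWeight π [] τ * |f.doWeight [] τ - g.doWeight [] τ| := by
  refine Finset.sum_congr rfl fun τ _ => ?_
  rw [prob_eq, prob_eq, ← sub_mul, abs_mul, abs_of_nonneg (polWeight_nonneg _ _ _), mul_comm]

theorem trajDist_nonneg (f g : System O A H oDum) (π : Policy O A) : 0 ≤ f.trajDist g π :=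
  Finset.sum_nonneg fun _ _ => abs_nonneg _

/-- Continuing two weighted systems can only increase the distance of the weights. -/
theorem abs_sub_le_histSum (f g : System O A H oDum) (π : Policy O A) (m : ℕ)
    (τ : List (O × A)) (c c' : ℝ) :
    |c - c'| ≤
      histSum m fun ρ => polWeight π τ ρ * |c * f.doWeight τ ρ - c' * g.doWeight τ ρ| := by
  have h : c - c' = histSum m fun ρ =>
      polWeight π τ ρ * (c * f.doWeight τ ρ - c' * g.doWeight τ ρ) := by
    have hf := congrArg (c * ·) (f.histSum_polWeight_mul_doWeight π m τ τ)
    have hg := congrArg (c' * ·) (g.histSum_polWeight_mul_doWeight π m τ τ)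
    simp only [mul_histSum, mul_one] at hf hg
    conv_lhs => rw [← hf, ← hg, ← histSum_sub]
    exact histSum_congr fun ρ _ => by ring
  rw [h]
  refine (abs_histSum_le _ _).trans (histSum_mono fun ρ _ => ?_)
  rw [abs_mul, abs_of_nonneg (polWeight_nonneg _ _ _)]

end System

end trajectories

/-! ### Tests with a given action sequence, and exploration -/

section explore

variable {O A : Type*} {H : ℕ} {oDum : O}

/-- Once all actions have been taken, all systems agree. -/
theorem System.doProb_eq_of_length_le (f g : System O A H oDum) (τ ρ : List (O × A)) (o : O)
    (h : H ≤ τ.length) : f.doProb τ ρ o = g.doProb τ ρ o := by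
  induction ρ generalizing τ with
  | nil => rw [doProb, doProb, f.obs_after τ h, g.obs_after τ h]
  | cons x ρ ih =>
    rw [doProb, doProb, f.obs_after τ h, g.obs_after τ h, ih _ (by simp; omega)]

variable [Fintype A] [Nonempty A]

theorem explore_of_lt (π : Policy O A) {h : ℕ} (u : List A) {τ : List (O × A)} (o : O)
    (hτ : τ.length + 1 < h) : explore π h u τ o = π τ o := by
  rw [explore, if_pos hτ]

theorem explore_of_eq (π : Policy O A) {h : ℕ} (u : List A) {τ : List (O × A)} (o : O)
    (hτ : τ.length + 1 = h) : explore π h u τ o = PMF.uniformOfFintype A := by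
  rw [explore, if_neg (by omega), if_pos (by omega)]

theorem explore_of_ge (π : Policy O A) {h : ℕ} (u : List A) {τ : List (O × A)} (o : O) {j : ℕ}
    (hj : j < u.length) (hτ : τ.length = h + j) : explore π h u τ o = PMF.pure u[j] := by
  rw [explore, if_neg (by omega), if_neg (by omega), hτ, Nat.add_sub_cancel_left,
    List.getElem?_eq_getElem hj]

theorem polWeight_explore (π : Policy O A) {n : ℕ} (u : List A) {τ : List (O × A)}
    (hτ : τ.length = n) (x : O × A) :
    polWeight π [] τ = Fintype.card A * polWeight (explore π (n + 1) u) [] (τ ++ [x]) := by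
  have hA : (Fintype.card A : ℝ) ≠ 0 := by exact_mod_cast Fintype.card_ne_zero
  rw [polWeight_append, List.nil_append,
    polWeight_congr (π := explore π (n + 1) u) (π' := π) [] τ fun σ o hσ =>
      explore_of_lt π u o (by simpa [hτ] using hσ)]
  rw [polWeight, polWeight, explore_of_eq π u x.1 (by omega)]
  simp
  field_simp

end explore

section obsTests

variable {O A : Type*} {H : ℕ} {oDum : O} [Fintype O]

/-- All the tests with a given action sequence. -/
def obsTests : List A → Finset (Test O A)
  | [] => Finset.univ.map ⟨fun o => ([], o), fun _ _ h => congrArg Prod.snd h⟩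
  | a :: u => (Finset.univ ×ˢ obsTests u).map
      ⟨fun p => ((p.1, a) :: p.2.1, p.2.2), fun p q h => by
        simp only [Prod.mk.injEq, List.cons.injEq, and_true] at h
        exact Prod.ext h.1.1 (Prod.ext h.1.2 h.2)⟩

theorem sum_obsTests_nil (g : Test O A → ℝ) : ∑ t ∈ obsTests [], g t = ∑ o, g ([], o) := by
  simp only [obsTests, Finset.sum_map]
  rfl

theorem sum_obsTests_cons (a : A) (u : List A) (g : Test O A → ℝ) :
    ∑ t ∈ obsTests (a :: u), g t = ∑ o, ∑ t ∈ obsTests u, g ((o, a) :: t.1, t.2) := by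
  simp only [obsTests, Finset.sum_map, Finset.sum_product]
  rfl

theorem mem_obsTests (t : Test O A) : t ∈ obsTests t.actions := by
  obtain ⟨ρ, o⟩ := t
  induction ρ with
  | nil => exact Finset.mem_map.2 ⟨o, Finset.mem_univ _, rfl⟩
  | cons x ρ ih =>
    refine Finset.mem_map.2 ⟨(x.1, (ρ, o)), ?_, rfl⟩
    exact Finset.mem_product.2 ⟨Finset.mem_univ _, ih⟩

/-- A sum over a set of tests is at most the sum over all tests with the same action sequences. -/
theorem sum_le_sum_obsTests (U : Finset (Test O A)) (g : Test O A → ℝ) (hg : ∀ t, 0 ≤ g t) :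
    ∑ t ∈ U, g t ≤ ∑ u ∈ actionSeqs U, ∑ t ∈ obsTests u, g t := by
  classical
  rw [← Finset.sum_fiberwise_of_maps_to (s := U) (t := actionSeqs U) (g := Test.actions)
    fun t ht => by unfold actionSeqs; convert Finset.mem_image_of_mem Test.actions ht]
  refine Finset.sum_le_sum fun u _ => Finset.sum_le_sum_of_subset_of_nonneg ?_ fun _ _ _ => hg _
  intro t ht
  rw [← (Finset.mem_filter.1 ht).2]
  exact mem_obsTests t

theorem System.sum_doProb_obsTests (M : System O A H oDum) (u : List A) (τ : List (O × A)) :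
    ∑ t ∈ obsTests u, M.doProb τ t.1 t.2 = 1 := by
  induction u generalizing τ with
  | nil => rw [sum_obsTests_nil]; simp [doProb, PMF.sum_toReal]
  | cons a u ih =>
    rw [sum_obsTests_cons]
    simp only [doProb, ← Finset.mul_sum, ih, mul_one, PMF.sum_toReal]

theorem System.sum_testProb_le (M : System O A H oDum) (U : Finset (Test O A))
    (τ : List (O × A)) : ∑ t ∈ U, M.testProb τ t ≤ (actionSeqs U).card := by
  refine (Finset.sum_le_sum fun t _ => M.testProb_le_doProb τ t).trans ?_
  refine (sum_le_sum_obsTests U _ fun t => M.doProb_nonneg τ t.1 t.2).trans ?_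
  simp [M.sum_doProb_obsTests]

variable [Fintype A]

/-- If a policy takes the actions of `u` after the history `τ`, then the distance of two weighted
systems on the tests with the action sequence `u` is at most their distance on the trajectories
under this policy.  This includes tests that extend beyond the horizon, where systems agree. -/
theorem System.sum_obsTests_abs_sub_le (f g : System O A H oDum) (π : Policy O A) (m : ℕ)
    (τ : List (O × A)) (hm : τ.length + m = H) (u : List A)
    (hu : ∀ (j : ℕ) (hj : j < u.length) (σ : List (O × A)) (o : O),
      σ.length = τ.length + j → π σ o = PMF.pure u[j]) (c c' : ℝ) :
    ∑ t ∈ obsTests u, |c * f.doProb τ t.1 t.2 - c' * g.doProb τ t.1 t.2| ≤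
      histSum m fun ρ => polWeight π τ ρ * |c * f.doWeight τ ρ - c' * g.doWeight τ ρ| := by
  classical
  induction m generalizing τ u c c' with
  | zero =>
    have h : ∀ t : Test O A, |c * f.doProb τ t.1 t.2 - c' * g.doProb τ t.1 t.2| =
        |c - c'| * f.doProb τ t.1 t.2 := by
      intro t
      rw [g.doProb_eq_of_length_le f τ t.1 t.2 (by omega), ← sub_mul, abs_mul,
        abs_of_nonneg (f.doProb_nonneg _ _ _)]
    simp [h, ← Finset.mul_sum, f.sum_doProb_obsTests, polWeight, doWeight]
  | succ m ih =>
    have hstep : ∀ x : O × A, histSum m (fun ρ => polWeight π τ (x :: ρ) *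
        |c * f.doWeight τ (x :: ρ) - c' * g.doWeight τ (x :: ρ)|) =
        (π τ x.1 x.2).toReal * histSum m fun ρ => polWeight π (τ ++ [x]) ρ *
          |(c * (f.obs τ x.1).toReal) * f.doWeight (τ ++ [x]) ρ -
            (c' * (g.obs τ x.1).toReal) * g.doWeight (τ ++ [x]) ρ| := by
      intro x
      rw [mul_histSum]
      exact histSum_congr fun ρ _ => by simp only [polWeight, doWeight, mul_assoc]
    rw [histSum_succ]
    simp only [hstep]
    rw [Fintype.sum_prod_type]
    cases u with
    | nil =>
      rw [sum_obsTests_nil]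
      refine Finset.sum_le_sum fun o _ => ?_
      calc |c * f.doProb τ [] o - c' * g.doProb τ [] o|
          = ∑ a, (π τ o a).toReal * |c * (f.obs τ o).toReal - c' * (g.obs τ o).toReal| := by
            rw [← Finset.sum_mul, PMF.sum_toReal, one_mul, doProb, doProb]
        _ ≤ _ := Finset.sum_le_sum fun a _ => mul_le_mul_of_nonneg_left
            (abs_sub_le_histSum f g π m _ _ _) ENNReal.toReal_nonneg
    | cons b u =>
      rw [sum_obsTests_cons]
      refine Finset.sum_le_sum fun o _ => ?_
      have hπ : π τ o = PMF.pure b := hu 0 (by simp) τ o (by simp)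
      rw [Finset.sum_eq_single b (fun a _ ha => by simp [hπ, ha]) (by simp)]
      simp only [hπ, PMF.pure_apply, if_true, ENNReal.toReal_one, one_mul, doProb, ← mul_assoc]
      refine ih (τ ++ [(o, b)]) (by simp; omega) u (fun j hj σ o' hσ => ?_) _ _
      have := hu (j + 1) (by simpa using hj) σ o' (by simp at hσ; omega)
      simpa using this

variable [Nonempty A]

/-- The error of two systems on the histories of length `n` followed by a test with action sequence
`u` is observed when exploring with `explore π n u`. -/
theorem System.histSum_explore_le (f g : System O A H oDum) (π : Policy O A) {n : ℕ} (hn : n ≤ H)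
    (u : List A) :
    histSum n (fun τ => polWeight (explore π n u) [] τ * ∑ t ∈ obsTests u,
      |f.doWeight [] τ * f.testProb τ t - g.doWeight [] τ * g.testProb τ t|) ≤
      f.trajDist g (explore π n u) := by
  obtain ⟨m, rfl⟩ := Nat.exists_eq_add_of_le hn
  rw [trajDist_eq, histSum_append]
  refine histSum_mono fun τ hτ => ?_
  simp only [doWeight_mul_testProb]
  refine (mul_le_mul_of_nonneg_left (sum_obsTests_abs_sub_le f g (explore π n u) m τ (by omega) u
    (fun j hj σ o hσ => explore_of_ge π u o hj (by omega)) _ _)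
    (polWeight_nonneg _ _ _)).trans (le_of_eq ?_)
  rw [mul_histSum]
  refine histSum_congr fun ρ _ => ?_
  rw [polWeight_append, doWeight_append, doWeight_append, List.nil_append, mul_assoc]

/-- The error of two systems on the core tests after one more step, when the step is taken with any
action. -/
theorem System.histSum_step_error_le (f g : System O A H oDum) (π : Policy O A) {n : ℕ}
    (hn : n + 1 ≤ H) (U : Finset (Test O A)) :
    histSum n (fun τ => polWeight π [] τ * ∑ x, ∑ t ∈ U,
      |f.doWeight [] (τ ++ [x]) * f.testProb (τ ++ [x]) t -
        g.doWeight [] (τ ++ [x]) * g.testProb (τ ++ [x]) t|) ≤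
      Fintype.card A * ∑ u ∈ actionSeqs U, f.trajDist g (explore π (n + 1) u) := by
  let D : List (O × A) → Test O A → ℝ := fun τ t =>
    |f.doWeight [] τ * f.testProb τ t - g.doWeight [] τ * g.testProb τ t|
  calc _ ≤ histSum n (fun τ => ∑ u ∈ actionSeqs U, ∑ x,
        (Fintype.card A : ℝ) * (polWeight (explore π (n + 1) u) [] (τ ++ [x]) *
          ∑ t ∈ obsTests u, D (τ ++ [x]) t)) := by
        refine histSum_mono fun τ hτ => ?_
        rw [Finset.sum_comm (s := actionSeqs U), Finset.mul_sum]
        refine Finset.sum_le_sum fun x _ => ?_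
        refine (mul_le_mul_of_nonneg_left (sum_le_sum_obsTests U (D (τ ++ [x]))
          fun t => abs_nonneg (_ : ℝ)) (polWeight_nonneg _ _ _)).trans (le_of_eq ?_)
        rw [Finset.mul_sum]
        refine Finset.sum_congr rfl fun u _ => ?_
        rw [polWeight_explore π u hτ x, mul_assoc]
    _ = Fintype.card A * ∑ u ∈ actionSeqs U, histSum (n + 1) (fun τ =>
          polWeight (explore π (n + 1) u) [] τ * ∑ t ∈ obsTests u, D τ t) := by
        rw [histSum_sum_comm, Finset.mul_sum]
        refine Finset.sum_congr rfl fun u _ => ?_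
        rw [histSum_append, mul_histSum]
        refine histSum_congr fun τ _ => ?_
        rw [histSum_one, Finset.mul_sum]
    _ ≤ _ := by
        gcongr with u
        exact histSum_explore_le f g π hn u

/-- The error of two systems on the core tests is observed when exploring. -/
theorem System.histSum_error_le (f g : System O A H oDum) (π : Policy O A) {n : ℕ}
    (hn : n ≤ H) (U : Finset (Test O A)) :
    histSum n (fun τ => polWeight π [] τ * ∑ t ∈ U,
      |f.doWeight [] τ * f.testProb τ t - g.doWeight [] τ * g.testProb τ t|) ≤
      Fintype.card A * ∑ u ∈ actionSeqs U, f.trajDist g (explore π n u) := by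
  cases n with
  | zero =>
    rw [histSum_zero]
    refine (mul_le_mul_of_nonneg_left (sum_le_sum_obsTests U _ fun t => abs_nonneg (_ : ℝ))
      (polWeight_nonneg _ _ _)).trans ?_
    have hA : (1 : ℝ) ≤ Fintype.card A := by exact_mod_cast Fintype.card_pos
    have hS : 0 ≤ ∑ u ∈ actionSeqs U, f.trajDist g (explore π 0 u) :=
      Finset.sum_nonneg fun _ _ => trajDist_nonneg _ _ _
    refine le_trans ?_ (le_mul_of_one_le_left hS hA)
    rw [polWeight, one_mul]
    refine Finset.sum_le_sum fun u _ => ?_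
    have h := histSum_explore_le f g π hn u
    rwa [histSum_zero, polWeight, one_mul] at h
  | succ n =>
    refine le_trans ?_ (histSum_step_error_le f g π hn U)
    rw [histSum_append]
    refine histSum_mono fun τ _ => ?_
    rw [histSum_one, Finset.mul_sum]
    refine Finset.sum_le_sum fun x _ => ?_
    gcongr
    rw [polWeight_append]
    exact mul_le_of_le_one_right (polWeight_nonneg _ _ _) (polWeight_le_one _ _ _)

end obsTests

/-! ### Predictive states and linear predictors -/

theorem sum_abs_mulVec_le_l1OpNorm {m n : Type*} [Fintype m] [Fintype n] (X : Matrix n m ℝ)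
    (x : m → ℝ) : ∑ j, |X.mulVec x j| ≤ l1OpNorm X * ∑ i, |x i| := by
  have hbdd : BddAbove (Set.range fun x : {x : m → ℝ // ∑ i, |x i| = 1} =>
      ∑ j, |X.mulVec x.1 j|) := by
    refine ⟨∑ j, ∑ i, |X j i|, ?_⟩
    rintro _ ⟨⟨x, hx⟩, rfl⟩
    refine Finset.sum_le_sum fun j _ => (Finset.abs_sum_le_sum_abs _ _).trans ?_
    refine Finset.sum_le_sum fun i _ => ?_
    rw [abs_mul]
    refine mul_le_of_le_one_right (abs_nonneg _) ?_
    refine le_trans ?_ hx.le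
    exact Finset.single_le_sum (f := fun i => |x i|) (fun i _ => abs_nonneg _) (Finset.mem_univ i)
  set s := ∑ i, |x i| with hs
  have hs0 : 0 ≤ s := Finset.sum_nonneg fun i _ => abs_nonneg _
  rcases hs0.eq_or_lt with h | h
  · have hx : x = 0 := by
      funext i
      have := (Finset.sum_eq_zero_iff_of_nonneg fun i _ => abs_nonneg (x i)).1 (hs ▸ h.symm) i
        (Finset.mem_univ i)
      simpa using this
    simp [hx, ← h]
  · have hx : ∑ i, |(s⁻¹ • x) i| = 1 := by
      simp only [Pi.smul_apply, smul_eq_mul, abs_mul, abs_of_pos (inv_pos.2 h), ← Finset.mul_sum]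
      exact inv_mul_cancel₀ h.ne'
    have hle : ∑ j, |X.mulVec (s⁻¹ • x) j| ≤ l1OpNorm X := le_ciSup hbdd ⟨s⁻¹ • x, hx⟩
    simp only [Matrix.mulVec_smul, Pi.smul_apply, smul_eq_mul, abs_mul,
      abs_of_pos (inv_pos.2 h), ← Finset.mul_sum] at hle
    rw [mul_comm]
    rwa [inv_mul_le_iff₀ h] at hle

section predictor

variable {O A : Type*} {H : ℕ} {oDum : O}

/-- The predictive state of the history `τ`. -/
noncomputable def System.predState (M : System O A H oDum) (U : Finset (Test O A))
    (τ : List (O × A)) : U → ℝ := fun u => M.testProb τ u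

/-- A linear predictor for the tests after histories of length `n`: the probability of each test is
the same linear combination, with coefficients linear in the predictive state, of its probabilities
after finitely many fixed histories, and the coefficient map is bounded by `a` in the `ℓ₁` norm. -/
structure Predictor (M : System O A H oDum) (n : ℕ) (U : Finset (Test O A)) (a : ℝ) where
  size : ℕ
  hist : Fin size → List (O × A)
  length_hist : ∀ j, (hist j).length = n
  coeff : (U → ℝ) →ₗ[ℝ] (Fin size → ℝ)
  sum_abs_coeff_le : ∀ x, ∑ j, |coeff x j| ≤ a * ∑ u, |x u|
  testProb_eq : ∀ (t : Test O A) (τ : List (O × A)), τ.length = n →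
    M.testProb τ t = ∑ j, M.testProb (hist j) t * coeff (M.predState U τ) j

/-- A core test set with a well-conditioned core matrix yields a predictor: the coefficients are
given by the pseudoinverse of the core matrix.  They reproduce the predictive states, hence also
all other tests, because the matrix of the core tests and the full dynamics matrix have the same
kernel. -/
theorem System.RegularAt.nonempty_predictor [Fintype O] [Fintype A] {M : System O A H oDum}
    {n : ℕ} {U : Finset (Test O A)} {α : ℝ} (hreg : M.RegularAt α n U)
    (hcore : M.IsCoreTestSet n U) : Nonempty (Predictor M n U (1 / α)) := by
  classical
  obtain ⟨σ, hσ, X, hX, hXα⟩ := hreg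
  have hker : LinearMap.ker (M.predMatrix n U).mulVecLin =
      LinearMap.ker (M.dynMatrix n).mulVecLin := by
    symm
    refine Submodule.eq_of_le_of_finrank_eq (fun x hx => ?_) ?_
    · rw [LinearMap.mem_ker, Matrix.mulVecLin_apply] at hx ⊢
      funext u
      exact congrFun hx u.1
    · have h1 := LinearMap.finrank_range_add_finrank_ker (M.predMatrix n U).mulVecLin
      have h2 := LinearMap.finrank_range_add_finrank_ker (M.dynMatrix n).mulVecLin
      have h3 : Module.finrank ℝ (LinearMap.range (M.predMatrix n U).mulVecLin) =
        Module.finrank ℝ (LinearMap.range (M.dynMatrix n).mulVecLin) := hcore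
      omega
  refine ⟨⟨_, fun j => List.ofFn (σ j), fun j => by simp, X.mulVecLin, fun x => ?_, ?_⟩⟩
  · refine (sum_abs_mulVec_le_l1OpNorm X x).trans ?_
    exact mul_le_mul_of_nonneg_right hXα (Finset.sum_nonneg fun _ _ => abs_nonneg _)
  · rintro t τ' rfl
    obtain ⟨τ, hτ⟩ : ∃ τ : Fin τ'.length → O × A, List.ofFn τ = τ' := ⟨τ'.get, List.ofFn_get τ'⟩
    set z := X.mulVec (M.predState U τ') with hz
    have hcol : M.predState U τ' = (M.predMatrix τ'.length U).col τ := by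
      funext u
      simp [predState, predMatrix, dynMatrix, Matrix.col, hτ]
    have hKz : (M.coreMatrix τ'.length U σ).mulVec z = M.predState U τ' := by
      have hmem := hσ τ
      have : Set.range (fun j => (M.predMatrix τ'.length U).col (σ j)) =
          Set.range (M.coreMatrix τ'.length U σ).col := rfl
      rw [this, ← Matrix.range_mulVecLin] at hmem
      obtain ⟨y, hy⟩ := hmem
      rw [Matrix.mulVecLin_apply, ← hcol] at hy
      rw [hz, ← hy, Matrix.mulVec_mulVec, Matrix.mulVec_mulVec, hX.mul_mul]
    let e : (Fin τ'.length → O × A) → ℝ := Pi.single τ 1 - ∑ j, z j • Pi.single (σ j) 1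
    have hmul : ∀ {m : Type _} (D : Matrix m (Fin τ'.length → O × A) ℝ),
        D.mulVec e = D.col τ - ∑ j, z j • D.col (σ j) := by
      intro m D
      simp only [e, ← Matrix.mulVecLin_apply, map_sub, map_sum, map_smul]
      simp only [Matrix.mulVecLin_apply, Matrix.mulVec_single_one]
    have he : e ∈ LinearMap.ker (M.predMatrix τ'.length U).mulVecLin := by
      rw [LinearMap.mem_ker, Matrix.mulVecLin_apply, hmul, ← hcol, ← hKz, sub_eq_zero]
      funext u
      simp [Matrix.mulVec, dotProduct, coreMatrix, Matrix.col, mul_comm]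
    rw [hker, LinearMap.mem_ker, Matrix.mulVecLin_apply, hmul] at he
    have ht := congrFun he t
    simp only [Pi.sub_apply, Finset.sum_apply, Pi.smul_apply, smul_eq_mul, Pi.zero_apply,
      Matrix.col_apply, dynMatrix, Matrix.of_apply, hτ, sub_eq_zero] at ht
    rw [ht]
    exact Finset.sum_congr rfl fun j _ => mul_comm _ _

namespace Predictor

variable {M : System O A H oDum} {n : ℕ} {U : Finset (Test O A)} {a : ℝ}

/-- The linear functional of the predictive state that predicts the test `t`. -/
noncomputable def op (P : Predictor M n U a) (t : Test O A) : (U → ℝ) →ₗ[ℝ] ℝ :=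
  ∑ j, M.testProb (P.hist j) t • (LinearMap.proj j ∘ₗ P.coeff)

theorem op_apply (P : Predictor M n U a) (t : Test O A) (x : U → ℝ) :
    P.op t x = ∑ j, M.testProb (P.hist j) t * P.coeff x j := by
  simp [op]

theorem op_predState (P : Predictor M n U a) (t : Test O A) {τ : List (O × A)}
    (hτ : τ.length = n) : P.op t (M.predState U τ) = M.testProb τ t := by
  rw [op_apply, P.testProb_eq t τ hτ]

theorem abs_op_le (P : Predictor M n U a) (t : Test O A) (x : U → ℝ) :
    |P.op t x| ≤ ∑ j, M.testProb (P.hist j) t * |P.coeff x j| := by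
  rw [op_apply]
  refine (Finset.abs_sum_le_sum_abs _ _).trans (le_of_eq ?_)
  simp only [abs_mul, abs_of_nonneg (M.testProb_nonneg _ _)]

theorem sum_abs_op_le [Fintype O] (P : Predictor M n U a) (S : Finset (Test O A)) (x : U → ℝ) :
    ∑ t ∈ S, |P.op t x| ≤ (actionSeqs S).card * (a * ∑ u, |x u|) := by
  calc ∑ t ∈ S, |P.op t x| ≤ ∑ t ∈ S, ∑ j, M.testProb (P.hist j) t * |P.coeff x j| :=
        Finset.sum_le_sum fun t _ => P.abs_op_le t x
    _ = ∑ j, (∑ t ∈ S, M.testProb (P.hist j) t) * |P.coeff x j| := by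
        rw [Finset.sum_comm]
        simp only [Finset.sum_mul]
    _ ≤ ∑ j, ((actionSeqs S).card : ℝ) * |P.coeff x j| := by
        gcongr
        exact M.sum_testProb_le S _
    _ ≤ _ := by
        rw [← Finset.mul_sum]
        gcongr
        exact P.sum_abs_coeff_le x

/-- Predictors compose: predicting a test after one step is the same as predicting it directly. -/
theorem op_cons [Fintype A] [Nonempty A] {U' : Finset (Test O A)} (P : Predictor M n U a)
    (P' : Predictor M (n + 1) U' a) (x : O × A) (t : Test O A) (v : U → ℝ) :
    P.op (x :: t.1, t.2) v = P'.op t fun u => P.op (x :: u.1.1, u.1.2) v := by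
  have h : (fun u : U' => P.op (x :: u.1.1, u.1.2) v) =
      ∑ j, ((M.obs (P.hist j) x.1).toReal * P.coeff v j) •
        M.predState U' (P.hist j ++ [x]) := by
    funext u
    rw [op_apply, Finset.sum_apply]
    refine Finset.sum_congr rfl fun j _ => ?_
    rw [M.testProb_cons, Pi.smul_apply, smul_eq_mul, System.predState]
    ring
  rw [h, map_sum, op_apply]
  refine Finset.sum_congr rfl fun j _ => ?_
  rw [map_smul, P'.op_predState _ (by simp [P.length_hist j]), M.testProb_cons, smul_eq_mul]
  ring

variable [Fintype O] [Fintype A]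

/-- Under any policy, started from any history, the predicted probabilities of the futures are
controlled by the `ℓ₁` norm of the state. -/
theorem histSum_abs_op_le (P : Predictor M n U a) (π : Policy O A) (τ : List (O × A)) (m : ℕ)
    (x : U → ℝ) :
    histSum m (fun ρ => polWeight π τ ρ * ∑ o, |P.op (ρ, o) x|) ≤ a * ∑ u, |x u| := by
  refine le_trans ?_ (P.sum_abs_coeff_le x)
  calc _ ≤ histSum m (fun ρ => ∑ j, |P.coeff x j| *
        (polWeight π τ ρ * M.doWeight (P.hist j) ρ)) := by
        refine histSum_mono fun ρ _ => ?_
        calc polWeight π τ ρ * ∑ o, |P.op (ρ, o) x|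
            ≤ polWeight π τ ρ * ∑ o, ∑ j, M.doWeight (P.hist j) ρ *
                (M.obs (P.hist j ++ ρ) o).toReal * |P.coeff x j| := by
              refine mul_le_mul_of_nonneg_left ?_ (polWeight_nonneg _ _ _)
              refine Finset.sum_le_sum fun o _ => (P.abs_op_le _ x).trans ?_
              refine Finset.sum_le_sum fun j _ => ?_
              refine mul_le_mul_of_nonneg_right ?_ (abs_nonneg _)
              exact (M.testProb_le_doProb _ _).trans (M.doProb_eq _ _ _).le
          _ = _ := by
              rw [Finset.sum_comm, Finset.mul_sum]
              refine Finset.sum_congr rfl fun j _ => ?_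
              rw [← Finset.sum_mul, ← Finset.mul_sum, PMF.sum_toReal]
              ring
    _ = ∑ j, |P.coeff x j| := by
        rw [histSum_sum_comm]
        refine Finset.sum_congr rfl fun j _ => ?_
        rw [← mul_histSum, M.histSum_polWeight_mul_doWeight, mul_one]

end Predictor

end predictor

/-! ### From prediction errors to the distance of trajectory laws, and back -/

section errors

variable {O A : Type*} {H : ℕ} {oDum : O}

theorem card_actionSeqs_le (U : Fin H → Finset (Test O A)) (n : Fin H) :
    (actionSeqs (U n)).card ≤ numActionSeqs U :=
  Finset.le_sup (f := fun n => (actionSeqs (U n)).card) (Finset.mem_univ n)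

variable {f g : System O A H oDum} {n : ℕ} {V V' : Finset (Test O A)} {a : ℝ}

/-- The predictive state of `τ`, scaled by the probability of its observations. -/
noncomputable def System.scaledState (g : System O A H oDum) (V : Finset (Test O A))
    (τ : List (O × A)) : V → ℝ := g.doWeight [] τ • g.predState V τ

theorem Predictor.op_scaledState (P : Predictor f n V a) (t : Test O A) {τ : List (O × A)}
    (hτ : τ.length = n) :
    P.op t (f.scaledState V τ) = f.doWeight [] τ * f.testProb τ t := by
  rw [System.scaledState, map_smul, P.op_predState t hτ, smul_eq_mul]

variable [Fintype O]

theorem card_actionSeqs_obsTests_nil_le :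
    (actionSeqs (obsTests ([] : List A) : Finset (Test O A))).card ≤ 1 := by
  classical
  refine Finset.card_le_one.2 fun u hu v hv => ?_
  simp only [actionSeqs, Finset.mem_image, obsTests, Finset.mem_map, Finset.mem_univ,
    true_and] at hu hv
  obtain ⟨_, ⟨o, rfl⟩, rfl⟩ := hu
  obtain ⟨_, ⟨o', rfl⟩, rfl⟩ := hv
  rfl

variable [Fintype A]

theorem System.trajDist_eq_doProb (f g : System O A H oDum) (π : Policy O A) {m : ℕ}
    (hm : m + 1 = H) :
    f.trajDist g π = histSum m fun ρ => polWeight π [] ρ *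
      ∑ o, |f.doProb [] ρ o - g.doProb [] ρ o| := by
  subst hm
  rw [trajDist_eq, histSum_append]
  refine histSum_congr fun ρ _ => ?_
  rw [histSum_one, Fintype.sum_prod_type, Finset.mul_sum]
  refine Finset.sum_congr rfl fun o _ => ?_
  simp only [polWeight_append, doWeight_append, polWeight, doWeight, mul_one, List.nil_append,
    doProb_eq]
  rw [← Finset.sum_mul, ← Finset.mul_sum, PMF.sum_toReal, mul_one]

/-- The tests that consist of one step, with any observation and action, followed by a test in
`V`. -/
def stepTests (V : Finset (Test O A)) : Finset (Test O A) :=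
  (Finset.univ ×ˢ V).map ⟨fun p : (O × A) × Test O A => (p.1 :: p.2.1, p.2.2), fun p q h => by
    simp only [Prod.mk.injEq, List.cons.injEq] at h
    exact Prod.ext h.1.1 (Prod.ext h.1.2 h.2)⟩

theorem sum_stepTests (V : Finset (Test O A)) (g : Test O A → ℝ) :
    ∑ t ∈ stepTests V, g t = ∑ x, ∑ u ∈ V, g (x :: u.1, u.2) := by
  simp only [stepTests, Finset.sum_map, Finset.sum_product]
  rfl

theorem card_actionSeqs_stepTests_le (V : Finset (Test O A)) :
    (actionSeqs (stepTests V)).card ≤ Fintype.card A * (actionSeqs V).card := by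
  classical
  have h : actionSeqs (stepTests V) ⊆
      (Finset.univ ×ˢ actionSeqs V).image fun p : A × List A => p.1 :: p.2 := by
    intro u hu
    obtain ⟨t, ht, rfl⟩ := by simpa only [actionSeqs, Finset.mem_image] using hu
    obtain ⟨⟨x, s⟩, hs, rfl⟩ := Finset.mem_map.1 ht
    refine Finset.mem_image.2 ⟨(x.2, s.actions), ?_, rfl⟩
    simp only [actionSeqs, Finset.mem_product, Finset.mem_univ, true_and, Finset.mem_image]
    exact ⟨s, (Finset.mem_product.1 hs).2, rfl⟩
  refine (Finset.card_le_card h).trans (Finset.card_image_le.trans ?_)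
  rw [Finset.card_product, Finset.card_univ]

/-- The tests on which the operators at step `n` are compared: one step followed by the next core
test set, or a single observation at the last step. -/
def nextTests (U : Fin H → Finset (Test O A)) (n : Fin H) : Finset (Test O A) :=
  if h : (n : ℕ) + 1 < H then stepTests (U ⟨n + 1, h⟩) else obsTests []

theorem card_actionSeqs_nextTests_le [Nonempty A] (U : Fin H → Finset (Test O A))
    (hU : 0 < numActionSeqs U) (n : Fin H) :
    (actionSeqs (nextTests U n)).card ≤ Fintype.card A * numActionSeqs U := by
  unfold nextTests
  split_ifs with h
  · exact (card_actionSeqs_stepTests_le _).trans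
      (Nat.mul_le_mul_left _ (card_actionSeqs_le U ⟨n + 1, h⟩))
  · exact card_actionSeqs_obsTests_nil_le.trans (Nat.mul_pos Fintype.card_pos hU)

/-- The error on the tests in `S` made by a predictor of one system when it is applied to the
states of the system `g`, in expectation over the histories under `π`. -/
noncomputable def predError (g : System O A H oDum) (P : Predictor f n V a)
    (S : Finset (Test O A)) (π : Policy O A) : ℝ :=
  histSum n fun τ => polWeight π [] τ *
    ∑ t ∈ S, |P.op t (g.scaledState V τ) - g.doWeight [] τ * g.testProb τ t|

theorem predError_nonneg (P : Predictor f n V a) (S : Finset (Test O A)) (π : Policy O A) :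
    0 ≤ predError g P S π :=
  histSum_nonneg fun _ => mul_nonneg (polWeight_nonneg _ _ _)
    (Finset.sum_nonneg fun _ _ => abs_nonneg _)

/-- The error that the predictor makes on whole futures of `τ`, of `m` steps and an observation. -/
noncomputable def futureError (g : System O A H oDum) (P : Predictor f n V a) (π : Policy O A)
    (m : ℕ) (τ : List (O × A)) : ℝ :=
  histSum m fun ρ => polWeight π τ ρ *
    ∑ o, |P.op (ρ, o) (g.scaledState V τ) - g.doWeight [] τ * g.doProb τ ρ o|

variable [Nonempty A]

theorem histSum_futureError_zero (P : Predictor f n V a) (π : Policy O A) :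
    histSum n (fun τ => polWeight π [] τ * futureError g P π 0 τ) =
      predError g P (obsTests []) π := by
  refine histSum_congr fun τ _ => ?_
  rw [futureError, histSum_zero, sum_obsTests_nil]
  simp only [polWeight, one_mul, g.doWeight_mul_testProb]

/-- One step of the telescoping: the predictor is applied to the first step, and the next predictor
to the true state after it. -/
theorem futureError_succ_le (P : Predictor f n V a) (P' : Predictor f (n + 1) V' a)
    (π : Policy O A) (m : ℕ) (τ : List (O × A)) :
    futureError g P π (m + 1) τ ≤
      a * ∑ t ∈ stepTests V', |P.op t (g.scaledState V τ) - g.doWeight [] τ * g.testProb τ t| +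
      ∑ x, (π τ x.1 x.2).toReal * futureError g P' π m (τ ++ [x]) := by
  rw [futureError, histSum_succ, sum_stepTests, Finset.mul_sum, ← Finset.sum_add_distrib]
  refine Finset.sum_le_sum fun x _ => ?_
  let v : V' → ℝ := fun u => P.op (x :: u.1.1, u.1.2) (g.scaledState V τ)
  have hstate : ∀ u : V', (v - g.scaledState V' (τ ++ [x])) u =
      P.op (x :: u.1.1, u.1.2) (g.scaledState V τ) -
        g.doWeight [] τ * g.testProb τ (x :: u.1.1, u.1.2) := by
    intro u
    simp only [v, Pi.sub_apply, System.scaledState, Pi.smul_apply, smul_eq_mul, System.predState,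
      g.testProb_cons, System.doWeight_append, List.nil_append, System.doWeight, mul_one,
      mul_assoc]
  have hsum : ∑ u, |(v - g.scaledState V' (τ ++ [x])) u| = ∑ u ∈ V',
      |P.op (x :: u.1, u.2) (g.scaledState V τ) -
        g.doWeight [] τ * g.testProb τ (x :: u.1, u.2)| := by
    simp only [hstate]
    exact Finset.sum_coe_sort V' fun u => |P.op (x :: u.1, u.2) (g.scaledState V τ) -
        g.doWeight [] τ * g.testProb τ (x :: u.1, u.2)|
  rw [← hsum]
  have hπ0 : 0 ≤ (π τ x.1 x.2).toReal := ENNReal.toReal_nonneg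
  calc histSum m (fun ρ => polWeight π τ (x :: ρ) * ∑ o,
        |P.op (x :: ρ, o) (g.scaledState V τ) - g.doWeight [] τ * g.doProb τ (x :: ρ) o|)
      ≤ histSum m (fun ρ => (π τ x.1 x.2).toReal * (polWeight π (τ ++ [x]) ρ * ∑ o,
          |P'.op (ρ, o) (v - g.scaledState V' (τ ++ [x]))|) +
          (π τ x.1 x.2).toReal * (polWeight π (τ ++ [x]) ρ * ∑ o,
            |P'.op (ρ, o) (g.scaledState V' (τ ++ [x])) -
              g.doWeight [] (τ ++ [x]) * g.doProb (τ ++ [x]) ρ o|)) := by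
        refine histSum_mono fun ρ _ => ?_
        rw [polWeight, mul_assoc, ← mul_add, ← mul_add, ← Finset.sum_add_distrib]
        refine mul_le_mul_of_nonneg_left (mul_le_mul_of_nonneg_left
          (Finset.sum_le_sum fun o _ => ?_) (polWeight_nonneg _ _ _)) hπ0
        have h1 : P.op (x :: ρ, o) (g.scaledState V τ) = P'.op (ρ, o) v :=
          P.op_cons P' x (ρ, o) _
        have h2 : g.doWeight [] τ * g.doProb τ (x :: ρ) o =
            g.doWeight [] (τ ++ [x]) * g.doProb (τ ++ [x]) ρ o := by
          simp [System.doWeight_append, System.doWeight, System.doProb, mul_assoc]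
        rw [h1, h2, map_sub]
        exact abs_sub_le _ _ _
    _ = (π τ x.1 x.2).toReal * histSum m (fun ρ => polWeight π (τ ++ [x]) ρ * ∑ o,
          |P'.op (ρ, o) (v - g.scaledState V' (τ ++ [x]))|) +
        (π τ x.1 x.2).toReal * futureError g P' π m (τ ++ [x]) := by
        rw [histSum_add, ← mul_histSum, ← mul_histSum, futureError]
    _ ≤ _ := by
        refine add_le_add_left ((mul_le_of_le_one_left (histSum_nonneg fun ρ => ?_)
          (PMF.toReal_le_one _ _)).trans (P'.histSum_abs_op_le π _ m _)) _
        exact mul_nonneg (polWeight_nonneg _ _ _) (Finset.sum_nonneg fun _ _ => abs_nonneg _)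

theorem histSum_futureError_succ_le (P : Predictor f n V a)
    (P' : Predictor f (n + 1) V' a) (π : Policy O A) (m : ℕ) :
    histSum n (fun τ => polWeight π [] τ * futureError g P π (m + 1) τ) ≤
      a * predError g P (stepTests V') π +
      histSum (n + 1) (fun τ => polWeight π [] τ * futureError g P' π m τ) := by
  rw [histSum_append, predError, mul_histSum, ← histSum_add]
  refine histSum_mono fun τ _ => ?_
  refine (mul_le_mul_of_nonneg_left (futureError_succ_le P P' π m τ)
    (polWeight_nonneg _ _ _)).trans (le_of_eq ?_)
  rw [histSum_one, mul_add, Finset.mul_sum _ _ (polWeight π [] τ)]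
  congr 1
  · ring
  · refine Finset.sum_congr rfl fun x _ => ?_
    rw [polWeight_append]
    simp [polWeight, mul_assoc]

theorem histSum_futureError_le {U : Fin H → Finset (Test O A)} (ha : 0 ≤ a)
    (P : ∀ n : Fin H, Predictor f n (U n) a) (π : Policy O A) (m : ℕ) (n : Fin H)
    (hm : (n : ℕ) + m + 1 = H) :
    histSum n (fun τ => polWeight π [] τ * futureError g (P n) π m τ) ≤
      ∑ k with n ≤ k, (a + 1) * predError g (P k) (nextTests U k) π := by
  have hnn : ∀ k, 0 ≤ predError g (P k) (nextTests U k) π := fun k => predError_nonneg _ _ _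
  have hfirst : (1 : ℝ) ≤ a + 1 := by linarith
  induction m generalizing n with
  | zero =>
    rw [histSum_futureError_zero]
    have h1 : nextTests U n = obsTests [] := by rw [nextTests, dif_neg (by omega)]
    rw [← h1]
    refine (le_mul_of_one_le_left (hnn n) hfirst).trans ?_
    exact Finset.single_le_sum (f := fun k => (a + 1) * predError g (P k) (nextTests U k) π)
      (fun k _ => mul_nonneg (by linarith) (hnn k)) (by simp)
  | succ m ih =>
    have hn1 : (n : ℕ) + 1 < H := by omega
    have h1 : nextTests U n = stepTests (U ⟨n + 1, hn1⟩) := by rw [nextTests, dif_pos hn1]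
    have h2 := histSum_futureError_succ_le (g := g) (P n) (P ⟨n + 1, hn1⟩) π m
    rw [← h1] at h2
    have h3 := ih ⟨n + 1, hn1⟩ (by simp only; omega)
    have h4 : insert n (Finset.univ.filter fun k : Fin H => ⟨n + 1, hn1⟩ ≤ k) ⊆
        Finset.univ.filter fun k => n ≤ k := by
      intro k hk
      simp only [Finset.mem_insert, Finset.mem_filter, Finset.mem_univ, true_and, Fin.le_def]
        at hk ⊢
      rcases hk with rfl | hk
      · exact le_rfl
      · omega
    refine le_trans ?_ (Finset.sum_le_sum_of_subset_of_nonneg h4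
      fun k _ _ => mul_nonneg (by linarith) (hnn k))
    rw [Finset.sum_insert (by simp [Fin.le_def])]
    have h5 := hnn n
    linarith

/-- The error of the initial predictive state. -/
noncomputable def initError (f g : System O A H oDum) (V : Finset (Test O A)) : ℝ :=
  ∑ u, |(f.scaledState V [] - g.scaledState V []) u|

/-- Replacing the operators of one system by those of another one step at a time, the distance of
the trajectory laws is at most the error of the initial state plus the errors of the steps. -/
theorem trajDist_le_sum_predError {U : Fin H → Finset (Test O A)} (ha : 0 ≤ a)
    (P : ∀ n : Fin H, Predictor f n (U n) a) (hH : 0 < H) (π : Policy O A) :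
    f.trajDist g π ≤ (a + 1) * (initError f g (U ⟨0, hH⟩) +
      ∑ n, predError g (P n) (nextTests U n) π) := by
  obtain ⟨m, hm⟩ : ∃ m, m + 1 = H := ⟨H - 1, by omega⟩
  let P0 : Predictor f 0 (U ⟨0, hH⟩) a := P ⟨0, hH⟩
  have h1 : f.trajDist g π ≤ a * initError f g (U ⟨0, hH⟩) + futureError g P0 π m [] := by
    rw [f.trajDist_eq_doProb g π hm, futureError]
    refine le_trans ?_ (add_le_add_left (P0.histSum_abs_op_le π [] m
      (f.scaledState _ [] - g.scaledState _ [])) _)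
    rw [← histSum_add]
    refine histSum_mono fun ρ _ => ?_
    rw [← mul_add, ← Finset.sum_add_distrib]
    refine mul_le_mul_of_nonneg_left (Finset.sum_le_sum fun o _ => ?_) (polWeight_nonneg _ _ _)
    have h2 : f.doProb [] ρ o = P0.op (ρ, o) (f.scaledState _ []) := by
      rw [P0.op_scaledState _ rfl, f.doWeight_mul_testProb]
      simp [System.doWeight]
    rw [h2, map_sub]
    refine (abs_sub_le _ (P0.op (ρ, o) (g.scaledState _ [])) _).trans (le_of_eq ?_)
    simp [System.doWeight]
  have h2 := histSum_futureError_le (g := g) ha P π m ⟨0, hH⟩ (by simp only; omega)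
  simp only [histSum_zero, polWeight, one_mul] at h2
  have h3 : (Finset.univ.filter fun k : Fin H => (⟨0, hH⟩ : Fin H) ≤ k) = Finset.univ := by
    ext k; simp [Fin.le_def]
  rw [h3, ← Finset.mul_sum] at h2
  have h4 : 0 ≤ initError f g (U ⟨0, hH⟩) := Finset.sum_nonneg fun _ _ => abs_nonneg _
  have h5 : futureError g P0 π m [] ≤ (a + 1) * ∑ n, predError g (P n) (nextTests U n) π := h2
  linarith

end errors

/-! ### The regret of a sequence of planned policies -/

section regret

variable {O A : Type*} {H : ℕ} {oDum : O} {f g : System O A H oDum}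
  {U : Fin H → Finset (Test O A)} {a : ℝ}

section

variable [Fintype A] [Nonempty A]

theorem length_exploreAll (U : Fin H → Finset (Test O A)) (π : Policy O A) :
    (exploreAll U π).length = ∑ n, (actionSeqs (U n)).card := by
  rw [exploreAll, List.length_flatMap, ← List.sum_ofFn, List.ofFn_eq_map]
  simp

theorem length_exploreAll_le (U : Fin H → Finset (Test O A)) (π : Policy O A) :
    (exploreAll U π).length ≤ H * numActionSeqs U := by
  rw [length_exploreAll]
  refine (Finset.sum_le_sum fun n _ => card_actionSeqs_le U n).trans ?_
  simp

end

variable [Fintype O]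

theorem System.sum_predState_le (M : System O A H oDum) (U : Fin H → Finset (Test O A))
    (n : Fin H) (τ : List (O × A)) :
    ∑ u, |M.predState (U n) τ u| ≤ numActionSeqs U := by
  have h : ∑ u, |M.predState (U n) τ u| = ∑ t ∈ U n, M.testProb τ t := by
    rw [← Finset.sum_coe_sort (U n) fun t => M.testProb τ t]
    exact Finset.sum_congr rfl fun u _ => abs_of_nonneg (M.testProb_nonneg _ _)
  rw [h]
  exact (M.sum_testProb_le _ _).trans (by exact_mod_cast card_actionSeqs_le U n)

variable [Fintype A]

theorem finrank_span_predState_le (hcore : ∀ n : Fin H, g.IsCoreTestSet n (U n)) (n : Fin H) :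
    Module.finrank ℝ (Submodule.span ℝ (Set.range fun τ : Fin n → O × A =>
      g.predState (U n) (List.ofFn τ))) ≤ g.psrRank := by
  have h := (g.predMatrix n (U n)).rank_eq_finrank_span_cols
  rw [show (g.predMatrix n (U n)).rank = g.rankAt n from hcore n] at h
  refine le_trans (le_of_eq h.symm) ?_
  exact Finset.le_sup (f := g.rankAt) (Finset.mem_range.2 n.2)

variable [Nonempty A]

/-- The total distance of two systems under the exploration policies of one iteration. -/
noncomputable def exploreDist (f g : System O A H oDum) (U : Fin H → Finset (Test O A))
    (π : Policy O A) : ℝ :=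
  ((exploreAll U π).map (f.trajDist g)).sum

theorem exploreDist_eq (f g : System O A H oDum) (U : Fin H → Finset (Test O A))
    (π : Policy O A) : exploreDist f g U π =
      ∑ n, ∑ u ∈ actionSeqs (U n), f.trajDist g (explore π n u) := by
  have h : ∀ l : List (Fin H), ((l.flatMap fun n => (actionSeqs (U n)).toList.map
      fun u => explore π n u).map (f.trajDist g)).sum =
      (l.map fun n => ∑ u ∈ actionSeqs (U n), f.trajDist g (explore π n u)).sum := by
    intro l
    induction l with
    | nil => simp
    | cons n l ih =>
      rw [List.flatMap_cons, List.map_append, List.sum_append, ih, List.map_cons, List.sum_cons,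
        List.map_map, Finset.sum_map_toList]
      rfl
  rw [exploreDist, exploreAll, h, ← List.sum_ofFn, List.ofFn_eq_map]

theorem sum_trajDist_explore_le (f g : System O A H oDum) (U : Fin H → Finset (Test O A))
    (π : Policy O A) (n : Fin H) :
    ∑ u ∈ actionSeqs (U n), f.trajDist g (explore π n u) ≤ exploreDist f g U π := by
  rw [exploreDist_eq]
  exact Finset.single_le_sum (f := fun n : Fin H =>
    ∑ u ∈ actionSeqs (U n), f.trajDist g (explore π n u))
    (fun n _ => Finset.sum_nonneg fun _ _ => System.trajDist_nonneg _ _ _) (Finset.mem_univ n)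

theorem System.histSum_coreError_le (f g : System O A H oDum) (U : Fin H → Finset (Test O A))
    (π : Policy O A) (n : Fin H) :
    histSum n (fun τ => polWeight π [] τ * ∑ t ∈ U n,
      |f.doWeight [] τ * f.testProb τ t - g.doWeight [] τ * g.testProb τ t|) ≤
      Fintype.card A * exploreDist f g U π :=
  (f.histSum_error_le g π n.2.le (U n)).trans
    (mul_le_mul_of_nonneg_left (sum_trajDist_explore_le f g U π n) (Nat.cast_nonneg _))

theorem initError_le (hH : 0 < H) (π : Policy O A) :
    initError f g (U ⟨0, hH⟩) ≤ Fintype.card A * exploreDist f g U π := by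
  have h := f.histSum_coreError_le g U π ⟨0, hH⟩
  rw [histSum_zero, polWeight, one_mul] at h
  refine le_trans (le_of_eq ?_) h
  exact Finset.sum_coe_sort (U ⟨0, hH⟩) fun t =>
    |f.doWeight [] [] * f.testProb [] t - g.doWeight [] [] * g.testProb [] t|

/-- The two systems differ little on the next tests, as seen by the exploration policies. -/
theorem histSum_nextError_le
    (hU : ∀ h : Fin H, (h : ℕ) + 1 = H → ∀ o : O, (([], o) : Test O A) ∈ U h)
    (π : Policy O A) (n : Fin H) :
    histSum n (fun τ => polWeight π [] τ * ∑ t ∈ nextTests U n,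
      |f.doWeight [] τ * f.testProb τ t - g.doWeight [] τ * g.testProb τ t|) ≤
      Fintype.card A * exploreDist f g U π := by
  unfold nextTests
  split_ifs with h
  · refine le_trans (le_of_eq ?_) ((f.histSum_step_error_le g π n.2 (U ⟨n + 1, h⟩)).trans
      (mul_le_mul_of_nonneg_left (sum_trajDist_explore_le f g U π ⟨n + 1, h⟩)
        (Nat.cast_nonneg _)))
    refine histSum_congr fun τ _ => ?_
    rw [sum_stepTests]
    congr 1
    refine Finset.sum_congr rfl fun x _ => Finset.sum_congr rfl fun t _ => ?_
    simp [System.testProb_cons, System.doWeight_append, System.doWeight, mul_assoc]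
  · refine le_trans (histSum_mono fun τ _ => ?_) (f.histSum_coreError_le g U π n)
    refine mul_le_mul_of_nonneg_left ?_ (polWeight_nonneg _ _ _)
    refine Finset.sum_le_sum_of_subset_of_nonneg ?_ fun _ _ _ => abs_nonneg _
    intro t ht
    obtain ⟨o, -, rfl⟩ := Finset.mem_map.1 ht
    exact hU n (by omega) o

/-- The prediction errors under a policy are observed by its exploration policies. -/
theorem predError_le (ha : 0 ≤ a)
    (hU : ∀ h : Fin H, (h : ℕ) + 1 = H → ∀ o : O, (([], o) : Test O A) ∈ U h)
    (hU0 : 0 < numActionSeqs U) (π : Policy O A) (n : Fin H) (P : Predictor f n (U n) a) :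
    predError g P (nextTests U n) π ≤
      ((Fintype.card A : ℝ) ^ 2 * numActionSeqs U * a + Fintype.card A) *
        exploreDist f g U π := by
  have hcard : ((actionSeqs (nextTests U n)).card : ℝ) ≤ Fintype.card A * numActionSeqs U := by
    exact_mod_cast card_actionSeqs_nextTests_le U hU0 n
  have hstate : ∀ τ : List (O × A), τ.length = n →
      ∑ u, |(g.scaledState (U n) τ - f.scaledState (U n) τ) u| = ∑ t ∈ U n,
        |f.doWeight [] τ * f.testProb τ t - g.doWeight [] τ * g.testProb τ t| := by
    intro τ _
    rw [← Finset.sum_coe_sort (U n) fun t =>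
      |f.doWeight [] τ * f.testProb τ t - g.doWeight [] τ * g.testProb τ t|]
    exact Finset.sum_congr rfl fun u _ => abs_sub_comm _ _
  calc predError g P (nextTests U n) π
      ≤ histSum n (fun τ => (Fintype.card A * numActionSeqs U * a) * (polWeight π [] τ *
          ∑ t ∈ U n, |f.doWeight [] τ * f.testProb τ t - g.doWeight [] τ * g.testProb τ t|) +
          polWeight π [] τ * ∑ t ∈ nextTests U n,
          |f.doWeight [] τ * f.testProb τ t - g.doWeight [] τ * g.testProb τ t|) := by
        refine histSum_mono fun τ hτ => ?_
        rw [← hstate τ hτ, mul_left_comm, ← mul_add]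
        refine mul_le_mul_of_nonneg_left ?_ (polWeight_nonneg _ _ _)
        have h1 : ∑ t ∈ nextTests U n,
            |P.op t (g.scaledState (U n) τ) - g.doWeight [] τ * g.testProb τ t| ≤
            ∑ t ∈ nextTests U n, |P.op t (g.scaledState (U n) τ - f.scaledState (U n) τ)| +
            ∑ t ∈ nextTests U n,
              |f.doWeight [] τ * f.testProb τ t - g.doWeight [] τ * g.testProb τ t| := by
          rw [← Finset.sum_add_distrib]
          refine Finset.sum_le_sum fun t _ => ?_
          rw [map_sub, P.op_scaledState t hτ]
          exact abs_sub_le _ _ _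
        refine h1.trans (add_le_add_left ((P.sum_abs_op_le _ _).trans ?_) _)
        rw [← mul_assoc]
        gcongr
    _ ≤ (Fintype.card A * numActionSeqs U * a) * (Fintype.card A * exploreDist f g U π) +
          Fintype.card A * exploreDist f g U π := by
        rw [histSum_add, ← mul_histSum]
        refine add_le_add (mul_le_mul_of_nonneg_left (f.histSum_coreError_le g U π n)
          (by positivity)) (histSum_nextError_le hU π n)
    _ = _ := by ring

/-- The growth of the sums in the eluder argument, with dimension `d`, range `R` and squared error
budget `B` over `K` rounds. -/
noncomputable def eluderBound (d R B : ℝ) (K : ℕ) : ℝ :=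
  d ^ 2 * √(K * ((d * R ^ 2 + B) * ((1 + d) * (d * (d + Real.log (1 + K))))))

/-- The eluder argument for the prediction errors at step `n`. -/
theorem sum_predError_le (ha : 0 ≤ a)
    (hU : ∀ h : Fin H, (h : ℕ) + 1 = H → ∀ o : O, (([], o) : Test O A) ∈ U h)
    (hU0 : 0 < numActionSeqs U) (hcore : ∀ n : Fin H, g.IsCoreTestSet n (U n))
    (n : Fin H) (Pg : Predictor g n (U n) a) (f : ℕ → System O A H oDum)
    (P : ∀ k, Predictor (f k) n (U n) a) (π : ℕ → Policy O A) (K : ℕ) {S : ℝ} (hS0 : 0 ≤ S)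
    (hS : ∀ k < K, ∑ i ∈ Finset.range k, exploreDist (f k) g U (π i) ^ 2 ≤ S) {d : ℕ}
    (hd : g.psrRank ≤ d) :
    ∑ k ∈ Finset.range K, predError g (P k) (nextTests U n) (π k) ≤
      eluderBound d (2 * (Fintype.card A * numActionSeqs U * (a * numActionSeqs U)))
        (((Fintype.card A : ℝ) ^ 2 * numActionSeqs U * a + Fintype.card A) ^ 2 * S) K := by
  have hcard : ((actionSeqs (nextTests U n)).card : ℝ) ≤ Fintype.card A * numActionSeqs U := by
    exact_mod_cast card_actionSeqs_nextTests_le U hU0 n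
  let p : ℕ → (Fin n → O × A) → ℝ := fun i τ =>
    polWeight (π i) [] (List.ofFn τ) * g.doWeight [] (List.ofFn τ)
  let w : ℕ → nextTests U n → (U n → ℝ) →ₗ[ℝ] ℝ := fun k t => (P k).op t - Pg.op t
  have hφ : ∀ k i, predError g (P k) (nextTests U n) (π i) =
      ∑ τ, p i τ * ∑ t, |w k t (g.predState (U n) (List.ofFn τ))| := by
    intro k i
    refine Finset.sum_congr rfl fun τ _ => ?_
    simp only [p, mul_assoc]
    congr 1
    rw [Finset.mul_sum, ← Finset.sum_coe_sort (nextTests U n) fun t =>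
      |(P k).op t (g.scaledState (U n) (List.ofFn τ)) -
        g.doWeight [] (List.ofFn τ) * g.testProb (List.ofFn τ) t|]
    refine Finset.sum_congr rfl fun t _ => ?_
    rw [← Pg.op_predState t (by simp), System.scaledState, map_smul, smul_eq_mul, ← mul_sub,
      abs_mul, abs_of_nonneg (g.doWeight_nonneg _ _)]
    rfl
  have hop : ∀ {f' : System O A H oDum} (P' : Predictor f' n (U n) a) (τ : List (O × A)),
      ∑ t ∈ nextTests U n, |P'.op t (g.predState (U n) τ)| ≤
        Fintype.card A * numActionSeqs U * (a * numActionSeqs U) := by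
    intro f' P' τ
    refine (P'.sum_abs_op_le _ _).trans ?_
    have := g.sum_predState_le U n τ
    gcongr
  simp only [hφ]
  refine sum_average_abs_le (fun τ : Fin n → O × A => g.predState (U n) (List.ofFn τ))
    ((finrank_span_predState_le hcore n).trans hd) p
    (fun i τ => mul_nonneg (polWeight_nonneg _ _ _) (g.doWeight_nonneg _ _))
    (fun i => (g.histSum_polWeight_mul_doWeight (π i) n [] []).le) w K (by positivity) ?_ ?_
  · intro k _ τ
    rw [two_mul]
    refine le_trans ?_ (add_le_add (hop (P k) (List.ofFn τ)) (hop Pg (List.ofFn τ)))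
    rw [← Finset.sum_add_distrib, ← Finset.sum_coe_sort (nextTests U n) fun t =>
      |(P k).op t (g.predState (U n) (List.ofFn τ))| + |Pg.op t (g.predState (U n) (List.ofFn τ))|]
    exact Finset.sum_le_sum fun t _ => abs_sub _ _
  · intro k hk
    refine le_trans (Finset.sum_le_sum fun i _ => ?_)
      ((Finset.mul_sum _ _ _).symm.le.trans (mul_le_mul_of_nonneg_left (hS k hk) (by positivity)))
    rw [← hφ, ← mul_pow]
    exact pow_le_pow_left₀ (predError_nonneg _ _ _) (predError_le ha hU hU0 _ _ _) 2

theorem sum_initError_le (hH : 0 < H) (f : ℕ → System O A H oDum) (π : ℕ → Policy O A) (K : ℕ)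
    {S : ℝ} (hS0 : 0 ≤ S)
    (hS : ∀ k < K, ∑ i ∈ Finset.range k, exploreDist (f k) g U (π i) ^ 2 ≤ S) {d : ℕ}
    (hd : 1 ≤ d) :
    ∑ k ∈ Finset.range K, initError (f k) g (U ⟨0, hH⟩) ≤
      eluderBound d (2 * numActionSeqs U) ((Fintype.card A : ℝ) ^ 2 * S) K := by
  have hnn : ∀ k, 0 ≤ initError (f k) g (U ⟨0, hH⟩) := fun k =>
    Finset.sum_nonneg fun _ _ => abs_nonneg _
  -- A one-dimensional instance of the eluder argument, with a single vector.
  have h := sum_average_abs_le (T := Unit) (L := Unit) (V := ℝ) (fun _ => 1) (d := d)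
    ((Submodule.finrank_le _).trans (by simpa using hd)) (fun _ _ => 1) (by simp) (by simp)
    (fun k _ => initError (f k) g (U ⟨0, hH⟩) • LinearMap.id) K
    (R := 2 * numActionSeqs U) (B := (Fintype.card A : ℝ) ^ 2 * S) (by positivity) ?_ ?_
  · exact le_trans (le_of_eq (by simp [abs_of_nonneg (hnn _)])) h
  · intro k _ _
    simp only [Finset.univ_unique, Finset.sum_const, Finset.card_singleton, one_smul,
      LinearMap.smul_apply, LinearMap.id_apply, smul_eq_mul, mul_one, abs_of_nonneg (hnn k)]
    have hs : ∀ M : System O A H oDum, M.scaledState (U ⟨0, hH⟩) [] =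
        M.predState (U ⟨0, hH⟩) [] := by
      intro M
      simp [System.scaledState, System.doWeight]
    rw [initError, hs, hs, two_mul]
    refine le_trans ?_ (add_le_add ((f k).sum_predState_le U ⟨0, hH⟩ [])
      (g.sum_predState_le U ⟨0, hH⟩ []))
    rw [← Finset.sum_add_distrib]
    exact Finset.sum_le_sum fun u _ => abs_sub _ _
  · intro k hk
    refine le_trans (Finset.sum_le_sum fun i _ => ?_)
      ((Finset.mul_sum _ _ _).symm.le.trans (mul_le_mul_of_nonneg_left (hS k hk) (by positivity)))
    simp only [Finset.univ_unique, Finset.sum_const, Finset.card_singleton, one_smul,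
      LinearMap.smul_apply, LinearMap.id_apply, smul_eq_mul, mul_one, one_mul,
      abs_of_nonneg (hnn k)]
    rw [← mul_pow]
    exact pow_le_pow_left₀ (hnn k) (initError_le hH _) 2

/-- If each model agrees with the true system on the data explored before, then the planned
policies have a small cumulative model error. -/
theorem sum_trajDist_le (ha : 0 ≤ a) (hH : 0 < H)
    (hU : ∀ h : Fin H, (h : ℕ) + 1 = H → ∀ o : O, (([], o) : Test O A) ∈ U h)
    (hU0 : 0 < numActionSeqs U) (hcore : ∀ n : Fin H, g.IsCoreTestSet n (U n))
    (Pg : ∀ n : Fin H, Predictor g n (U n) a) (f : ℕ → System O A H oDum)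
    (P : ∀ k, ∀ n : Fin H, Predictor (f k) n (U n) a) (π : ℕ → Policy O A) (K : ℕ) {S : ℝ}
    (hS0 : 0 ≤ S)
    (hS : ∀ k < K, ∑ i ∈ Finset.range k, exploreDist (f k) g U (π i) ^ 2 ≤ S) :
    ∑ k ∈ Finset.range K, (f k).trajDist g (π k) ≤ (a + 1) * ((H + 1) *
      eluderBound (g.psrRank + 1 : ℝ)
        (2 * (Fintype.card A * numActionSeqs U * (a * numActionSeqs U) + numActionSeqs U))
        (((Fintype.card A : ℝ) ^ 2 * numActionSeqs U * a + Fintype.card A) ^ 2 * S) K) := by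
  have hlog : 0 ≤ Real.log (1 + K) := Real.log_nonneg (by simp)
  have hmono : ∀ {R R' B B' : ℝ}, 0 ≤ R → R ≤ R' → B ≤ B' →
      eluderBound ((g.psrRank + 1 : ℕ) : ℝ) R B K ≤ eluderBound (g.psrRank + 1 : ℝ) R' B' K := by
    intro R R' B B' hR0 hR hB
    rw [Nat.cast_add_one]
    unfold eluderBound
    gcongr
  have hA : (1 : ℝ) ≤ Fintype.card A := by exact_mod_cast Fintype.card_pos
  have h1 := sum_initError_le hH f π K hS0 hS (d := g.psrRank + 1) (by omega)
  have h2 : ∀ n : Fin H, _ := fun n => sum_predError_le ha hU hU0 hcore n (Pg n) f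
    (fun k => P k n) π K hS0 hS (d := g.psrRank + 1) (by omega)
  calc ∑ k ∈ Finset.range K, (f k).trajDist g (π k)
      ≤ ∑ k ∈ Finset.range K, (a + 1) * (initError (f k) g (U ⟨0, hH⟩) +
          ∑ n, predError g (P k n) (nextTests U n) (π k)) :=
        Finset.sum_le_sum fun k _ => trajDist_le_sum_predError ha (P k) hH (π k)
    _ = (a + 1) * (∑ k ∈ Finset.range K, initError (f k) g (U ⟨0, hH⟩) +
          ∑ n, ∑ k ∈ Finset.range K, predError g (P k n) (nextTests U n) (π k)) := by
        rw [← Finset.mul_sum, Finset.sum_add_distrib, Finset.sum_comm (s := Finset.range K)]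
    _ ≤ _ := by
        refine mul_le_mul_of_nonneg_left ?_ (by linarith)
        rw [add_comm (H : ℝ) 1, add_mul, one_mul]
        refine add_le_add (h1.trans (hmono (by positivity) ?_ ?_)) ?_
        · have : 0 ≤ (Fintype.card A : ℝ) * numActionSeqs U * (a * numActionSeqs U) := by
            positivity
          linarith
        · gcongr
          exact le_add_of_nonneg_left (by positivity)
        · refine (Finset.sum_le_card_nsmul _ _ _ fun n _ => (h2 n).trans
            (hmono (R' := 2 * (Fintype.card A * numActionSeqs U * (a * numActionSeqs U) +
              numActionSeqs U)) (by positivity) ?_ le_rfl)).trans (le_of_eq ?_)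
          · gcongr
            exact le_add_of_nonneg_right (Nat.cast_nonneg _)
          · rw [Finset.card_univ, Fintype.card_fin, nsmul_eq_mul]

end regret

/-! ### Brackets -/

section brackets

variable {O A : Type*} {H : ℕ} {oDum : O}

theorem System.prob_nonneg (M : System O A H oDum) (π : Policy O A) (τ : Fin H → O × A) :
    0 ≤ M.prob π τ := ENNReal.toReal_nonneg

variable [Fintype O] [Fintype A]

theorem System.sum_prob (M : System O A H oDum) (π : Policy O A) : ∑ τ, M.prob π τ = 1 := by
  rw [← M.histSum_polWeight_mul_doWeight π H [] []]
  exact Finset.sum_congr rfl fun τ _ => by rw [M.prob_eq, mul_comm]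

/-- The bracket number is attained: there are finite bracketings at every scale, because all
observation probabilities of trajectories can be rounded to a finite grid. -/
theorem bracketNumber_spec (F : Set (System O A H oDum)) {ε : ℝ} (hε : 0 < ε) :
    ∃ g₁ g₂ : Fin (bracketNumber F ε) → Policy O A → (Fin H → O × A) → ℝ,
      (∀ i π, ∑ τ, |g₁ i π τ - g₂ i π τ| ≤ ε) ∧
      ∀ f ∈ F, ∃ i, ∀ π τ, g₁ i π τ ≤ f.prob π τ ∧ f.prob π τ ≤ g₂ i π τ := by
  classical
  refine Nat.sInf_mem (s := {N | ∃ g₁ g₂ : Fin N → Policy O A → (Fin H → O × A) → ℝ,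
    (∀ i π, ∑ τ, |g₁ i π τ - g₂ i π τ| ≤ ε) ∧
    ∀ f ∈ F, ∃ i, ∀ π τ, g₁ i π τ ≤ f.prob π τ ∧ f.prob π τ ≤ g₂ i π τ}) ?_
  obtain ⟨m, hm⟩ := exists_nat_gt ((Fintype.card (Fin H → O × A) : ℝ) / ε)
  have hm0 : (0 : ℝ) < m := lt_of_le_of_lt (by positivity) hm
  let e := Fintype.equivFin ((Fin H → O × A) → Fin (m + 1))
  refine ⟨_, fun i π τ => ((e.symm i τ : ℕ) : ℝ) / m * polWeight π [] (List.ofFn τ),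
    fun i π τ => (((e.symm i τ : ℕ) : ℝ) + 1) / m * polWeight π [] (List.ofFn τ), ?_, ?_⟩
  · intro i π
    calc _ ≤ ∑ _τ : Fin H → O × A, (1 : ℝ) / m := by
          refine Finset.sum_le_sum fun τ _ => ?_
          rw [abs_sub_comm, ← sub_mul, ← sub_div, add_sub_cancel_left, abs_mul,
            abs_of_nonneg (by positivity), abs_of_nonneg (polWeight_nonneg _ _ _)]
          exact mul_le_of_le_one_right (by positivity) (polWeight_le_one _ _ _)
      _ = (Fintype.card (Fin H → O × A) : ℝ) / m := by simp [div_eq_mul_inv]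
      _ ≤ ε := by
          rw [div_le_iff₀ hm0]
          rw [div_lt_iff₀ hε] at hm
          linarith
  · intro f _
    have hfl : ∀ τ : Fin H → O × A, ⌊f.doWeight [] (List.ofFn τ) * m⌋₊ < m + 1 := by
      intro τ
      refine Nat.lt_succ_of_le (Nat.floor_le_of_le ?_)
      exact mul_le_of_le_one_left hm0.le (f.doWeight_le_one _ _)
    refine ⟨e fun τ => ⟨_, hfl τ⟩, fun π τ => ?_⟩
    have h0 : 0 ≤ f.doWeight [] (List.ofFn τ) * m := mul_nonneg (f.doWeight_nonneg _ _) hm0.le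
    simp only [f.prob_eq, Equiv.symm_apply_apply]
    constructor
    · refine mul_le_mul_of_nonneg_right ?_ (polWeight_nonneg _ _ _)
      rw [div_le_iff₀ hm0]
      exact Nat.floor_le h0
    · refine mul_le_mul_of_nonneg_right ?_ (polWeight_nonneg _ _ _)
      rw [le_div_iff₀ hm0]
      exact (Nat.lt_floor_add_one _).le

/-- `G` is a nonnegative family of upper brackets for the class `F` at scale `ε`. -/
structure IsUpperBracketing {N : ℕ} (F : Set (System O A H oDum)) (ε : ℝ)
    (G : Fin N → Policy O A → (Fin H → O × A) → ℝ) : Prop where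
  nonneg : ∀ i π τ, 0 ≤ G i π τ
  sum_le : ∀ i π, ∑ τ, G i π τ ≤ 1 + ε
  exists_bracket : ∀ f ∈ F, ∃ i, (∀ π τ, f.prob π τ ≤ G i π τ) ∧
    ∀ π, ∑ τ, (G i π τ - f.prob π τ) ≤ ε

theorem exists_isUpperBracketing (F : Set (System O A H oDum)) {ε : ℝ} (hε : 0 < ε) :
    ∃ G : Fin (bracketNumber F ε) → Policy O A → (Fin H → O × A) → ℝ,
      IsUpperBracketing F ε G := by
  classical
  obtain ⟨g₁, g₂, hsum, hF⟩ := bracketNumber_spec F hε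
  let hit : Fin (bracketNumber F ε) → Prop := fun i =>
    ∃ f ∈ F, ∀ π τ, g₁ i π τ ≤ f.prob π τ ∧ f.prob π τ ≤ g₂ i π τ
  have hgap : ∀ i (f : System O A H oDum),
      (∀ π τ, g₁ i π τ ≤ f.prob π τ ∧ f.prob π τ ≤ g₂ i π τ) →
      ∀ π, ∑ τ, (g₂ i π τ - f.prob π τ) ≤ ε := by
    intro i f hf π
    refine le_trans (Finset.sum_le_sum fun τ _ => ?_) (hsum i π)
    rw [abs_sub_comm]
    exact le_trans (by linarith [(hf π τ).1]) (le_abs_self _)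
  -- Brackets that contain no model are not bounded by a law; they are replaced by zero.
  refine ⟨fun i => if hit i then g₂ i else 0, ⟨fun i π τ => ?_, fun i π => ?_, fun f hf => ?_⟩⟩
  · by_cases h : hit i
    · obtain ⟨f, -, hf⟩ := id h
      simpa [h] using (f.prob_nonneg π τ).trans (hf π τ).2
    · simp [h]
  · by_cases h : hit i
    · obtain ⟨f, -, hf⟩ := id h
      have h1 := hgap i f hf π
      rw [Finset.sum_sub_distrib, f.sum_prob] at h1
      simp only [h, if_true]
      linarith
    · simp [h]; linarith
  · obtain ⟨i, hi⟩ := hF f hf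
    have h : hit i := ⟨f, hf, hi⟩
    exact ⟨i, by simpa [h] using fun π τ => (hi π τ).2, by simpa [h] using hgap i f hi⟩

end brackets

/-! ### Likelihood ratios and Hellinger distances -/

section likelihood

variable {O A : Type*} {H : ℕ} {oDum : O}

/-- The likelihood of a data set. -/
noncomputable def likelihood (f : System O A H oDum) (D : Data O A) : ℝ :=
  (D.map fun x => (f.traj x.1 H x.2).toReal).prod

theorem likelihood_nonneg (f : System O A H oDum) (D : Data O A) : 0 ≤ likelihood f D :=
  List.prod_nonneg fun a ha => by
    obtain ⟨x, -, rfl⟩ := List.mem_map.1 ha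
    exact ENNReal.toReal_nonneg

theorem logLik_eq (f : System O A H oDum) (D : Data O A) :
    logLik f D = ENNReal.log (ENNReal.ofReal (likelihood f D)) := by
  induction D with
  | nil => simp [logLik, likelihood]
  | cons x D ih =>
    have h1 : logLik f (x :: D) = ENNReal.log (f.traj x.1 H x.2) + logLik f D := by
      simp [logLik]
    have h2 : likelihood f (x :: D) = (f.traj x.1 H x.2).toReal * likelihood f D := by
      simp [likelihood]
    rw [h1, ih, h2, ENNReal.ofReal_mul ENNReal.toReal_nonneg,
      ENNReal.ofReal_toReal (PMF.apply_ne_top _ _), ENNReal.log_mul_add]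

theorem logLik_le_add_iff (f g : System O A H oDum) (D : Data O A) (β : ℝ) :
    logLik f D ≤ logLik g D + (β : EReal) ↔
      likelihood f D ≤ Real.exp β * likelihood g D := by
  have hβ : (β : EReal) = ENNReal.log (ENNReal.ofReal (Real.exp β)) := by
    rw [ENNReal.log_ofReal_of_pos (Real.exp_pos β), Real.log_exp]
  rw [logLik_eq, logLik_eq, hβ, ← ENNReal.log_mul_add, ENNReal.log_le_log_iff,
    ← ENNReal.ofReal_mul (likelihood_nonneg _ _), ENNReal.ofReal_le_ofReal_iff (by
      exact mul_nonneg (likelihood_nonneg _ _) (Real.exp_pos _).le), mul_comm]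

theorem mem_confSet {F : Set (System O A H oDum)} {f : System O A H oDum} {β : ℝ}
    {D : Data O A} (hf : f ∈ F)
    (h : ∀ f' ∈ F, likelihood f' D ≤ Real.exp β * likelihood f D) : f ∈ confSet F β D := by
  refine ⟨hf, ?_⟩
  rw [EReal.sub_le_iff_le_add (Or.inl (EReal.coe_ne_bot β)) (Or.inl (EReal.coe_ne_top β))]
  exact iSup₂_le fun f' hf' => (logLik_le_add_iff f' f D β).2 (h f' hf')

theorem likelihood_le_of_mem_confSet {F : Set (System O A H oDum)} {f g : System O A H oDum}
    {β : ℝ} {D : Data O A} (hg : g ∈ F) (hf : f ∈ confSet F β D) :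
    likelihood g D ≤ Real.exp β * likelihood f D := by
  rw [← logLik_le_add_iff]
  have h := hf.2
  rw [EReal.sub_le_iff_le_add (Or.inl (EReal.coe_ne_bot β)) (Or.inl (EReal.coe_ne_top β))] at h
  exact (le_iSup₂ (f := fun f' (_ : f' ∈ F) => logLik f' D) g hg).trans h

variable {M : System O A H oDum} {ε : ℝ} {G : Policy O A → (Fin H → O × A) → ℝ}
  {f : System O A H oDum}

theorem extend_ofFn_apply (π : Policy O A) (τ : Fin H → O × A) :
    Function.extend List.ofFn (G π) 0 (List.ofFn τ) = G π τ :=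
  List.ofFn_injective.extend_apply _ _ _

theorem extend_ofFn_nonneg (hG : ∀ π τ, 0 ≤ G π τ) (π : Policy O A) (l : List (O × A)) :
    0 ≤ Function.extend List.ofFn (G π) 0 l := by
  by_cases h : ∃ τ : Fin H → O × A, List.ofFn τ = l
  · obtain ⟨τ, rfl⟩ := h
    rw [extend_ofFn_apply]
    exact hG π τ
  · rw [Function.extend_apply' _ _ _ h]
    exact le_rfl

theorem traj_toReal_le_extend (hfG : ∀ π τ, f.prob π τ ≤ G π τ)
    {x : Policy O A × List (O × A)} (hx : x.2.length = H) :
    (f.traj x.1 H x.2).toReal ≤ Function.extend List.ofFn (G x.1) 0 x.2 := by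
  obtain ⟨π, l⟩ := x
  obtain ⟨τ, rfl⟩ : ∃ τ : Fin H → O × A, List.ofFn τ = l := by
    subst hx
    exact ⟨l.get, List.ofFn_get l⟩
  rw [extend_ofFn_apply]
  exact hfG π τ

/-- The likelihood ratio of a bracket function and a system, normalized to expectation at most
one.  As data sets consist of lists, the bracket function is extended by zero from trajectories to
lists.  The ratio is `0` where the system has probability zero, which is a null event. -/
noncomputable def likRatio (M : System O A H oDum) (ε : ℝ)
    (G : Policy O A → (Fin H → O × A) → ℝ) (x : Policy O A × List (O × A)) : ℝ :=
  Function.extend List.ofFn (G x.1) 0 x.2 / (M.traj x.1 H x.2).toReal * Real.exp (-ε)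

theorem likRatio_nonneg (hG : ∀ π τ, 0 ≤ G π τ) (x : Policy O A × List (O × A)) :
    0 ≤ likRatio M ε G x :=
  mul_nonneg (div_nonneg (extend_ofFn_nonneg hG _ _) ENNReal.toReal_nonneg) (Real.exp_pos _).le

/-- If the normalized likelihood ratio of the bracket is small on the data, then the model in the
bracket is not much more likely than the true system. -/
theorem likelihood_le_prod_likRatio (hfG : ∀ π τ, f.prob π τ ≤ G π τ) (D : Data O A)
    (hD : ∀ x ∈ D, M.traj x.1 H x.2 ≠ 0) :
    likelihood f D ≤
      (D.map (likRatio M ε G)).prod * Real.exp (ε * D.length) * likelihood M D := by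
  induction D with
  | nil => simp [likelihood]
  | cons x D ih =>
    have hx := hD x List.mem_cons_self
    have hpos : 0 < (M.traj x.1 H x.2).toReal := ENNReal.toReal_pos hx (PMF.apply_ne_top _ _)
    have h1 : (f.traj x.1 H x.2).toReal ≤
        likRatio M ε G x * Real.exp ε * (M.traj x.1 H x.2).toReal := by
      refine (traj_toReal_le_extend hfG (M.traj_length hx)).trans (le_of_eq ?_)
      rw [likRatio, mul_assoc _ (Real.exp (-ε)), ← Real.exp_add, neg_add_cancel, Real.exp_zero,
        mul_one, div_mul_cancel₀ _ hpos.ne']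
    have h2 := mul_le_mul h1 (ih fun y hy => hD y (List.mem_cons_of_mem _ hy))
      (likelihood_nonneg _ _) (ENNReal.toReal_nonneg.trans h1)
    have h3 : Real.exp (ε * ((x :: D).length : ℕ)) = Real.exp ε * Real.exp (ε * D.length) := by
      rw [← Real.exp_add, List.length_cons]
      push_cast
      ring_nf
    rw [h3]
    simp only [likelihood, List.map_cons, List.prod_cons] at h2 ⊢
    exact h2.trans (le_of_eq (by ring))

variable [Fintype O] [Fintype A]

/-- The squared Hellinger distance, up to a factor `2`, of a bracket function and a system. -/
noncomputable def hellinger (M : System O A H oDum) (G : Policy O A → (Fin H → O × A) → ℝ)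
    (π : Policy O A) : ℝ :=
  ∑ τ, (√(G π τ) - √(M.prob π τ)) ^ 2

/-- The square root of the likelihood ratio of a bracket function and a system, normalized to
expectation at most one. -/
noncomputable def sqrtLikRatio (M : System O A H oDum) (ε : ℝ)
    (G : Policy O A → (Fin H → O × A) → ℝ) (x : Policy O A × List (O × A)) : ℝ :=
  √(Function.extend List.ofFn (G x.1) 0 x.2 / (M.traj x.1 H x.2).toReal) *
    Real.exp (hellinger M G x.1 / 2 - ε / 2)

theorem sum_prob_mul_likRatio_le (hG : ∀ π τ, 0 ≤ G π τ) (hsum : ∀ π, ∑ τ, G π τ ≤ 1 + ε)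
    (π : Policy O A) : ∑ τ, M.prob π τ * likRatio M ε G (π, List.ofFn τ) ≤ 1 := by
  calc ∑ τ, M.prob π τ * likRatio M ε G (π, List.ofFn τ)
      ≤ ∑ τ, G π τ * Real.exp (-ε) := by
        refine Finset.sum_le_sum fun τ _ => ?_
        rw [likRatio, extend_ofFn_apply, ← mul_assoc]
        refine mul_le_mul_of_nonneg_right ?_ (Real.exp_pos _).le
        change M.prob π τ * (G π τ / M.prob π τ) ≤ G π τ
        rcases (M.prob_nonneg π τ).eq_or_lt with h0 | h0
        · simpa [← h0] using hG π τ
        · rw [mul_div_cancel₀ _ h0.ne']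
    _ = (∑ τ, G π τ) * Real.exp (-ε) := by rw [Finset.sum_mul]
    _ ≤ Real.exp ε * Real.exp (-ε) := by
        refine mul_le_mul_of_nonneg_right ((hsum π).trans ?_) (Real.exp_pos _).le
        linarith [Real.add_one_le_exp ε]
    _ = 1 := by rw [← Real.exp_add, add_neg_cancel, Real.exp_zero]

theorem sum_sqrt_mul_sqrt_eq (hG : ∀ π τ, 0 ≤ G π τ) (π : Policy O A) :
    ∑ τ, √(G π τ) * √(M.prob π τ) = (∑ τ, G π τ + 1 - hellinger M G π) / 2 := by
  have h : hellinger M G π =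
      ∑ τ, G π τ + ∑ τ, M.prob π τ - 2 * ∑ τ, √(G π τ) * √(M.prob π τ) := by
    rw [hellinger, Finset.mul_sum, ← Finset.sum_add_distrib, ← Finset.sum_sub_distrib]
    refine Finset.sum_congr rfl fun τ _ => ?_
    rw [sub_sq, Real.sq_sqrt (hG π τ), Real.sq_sqrt (M.prob_nonneg π τ)]
    ring
  rw [h, M.sum_prob]
  ring

/-- Since `∑ √(G ℙ) = (∑ G + 1 - hellinger) / 2 ≤ exp (ε / 2 - hellinger / 2)`, the square root of
the likelihood ratio is normalized by the Hellinger distance. -/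
theorem sum_prob_mul_sqrtLikRatio_le (hG : ∀ π τ, 0 ≤ G π τ) (hsum : ∀ π, ∑ τ, G π τ ≤ 1 + ε)
    (π : Policy O A) : ∑ τ, M.prob π τ * sqrtLikRatio M ε G (π, List.ofFn τ) ≤ 1 := by
  set h := hellinger M G π with hh
  calc ∑ τ, M.prob π τ * sqrtLikRatio M ε G (π, List.ofFn τ)
      ≤ ∑ τ, √(G π τ) * √(M.prob π τ) * Real.exp (h / 2 - ε / 2) := by
        refine Finset.sum_le_sum fun τ _ => ?_
        rw [sqrtLikRatio, extend_ofFn_apply, ← mul_assoc]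
        refine mul_le_mul_of_nonneg_right (le_of_eq ?_) (Real.exp_pos _).le
        change M.prob π τ * √(G π τ / M.prob π τ) = _
        rw [Real.sqrt_div (hG π τ)]
        rcases (M.prob_nonneg π τ).eq_or_lt with h0 | h0
        · simp [← h0]
        · have h1 := Real.mul_self_sqrt h0.le
          have h2 := Real.sqrt_pos.2 h0
          field_simp
          rw [sq, h1, mul_comm]
    _ = (∑ τ, √(G π τ) * √(M.prob π τ)) * Real.exp (h / 2 - ε / 2) := by rw [Finset.sum_mul]
    _ ≤ Real.exp (-(h / 2 - ε / 2)) * Real.exp (h / 2 - ε / 2) := by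
        refine mul_le_mul_of_nonneg_right ?_ (Real.exp_pos _).le
        rw [sum_sqrt_mul_sqrt_eq hG]
        have := Real.add_one_le_exp (-(h / 2 - ε / 2))
        linarith [hsum π]
    _ = 1 := by rw [← Real.exp_add, neg_add_cancel, Real.exp_zero]

theorem sqrtLikRatio_nonneg (x : Policy O A × List (O × A)) : 0 ≤ sqrtLikRatio M ε G x :=
  mul_nonneg (Real.sqrt_nonneg _) (Real.exp_pos _).le

/-- The likelihood of a model is exponentially small in the Hellinger distance of its bracket to the
true system, up to the product of the normalized ratios. -/
theorem sqrt_likelihood_mul_exp_le (hfG : ∀ π τ, f.prob π τ ≤ G π τ) (D : Data O A)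
    (hD : ∀ x ∈ D, M.traj x.1 H x.2 ≠ 0) :
    √(likelihood f D) * Real.exp ((D.map fun x => hellinger M G x.1).sum / 2 - ε * D.length / 2) ≤
      (D.map (sqrtLikRatio M ε G)).prod * √(likelihood M D) := by
  induction D with
  | nil => simp [likelihood]
  | cons x D ih =>
    have hx := hD x List.mem_cons_self
    have hpos : 0 < (M.traj x.1 H x.2).toReal := ENNReal.toReal_pos hx (PMF.apply_ne_top _ _)
    have h1 : √(f.traj x.1 H x.2).toReal * Real.exp (hellinger M G x.1 / 2 - ε / 2) ≤
        sqrtLikRatio M ε G x * √(M.traj x.1 H x.2).toReal := by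
      rw [sqrtLikRatio, mul_right_comm, ← Real.sqrt_mul' _ hpos.le, div_mul_cancel₀ _ hpos.ne']
      refine mul_le_mul_of_nonneg_right (Real.sqrt_le_sqrt ?_) (Real.exp_pos _).le
      exact traj_toReal_le_extend hfG (M.traj_length hx)
    have h2 := mul_le_mul h1 (ih fun y hy => hD y (List.mem_cons_of_mem _ hy))
      (by positivity) (mul_nonneg (sqrtLikRatio_nonneg _) (Real.sqrt_nonneg _))
    have h3 : Real.exp (((x :: D).map fun x => hellinger M G x.1).sum / 2 -
          ε * ((x :: D).length : ℕ) / 2) = Real.exp (hellinger M G x.1 / 2 - ε / 2) *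
        Real.exp ((D.map fun x => hellinger M G x.1).sum / 2 - ε * D.length / 2) := by
      rw [← Real.exp_add, List.length_cons, List.map_cons, List.sum_cons]
      push_cast
      ring_nf
    rw [h3]
    simp only [likelihood, List.map_cons, List.prod_cons] at h2 ⊢
    rw [Real.sqrt_mul ENNReal.toReal_nonneg, Real.sqrt_mul ENNReal.toReal_nonneg]
    refine le_trans (le_of_eq (by ring)) (h2.trans (le_of_eq (by ring)))

/-- A model that is nearly as likely as the true system is close to it in Hellinger distance along
the data. -/
theorem sum_hellinger_le (hfG : ∀ π τ, f.prob π τ ≤ G π τ) (D : Data O A)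
    (hD : ∀ x ∈ D, M.traj x.1 H x.2 ≠ 0) {β c : ℝ}
    (hβ : likelihood M D ≤ Real.exp β * likelihood f D)
    (hc : (D.map (sqrtLikRatio M ε G)).prod ≤ Real.exp c) :
    (D.map fun x => hellinger M G x.1).sum ≤ 2 * c + ε * D.length + β := by
  have hM : 0 < likelihood M D := List.prod_pos fun a ha => by
    obtain ⟨x, hx, rfl⟩ := List.mem_map.1 ha
    exact ENNReal.toReal_pos (hD x hx) (PMF.apply_ne_top _ _)
  have hf : 0 < √(likelihood f D) := by
    refine Real.sqrt_pos.2 ((pos_iff_pos_of_mul_pos ?_).1 (Real.exp_pos β))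
    exact hM.trans_le hβ
  have h1 := sqrt_likelihood_mul_exp_le (ε := ε) hfG D hD
  have h2 : √(likelihood M D) ≤ Real.exp (β / 2) * √(likelihood f D) := by
    rw [Real.exp_half, ← Real.sqrt_mul (Real.exp_pos β).le]
    exact Real.sqrt_le_sqrt hβ
  have h3 := h1.trans (mul_le_mul hc h2 (Real.sqrt_nonneg _) (Real.exp_pos _).le)
  rw [← mul_assoc, mul_comm, ← Real.exp_add] at h3
  have h4 := Real.exp_le_exp.1 (le_of_mul_le_mul_right h3 hf)
  linarith

/-- The `ℓ₁` distance is bounded by the Hellinger distance, by Cauchy–Schwarz, up to the width of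
the bracket. -/
theorem sq_trajDist_le (hfG : ∀ π τ, f.prob π τ ≤ G π τ) (hG : ∀ π τ, 0 ≤ G π τ)
    (hsum : ∀ π, ∑ τ, G π τ ≤ 1 + ε) (hε : ε ≤ 1) (π : Policy O A)
    (hgap : ∑ τ, (G π τ - f.prob π τ) ≤ ε) :
    f.trajDist M π ^ 2 ≤ 12 * hellinger M G π + 2 * ε ^ 2 := by
  have h1 : f.trajDist M π ≤ ε + ∑ τ, |G π τ - M.prob π τ| := by
    refine le_trans ?_ (add_le_add_left hgap _)
    rw [← Finset.sum_add_distrib]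
    refine Finset.sum_le_sum fun τ _ => ?_
    refine (abs_sub_le _ (G π τ) _).trans ?_
    rw [abs_sub_comm, abs_of_nonneg (sub_nonneg.2 (hfG π τ))]
  have h2 : (∑ τ, |G π τ - M.prob π τ|) ^ 2 ≤ hellinger M G π * 6 := by
    calc (∑ τ, |G π τ - M.prob π τ|) ^ 2
        = (∑ τ, |√(G π τ) - √(M.prob π τ)| * (√(G π τ) + √(M.prob π τ))) ^ 2 := by
          congr 1
          refine Finset.sum_congr rfl fun τ _ => ?_
          have h3 : G π τ - M.prob π τ =
              (√(G π τ) - √(M.prob π τ)) * (√(G π τ) + √(M.prob π τ)) := by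
            have := Real.mul_self_sqrt (hG π τ)
            have := Real.mul_self_sqrt (M.prob_nonneg π τ)
            linarith
          rw [h3, abs_mul, abs_of_nonneg (show 0 ≤ √(G π τ) + √(M.prob π τ) by positivity)]
      _ ≤ (∑ τ, |√(G π τ) - √(M.prob π τ)| ^ 2) * ∑ τ, (√(G π τ) + √(M.prob π τ)) ^ 2 :=
          Finset.sum_mul_sq_le_sq_mul_sq _ _ _
      _ ≤ hellinger M G π * 6 := by
          simp only [sq_abs]
          refine mul_le_mul_of_nonneg_left ?_ (Finset.sum_nonneg fun _ _ => sq_nonneg _)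
          calc ∑ τ, (√(G π τ) + √(M.prob π τ)) ^ 2
              ≤ ∑ τ, 2 * (G π τ + M.prob π τ) := by
                refine Finset.sum_le_sum fun τ _ => ?_
                have := Real.sq_sqrt (hG π τ)
                have := Real.sq_sqrt (M.prob_nonneg π τ)
                nlinarith [sq_nonneg (√(G π τ) - √(M.prob π τ))]
            _ = 2 * (∑ τ, G π τ + 1) := by
                rw [← Finset.mul_sum, Finset.sum_add_distrib, M.sum_prob]
            _ ≤ 6 := by linarith [hsum π]
  have h3 := pow_le_pow_left₀ (System.trajDist_nonneg f M π) h1 2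
  nlinarith [sq_nonneg (ε - ∑ τ, |G π τ - M.prob π τ|)]

end likelihood

/-! ### Expectations along the run of the algorithm -/

/-- The expectation of a nonnegative function. -/
noncomputable def PMF.expect {α : Type*} (p : PMF α) (g : α → ℝ≥0∞) : ℝ≥0∞ := ∑' a, p a * g a

namespace PMF

variable {α β : Type*}

theorem expect_pure (a : α) (g : α → ℝ≥0∞) : (PMF.pure a).expect g = g a := by
  classical
  rw [expect, tsum_eq_single a fun b hb => by simp [hb]]
  simp

theorem expect_bind (p : PMF α) (f : α → PMF β) (g : β → ℝ≥0∞) :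
    (p.bind f).expect g = p.expect fun a => (f a).expect g := by
  simp only [expect, bind_apply, ← ENNReal.tsum_mul_right, ← ENNReal.tsum_mul_left]
  rw [ENNReal.tsum_comm]
  simp only [mul_assoc]

theorem expect_map (p : PMF α) (f : α → β) (g : β → ℝ≥0∞) :
    (p.map f).expect g = p.expect (g ∘ f) := by
  rw [← bind_pure_comp, expect_bind]
  simp only [Function.comp_apply, expect_pure]
  rfl

theorem expect_mono {p : PMF α} {g g' : α → ℝ≥0∞} (h : ∀ a ∈ p.support, g a ≤ g' a) :
    p.expect g ≤ p.expect g' := by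
  refine ENNReal.tsum_le_tsum fun a => ?_
  by_cases ha : p a = 0
  · simp [ha]
  · exact mul_le_mul_right (h a ha) _

theorem expect_const (p : PMF α) (c : ℝ≥0∞) : p.expect (fun _ => c) = c := by
  rw [expect, ENNReal.tsum_mul_right, p.tsum_coe, one_mul]

theorem expect_le {p : PMF α} {g : α → ℝ≥0∞} {c : ℝ≥0∞} (h : ∀ a ∈ p.support, g a ≤ c) :
    p.expect g ≤ c :=
  (expect_mono h).trans (p.expect_const c).le

theorem expect_sum {ι : Type*} (p : PMF α) (s : Finset ι) (g : ι → α → ℝ≥0∞) :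
    p.expect (fun a => ∑ i ∈ s, g i a) = ∑ i ∈ s, p.expect (g i) := by
  simp only [expect, Finset.mul_sum]
  exact Summable.tsum_finsetSum fun _ _ => ENNReal.summable

theorem expect_const_mul (p : PMF α) (c : ℝ≥0∞) (g : α → ℝ≥0∞) :
    p.expect (fun a => c * g a) = c * p.expect g := by
  simp only [expect, ← ENNReal.tsum_mul_left, mul_left_comm]

/-- Markov's inequality, in terms of the complementary event. -/
theorem ofReal_le_toOuterMeasure {p : PMF α} {T : α → ℝ≥0∞} {C δ : ℝ} (hC : 0 < C) (hδ : 0 < δ)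
    (hT : p.expect T ≤ ENNReal.ofReal C) {E : Set α}
    (hE : ∀ a ∈ p.support, T a < ENNReal.ofReal (C / δ) → a ∈ E) :
    ENNReal.ofReal (1 - δ) ≤ p.toOuterMeasure E := by
  classical
  have hCδ : 0 < C / δ := div_pos hC hδ
  have h1 : (1 : ℝ≥0∞) ≤ p.toOuterMeasure E + ENNReal.ofReal (δ / C) * p.expect T := by
    rw [p.toOuterMeasure_apply, expect, ← ENNReal.tsum_mul_left, ← ENNReal.tsum_add,
      ← p.tsum_coe]
    refine ENNReal.tsum_le_tsum fun a => ?_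
    by_cases ha : p a = 0
    · simp [ha]
    by_cases hTa : T a < ENNReal.ofReal (C / δ)
    · rw [Set.indicator_of_mem (hE a ha hTa)]
      exact le_self_add
    · refine le_trans ?_ le_add_self
      rw [mul_left_comm]
      refine le_mul_of_one_le_right zero_le ?_
      refine le_trans (le_of_eq ?_) (mul_le_mul_right (not_lt.1 hTa) _)
      rw [← ENNReal.ofReal_mul (by positivity), div_mul_div_comm, mul_comm δ C,
        div_self (by positivity), ENNReal.ofReal_one]
  have h2 : ENNReal.ofReal (δ / C) * p.expect T ≤ ENNReal.ofReal δ := by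
    refine (mul_le_mul_right hT _).trans (le_of_eq ?_)
    rw [← ENNReal.ofReal_mul (by positivity), div_mul_cancel₀ _ hC.ne']
  rw [ENNReal.ofReal_sub _ hδ.le, ENNReal.ofReal_one, tsub_le_iff_right]
  exact h1.trans (add_le_add_right h2 _)

end PMF

section run

variable {O A : Type*} {H : ℕ} {oDum : O} {M : System O A H oDum}

theorem expect_traj_ofReal [Fintype O] [Fintype A] (π : Policy O A) {z : List (O × A) → ℝ}
    (hz : ∀ l, 0 ≤ z l) : (M.traj π H).expect (fun l => ENNReal.ofReal (z l)) =
      ENNReal.ofReal (∑ τ, M.prob π τ * z (List.ofFn τ)) := by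
  rw [ENNReal.ofReal_sum_of_nonneg fun τ _ => mul_nonneg (M.prob_nonneg π τ) (hz _), PMF.expect,
    ← tsum_fintype (L := .unconditional _)]
  have hsupp : Function.support (fun l => M.traj π H l * ENNReal.ofReal (z l)) ⊆
      Set.range (List.ofFn : (Fin H → O × A) → List (O × A)) := by
    intro l hl
    have hlen := M.traj_length (left_ne_zero_of_mul hl)
    subst hlen
    exact ⟨l.get, List.ofFn_get l⟩
  rw [← List.ofFn_injective.tsum_eq hsupp]
  refine tsum_congr fun τ => ?_
  rw [ENNReal.ofReal_mul (M.prob_nonneg π τ), System.prob,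
    ENNReal.ofReal_toReal (PMF.apply_ne_top _ _)]

/-- New data have the prescribed policies, and trajectories that are possible in the system. -/
theorem exists_of_mem_support_collect {πs : List (Policy O A)} {D D' : Data O A}
    (h : D' ∈ (collect M πs D).support) :
    ∃ E : Data O A, D' = D ++ E ∧ E.map Prod.fst = πs ∧ ∀ x ∈ E, M.traj x.1 H x.2 ≠ 0 := by
  induction πs generalizing D with
  | nil => exact ⟨[], by simpa [collect] using h, rfl, by simp⟩
  | cons π πs ih =>
    rw [collect, PMF.mem_support_bind_iff] at h
    obtain ⟨τ, hτ, h⟩ := h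
    obtain ⟨E, hE, hπ, hpos⟩ := ih h
    refine ⟨(π, τ) :: E, by simpa using hE, by simp [hπ], ?_⟩
    simpa using ⟨hτ, fun a b hab => hpos (a, b) hab⟩

/-- If a weight has expectation at most one under each policy, then its product along the data is a
supermartingale. -/
theorem expect_collect_le {Z : Policy O A × List (O × A) → ℝ≥0∞}
    (hZ : ∀ π, (M.traj π H).expect (fun l => Z (π, l)) ≤ 1) (πs : List (Policy O A))
    (D : Data O A) :
    (collect M πs D).expect (fun D' => (D'.map Z).prod) ≤ (D.map Z).prod := by
  induction πs generalizing D with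
  | nil => rw [collect, PMF.expect_pure]
  | cons π πs ih =>
    rw [collect, PMF.expect_bind]
    refine (PMF.expect_mono fun τ _ => ih (D ++ [(π, τ)])).trans ?_
    simp only [List.map_append, List.prod_append, List.map_cons, List.map_nil,
      List.prod_singleton]
    rw [PMF.expect_const_mul]
    exact mul_le_of_le_one_right zero_le (hZ π)

variable [Fintype A] [Nonempty A] {U : Fin H → Finset (Test O A)}
  {plan : CraneState O A H oDum → PMF (System O A H oDum × Policy O A)}

/-- The number of episodes in one iteration. -/
noncomputable def episodes (U : Fin H → Finset (Test O A)) : ℕ := ∑ n, (actionSeqs (U n)).card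

theorem exists_of_mem_support_craneRun_succ {k : ℕ} {s : CraneState O A H oDum}
    (hs : s ∈ (craneRun M U plan (k + 1)).support) :
    ∃ s₀ ∈ (craneRun M U plan k).support, ∃ x ∈ (plan s₀).support, ∃ E : Data O A,
      s.data = s₀.data ++ E ∧ E.map Prod.fst = exploreAll U x.2 ∧
      (∀ y ∈ E, M.traj y.1 H y.2 ≠ 0) ∧ s.plans = s₀.plans ++ [x] := by
  rw [craneRun, PMF.mem_support_bind_iff] at hs
  obtain ⟨s₀, hs₀, hs⟩ := hs
  rw [PMF.mem_support_bind_iff] at hs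
  obtain ⟨x, hx, hs⟩ := hs
  rw [PMF.mem_support_map_iff] at hs
  obtain ⟨D, hD, rfl⟩ := hs
  obtain ⟨E, rfl, hE, hpos⟩ := exists_of_mem_support_collect hD
  exact ⟨s₀, hs₀, x, hx, E, rfl, hE, hpos, rfl⟩

theorem length_data_of_mem_support {k : ℕ} {s : CraneState O A H oDum}
    (hs : s ∈ (craneRun M U plan k).support) : s.data.length = k * episodes U := by
  induction k generalizing s with
  | zero =>
    obtain rfl : s = ⟨[], []⟩ := by simpa [craneRun] using hs
    simp
  | succ k ih =>
    obtain ⟨s₀, hs₀, x, -, E, hdata, hE, -, -⟩ := exists_of_mem_support_craneRun_succ hs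
    have hlen : E.length = episodes U := by
      rw [← List.length_map (f := Prod.fst), hE, length_exploreAll, episodes]
    rw [hdata, List.length_append, ih hs₀, hlen]
    ring

/-- The expectation of the product of a weight along the data of the first `j` iterations. -/
theorem expect_craneRun_take_le {Z : Policy O A × List (O × A) → ℝ≥0∞}
    (hZ : ∀ π, (M.traj π H).expect (fun l => Z (π, l)) ≤ 1) (j k : ℕ) :
    (craneRun M U plan k).expect
      (fun s => ((s.data.take (j * episodes U)).map Z).prod) ≤ 1 := by
  induction k with
  | zero => rw [craneRun, PMF.expect_pure]; simp
  | succ k ih =>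
    rw [craneRun, PMF.expect_bind]
    refine (PMF.expect_mono fun s hs => ?_).trans ih
    rw [PMF.expect_bind]
    refine PMF.expect_le fun x _ => ?_
    rw [PMF.expect_map]
    have hlen := length_data_of_mem_support hs
    rcases le_or_gt j k with hjk | hjk
    · -- The data of the first `j` iterations are already there.
      refine PMF.expect_le fun D hD => ?_
      obtain ⟨E, rfl, -, -⟩ := exists_of_mem_support_collect hD
      have : j * episodes U ≤ s.data.length := hlen ▸ Nat.mul_le_mul_right _ hjk
      simp only [Function.comp_apply]
      rw [List.take_append_of_le_length this]
    · have htake : s.data.take (j * episodes U) = s.data :=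
        List.take_of_length_le (hlen ▸ Nat.mul_le_mul_right _ hjk.le)
      rw [htake]
      refine (PMF.expect_mono fun D hD => ?_).trans
        (expect_collect_le hZ (exploreAll U x.2) s.data)
      obtain ⟨E, rfl, hE, -⟩ := exists_of_mem_support_collect hD
      have hElen : E.length = episodes U := by
        rw [← List.length_map (f := Prod.fst), hE, length_exploreAll, episodes]
      simp only [Function.comp_apply]
      rw [List.take_of_length_le]
      rw [List.length_append, hlen, hElen]
      rw [← Nat.succ_mul]
      exact Nat.mul_le_mul_right _ hjk

/-- The structure of the run: the data come from exploring with the planned policies, and each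
plan was optimistic for the confidence set of the data available at that time. -/
theorem run_structure {r : Fin H → O → A → ℝ} {F : Set (System O A H oDum)} {β : ℝ} {K : ℕ}
    [Fintype O] (hplan : IsCranePlanner M U r F β K plan) {k : ℕ} (hk : k ≤ K)
    {s : CraneState O A H oDum} (hs : s ∈ (craneRun M U plan k).support) :
    s.plans.length = k ∧ s.data.map Prod.fst = s.plans.flatMap (fun x => exploreAll U x.2) ∧
      (∀ x ∈ s.data, M.traj x.1 H x.2 ≠ 0) ∧
      ∀ (j : ℕ) (hj : j < s.plans.length),
        IsOptimistic r (confSet F β (s.data.take (j * episodes U))) s.plans[j] := by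
  induction k generalizing s with
  | zero =>
    obtain rfl : s = ⟨[], []⟩ := by simpa [craneRun] using hs
    simp
  | succ k ih =>
    obtain ⟨s₀, hs₀, x, hx, E, hdata, hE, hpos, hplans⟩ := exists_of_mem_support_craneRun_succ hs
    obtain ⟨h1, h2, h3, h4⟩ := ih (by omega) hs₀
    have hlen := length_data_of_mem_support hs₀
    refine ⟨by simp [hplans, h1], by simp [hplans, hdata, h2, hE], ?_, ?_⟩
    · intro y hy
      rw [hdata, List.mem_append] at hy
      exact hy.elim (h3 y) (hpos y)
    · intro j hj
      have hjk : j ≤ k := by simp [hplans, h1] at hj; omega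
      rw [hdata, List.take_append_of_le_length (hlen ▸ Nat.mul_le_mul_right _ hjk)]
      rcases hjk.lt_or_eq with hjk | rfl
      · have : s.plans[j] = s₀.plans[j]'(h1 ▸ hjk) := by
          simp [hplans, h1, hjk]
        rw [this]
        exact h4 j (h1 ▸ hjk)
      · have : s.plans[j] = x := by simp [hplans, h1]
        rw [this, List.take_of_length_le hlen.le]
        exact hplan j (by omega) s₀ hs₀ x hx

end run

/-! ### The good event and its consequences -/

section lists

theorem List.take_flatMap_of_length {α β : Type*} {g : α → List β} {m : ℕ}
    (hg : ∀ x, (g x).length = m) (l : List α) (k : ℕ) :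
    (l.flatMap g).take (k * m) = (l.take k).flatMap g := by
  induction l generalizing k with
  | nil => simp
  | cons x l ih =>
    cases k with
    | zero => simp
    | succ k =>
      rw [List.flatMap_cons, List.take_succ_cons, List.flatMap_cons, ← ih,
        List.take_append, hg, List.take_of_length_le (by rw [hg]; nlinarith)]
      congr 2
      rw [Nat.succ_mul, Nat.add_sub_cancel]

theorem List.sum_map_take_eq {α : Type*} (l : List α) (d : α) (φ : α → ℝ) {k : ℕ}
    (hk : k ≤ l.length) :
    ((l.take k).map φ).sum = ∑ i ∈ Finset.range k, φ (l.getD i d) := by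
  induction k with
  | zero => simp
  | succ k ih =>
    have hk' : k < l.length := hk
    rw [Finset.sum_range_succ, ← ih hk'.le, List.take_succ_eq_append_getElem hk', List.map_append,
      List.sum_append, List.getD_eq_getElem _ _ hk']
    simp

theorem List.sq_sum_map_le {α : Type*} (l : List α) (φ : α → ℝ) :
    (l.map φ).sum ^ 2 ≤ l.length * (l.map fun x => φ x ^ 2).sum := by
  rw [← Fin.sum_univ_fun_getElem, ← Fin.sum_univ_fun_getElem]
  simpa using sq_sum_le_card_mul_sum_sq (s := (Finset.univ : Finset (Fin l.length)))
    (f := fun i => φ l[i])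

theorem List.sum_flatMap_eq {α : Type*} (l : List α) (φ : α → List ℝ) :
    (l.flatMap φ).sum = (l.map fun x => (φ x).sum).sum := by
  induction l with
  | nil => simp
  | cons x l ih => simp [ih]

theorem List.prod_map_ofReal {α : Type*} {z : α → ℝ} (hz : ∀ x, 0 ≤ z x) (l : List α) :
    (l.map fun x => ENNReal.ofReal (z x)).prod = ENNReal.ofReal (l.map z).prod := by
  induction l with
  | nil => simp
  | cons x l ih => simp [ih, ENNReal.ofReal_mul (hz x)]

end lists

section value

variable {O A : Type*} {H : ℕ} {oDum : O} {r : Fin H → O → A → ℝ}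

theorem totalReward_mem (hr : ∀ h o a, r h o a ∈ Set.Icc (0 : ℝ) 1) (τ : Fin H → O × A) :
    0 ≤ ∑ h, r h (τ h).1 (τ h).2 ∧ ∑ h, r h (τ h).1 (τ h).2 ≤ H := by
  refine ⟨Finset.sum_nonneg fun h _ => (hr _ _ _).1, ?_⟩
  exact (Finset.sum_le_card_nsmul _ _ 1 fun h _ => (hr _ _ _).2).trans (by simp)

variable [Fintype O] [Fintype A]

theorem abs_value_sub_le (hr : ∀ h o a, r h o a ∈ Set.Icc (0 : ℝ) 1)
    (f g : System O A H oDum) (π : Policy O A) :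
    |f.value r π - g.value r π| ≤ H * f.trajDist g π := by
  rw [System.value, System.value, expectedReturn, expectedReturn, ← Finset.sum_sub_distrib,
    System.trajDist, Finset.mul_sum]
  refine (Finset.abs_sum_le_sum_abs _ _).trans (Finset.sum_le_sum fun τ _ => ?_)
  obtain ⟨h0, h1⟩ := totalReward_mem hr τ
  rw [← sub_mul, abs_mul, abs_of_nonneg h0, mul_comm]
  exact mul_le_mul_of_nonneg_right h1 (abs_nonneg _)

theorem value_nonneg (hr : ∀ h o a, r h o a ∈ Set.Icc (0 : ℝ) 1)
    (f : System O A H oDum) (π : Policy O A) : 0 ≤ f.value r π :=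
  Finset.sum_nonneg fun τ _ => mul_nonneg (f.prob_nonneg π τ) (totalReward_mem hr τ).1

theorem value_le (hr : ∀ h o a, r h o a ∈ Set.Icc (0 : ℝ) 1)
    (f : System O A H oDum) (π : Policy O A) : f.value r π ≤ H := by
  calc f.value r π ≤ ∑ τ, f.prob π τ * H := Finset.sum_le_sum fun τ _ =>
        mul_le_mul_of_nonneg_left (totalReward_mem hr τ).2 (f.prob_nonneg π τ)
    _ = H := by rw [← Finset.sum_mul, f.sum_prob, one_mul]

theorem mixValue_eq (M : System O A H oDum) (πs : List (Policy O A)) :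
    M.mixValue r πs = (πs.map (M.value r)).sum / πs.length := by
  have h : ∀ l : List (Policy O A), ∀ c : ℝ,
      ∑ τ, (l.map fun π => M.prob π τ).sum / c * ∑ h, r h (τ h).1 (τ h).2 =
        (l.map (M.value r)).sum / c := by
    intro l c
    induction l with
    | nil => simp
    | cons π l ih =>
      simp only [List.map_cons, List.sum_cons, add_div, add_mul, Finset.sum_add_distrib, ih]
      congr 1
      rw [System.value, expectedReturn, Finset.sum_div]
      exact Finset.sum_congr rfl fun τ _ => by ring
  exact h πs _

end value

section goodEvent

variable {O A : Type*} {H : ℕ} {oDum : O}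
  {M : System O A H oDum} {U : Fin H → Finset (Test O A)} {F : Set (System O A H oDum)}
  {plan : CraneState O A H oDum → PMF (System O A H oDum × Policy O A)} {N : ℕ} {ε : ℝ}
  {G : Fin N → Policy O A → (Fin H → O × A) → ℝ}

theorem episodes_le [Fintype A] [Nonempty A] (U : Fin H → Finset (Test O A)) :
    episodes U ≤ H * numActionSeqs U := by
  obtain ⟨π⟩ : Nonempty (Policy O A) := ⟨fun _ _ => PMF.uniformOfFintype A⟩
  rw [episodes, ← length_exploreAll U π]
  exact length_exploreAll_le U π

variable [Fintype O] [Fintype A]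

/-- The sum of all likelihood ratio processes, over the brackets and the iterations.  The good event
is that it is small. -/
noncomputable def ratioSum (M : System O A H oDum) (U : Fin H → Finset (Test O A)) (ε : ℝ)
    (G : Fin N → Policy O A → (Fin H → O × A) → ℝ) (K : ℕ) (D : Data O A) : ℝ≥0∞ :=
  ∑ k ∈ Finset.range K, ∑ i, (((D.take (k * episodes U)).map fun x =>
    ENNReal.ofReal (likRatio M ε (G i) x)).prod + ((D.take (k * episodes U)).map fun x =>
    ENNReal.ofReal (sqrtLikRatio M ε (G i) x)).prod)

theorem prod_le_of_ratioSum_lt (hG : IsUpperBracketing F ε G) {K : ℕ} {D : Data O A} {c : ℝ}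
    (h : ratioSum M U ε G K D < ENNReal.ofReal (Real.exp c)) {k : ℕ} (hk : k < K) (i : Fin N) :
    ((D.take (k * episodes U)).map (likRatio M ε (G i))).prod ≤ Real.exp c ∧
      ((D.take (k * episodes U)).map (sqrtLikRatio M ε (G i))).prod ≤ Real.exp c := by
  have h1 := (Finset.single_le_sum (f := fun i : Fin N => ((D.take (k * episodes U)).map fun x =>
    ENNReal.ofReal (likRatio M ε (G i) x)).prod + ((D.take (k * episodes U)).map fun x =>
    ENNReal.ofReal (sqrtLikRatio M ε (G i) x)).prod) (fun _ _ => zero_le)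
    (Finset.mem_univ i)).trans (Finset.single_le_sum (f := fun k => ∑ i,
      (((D.take (k * episodes U)).map fun x =>
    ENNReal.ofReal (likRatio M ε (G i) x)).prod + ((D.take (k * episodes U)).map fun x =>
    ENNReal.ofReal (sqrtLikRatio M ε (G i) x)).prod)) (fun _ _ => zero_le)
    (Finset.mem_range.2 hk))
  have h2 := h1.trans h.le
  rw [List.prod_map_ofReal fun x => likRatio_nonneg (hG.nonneg i) x,
    List.prod_map_ofReal fun x => sqrtLikRatio_nonneg x] at h2
  exact ⟨(ENNReal.ofReal_le_ofReal_iff (Real.exp_pos c).le).1 (le_self_add.trans h2),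
    (ENNReal.ofReal_le_ofReal_iff (Real.exp_pos c).le).1 (le_add_self.trans h2)⟩

/-- On the good event the true system is in the confidence set. -/
theorem mem_confSet_of_prod_le (hG : IsUpperBracketing F ε G) (hM : M ∈ F) {D : Data O A}
    (hD : ∀ x ∈ D, M.traj x.1 H x.2 ≠ 0) (hlen : ε * D.length ≤ 1) {c β : ℝ} (hβ : c + 1 ≤ β)
    (h : ∀ i, (D.map (likRatio M ε (G i))).prod ≤ Real.exp c) : M ∈ confSet F β D := by
  refine mem_confSet hM fun f hf => ?_
  obtain ⟨i, hi, -⟩ := hG.exists_bracket f hf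
  refine (likelihood_le_prod_likRatio (ε := ε) hi D hD).trans ?_
  refine mul_le_mul_of_nonneg_right ?_ (likelihood_nonneg _ _)
  calc _ ≤ Real.exp c * Real.exp 1 :=
        mul_le_mul (h i) (Real.exp_le_exp.2 hlen) (Real.exp_pos _).le (Real.exp_pos _).le
    _ ≤ Real.exp β := by
        rw [← Real.exp_add]
        exact Real.exp_le_exp.2 hβ

/-- On the good event all models of the confidence set are close to the true system along the
data. -/
theorem sum_sq_trajDist_le_of_prod_le (hG : IsUpperBracketing F ε G) (hM : M ∈ F) {D : Data O A}
    (hD : ∀ x ∈ D, M.traj x.1 H x.2 ≠ 0) (hε0 : 0 ≤ ε) (hε1 : ε ≤ 1) (hlen : ε * D.length ≤ 1)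
    {c β : ℝ} (hβ : c + 1 ≤ β)
    (h : ∀ i, (D.map (sqrtLikRatio M ε (G i))).prod ≤ Real.exp c) {f : System O A H oDum}
    (hf : f ∈ confSet F β D) :
    (D.map fun x => f.trajDist M x.1 ^ 2).sum ≤ 36 * β + 2 := by
  obtain ⟨i, hi, hgap⟩ := hG.exists_bracket f hf.1
  have h1 := sum_hellinger_le (ε := ε) hi D hD (likelihood_le_of_mem_confSet hM hf) (h i)
  have h2 : (D.map fun x => f.trajDist M x.1 ^ 2).sum ≤
      (D.map fun x => 12 * hellinger M (G i) x.1 + 2 * ε ^ 2).sum :=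
    List.sum_le_sum fun x _ =>
      sq_trajDist_le hi (hG.nonneg i) (hG.sum_le i) hε1 x.1 (hgap x.1)
  have h3 : (D.map fun x => 12 * hellinger M (G i) x.1 + 2 * ε ^ 2).sum =
      12 * (D.map fun x => hellinger M (G i) x.1).sum + 2 * ε ^ 2 * D.length := by
    rw [List.sum_map_add, List.sum_map_mul_left]
    simp
    ring
  have h4 : ε ^ 2 * D.length ≤ 1 := by
    rw [sq, mul_assoc]
    exact mul_le_one₀ hε1 (by positivity) hlen
  linarith

variable [Nonempty A]

theorem expect_ratioSum_le (hG : IsUpperBracketing F ε G) (K : ℕ) :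
    (craneRun M U plan K).expect (fun s => ratioSum M U ε G K s.data) ≤
      ENNReal.ofReal (2 * N * K) := by
  have h1 : ∀ i π, (M.traj π H).expect
      (fun l => ENNReal.ofReal (likRatio M ε (G i) (π, l))) ≤ 1 := by
    intro i π
    rw [expect_traj_ofReal π fun l => likRatio_nonneg (hG.nonneg i) _]
    exact ENNReal.ofReal_le_one.2 (sum_prob_mul_likRatio_le (hG.nonneg i) (hG.sum_le i) π)
  have h2 : ∀ i π, (M.traj π H).expect
      (fun l => ENNReal.ofReal (sqrtLikRatio M ε (G i) (π, l))) ≤ 1 := by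
    intro i π
    rw [expect_traj_ofReal π fun l => sqrtLikRatio_nonneg _]
    exact ENNReal.ofReal_le_one.2 (sum_prob_mul_sqrtLikRatio_le (hG.nonneg i) (hG.sum_le i) π)
  have hadd : ∀ (p : PMF (CraneState O A H oDum)) (g g' : CraneState O A H oDum → ℝ≥0∞),
      p.expect (fun s => g s + g' s) = p.expect g + p.expect g' := by
    intro p g g'
    simp only [PMF.expect, mul_add, ENNReal.tsum_add]
  simp only [ratioSum, PMF.expect_sum, hadd]
  calc _ ≤ ∑ _k ∈ Finset.range K, ∑ _i : Fin N, ((1 : ℝ≥0∞) + 1) :=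
        Finset.sum_le_sum fun k _ => Finset.sum_le_sum fun i _ =>
          add_le_add (expect_craneRun_take_le (h1 i) k K) (expect_craneRun_take_le (h2 i) k K)
    _ = ENNReal.ofReal (2 * N * K) := by
        rw [show (2 * N * K : ℝ) = ((2 * N * K : ℕ) : ℝ) by push_cast; ring,
          ENNReal.ofReal_natCast]
        simp
        ring

/-- On the good event the uniform mixture of the planned policies is nearly optimal. -/
theorem optValue_sub_mixValue_le {r : Fin H → O → A → ℝ}
    (hr : ∀ h o a, r h o a ∈ Set.Icc (0 : ℝ) 1) {α : ℝ} (hα : 0 < α) (hH : 0 < H)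
    (hU : ∀ h : Fin H, (h : ℕ) + 1 = H → ∀ o : O, (([], o) : Test O A) ∈ U h)
    (hU0 : 0 < numActionSeqs U) (hM : M ∈ F)
    (hcore : ∀ f ∈ F, ∀ h : Fin H, f.IsCoreTestSet h (U h))
    (hreg : ∀ f ∈ F, ∀ h : Fin H, f.RegularAt α h (U h)) {K : ℕ} (hK : 0 < K) {c β : ℝ}
    (hβ0 : 0 ≤ β) (hβ : c + 1 ≤ β) (hplan : IsCranePlanner M U r F β K plan)
    (hG : IsUpperBracketing F (1 / ((K : ℝ) * H * numActionSeqs U)) G)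
    {s : CraneState O A H oDum} (hs : s ∈ (craneRun M U plan K).support)
    (hgood : ratioSum M U (1 / ((K : ℝ) * H * numActionSeqs U)) G K s.data <
      ENNReal.ofReal (Real.exp c)) :
    M.optValue r - M.mixValue r (s.plans.map Prod.snd) ≤
      H * ((1 / α + 1) * ((H + 1) * eluderBound (M.psrRank + 1 : ℝ)
        (2 * (Fintype.card A * numActionSeqs U * (1 / α * numActionSeqs U) + numActionSeqs U))
        (((Fintype.card A : ℝ) ^ 2 * numActionSeqs U * (1 / α) + Fintype.card A) ^ 2 *
          (H * numActionSeqs U * (36 * β + 2))) K)) / K := by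
  obtain ⟨hplen, hfst, hpos, hopt⟩ := run_structure hplan le_rfl hs
  have hdlen := length_data_of_mem_support hs
  set ε : ℝ := 1 / ((K : ℝ) * H * numActionSeqs U) with hε
  have hKHU : (1 : ℝ) ≤ (K : ℝ) * H * numActionSeqs U := by
    exact_mod_cast Nat.mul_pos (Nat.mul_pos hK hH) hU0
  have hε0 : 0 ≤ ε := by positivity
  have hε1 : ε ≤ 1 := by rw [hε, div_le_one (by linarith)]; exact hKHU
  have hlen : ∀ k, ε * (s.data.take (k * episodes U)).length ≤ 1 := by
    intro k
    rw [hε, one_div, inv_mul_le_iff₀ (by linarith), mul_one]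
    have h1 : (s.data.take (k * episodes U)).length ≤ K * H * numActionSeqs U := by
      rw [mul_assoc]
      refine (List.length_take_le' _ _).trans (hdlen.le.trans (Nat.mul_le_mul_left _ ?_))
      exact episodes_le U
    exact_mod_cast h1
  have hposk : ∀ k, ∀ x ∈ s.data.take (k * episodes U), M.traj x.1 H x.2 ≠ 0 :=
    fun k x hx => hpos x (List.mem_of_mem_take hx)
  -- The models and policies of the rounds, continued arbitrarily after round `K`.
  let z : ℕ → System O A H oDum × Policy O A := fun k =>
    s.plans.getD k (M, fun _ _ => PMF.uniformOfFintype A)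
  have hz : ∀ k < K, IsOptimistic r (confSet F β (s.data.take (k * episodes U))) (z k) := by
    intro k hk
    have : z k = s.plans[k]'(hplen ▸ hk) := List.getD_eq_getElem _ _ _
    rw [this]
    exact hopt k (hplen ▸ hk)
  have hMk : ∀ k < K, M ∈ confSet F β (s.data.take (k * episodes U)) := fun k hk =>
    mem_confSet_of_prod_le hG hM (hposk k) (hlen k) hβ
      fun i => (prod_le_of_ratioSum_lt hG hgood hk i).1
  have hzF : ∀ k, (z k).1 ∈ F := by
    intro k
    rcases lt_or_ge k K with hk | hk
    · exact (hz k hk).1.1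
    · have : z k = (M, fun _ _ => PMF.uniformOfFintype A) :=
        List.getD_eq_default _ _ (hplen ▸ hk)
      rw [this]
      exact hM
  have hdata : ∀ k < K, ∑ i ∈ Finset.range k, exploreDist (z k).1 M U (z i).2 ^ 2 ≤
      H * numActionSeqs U * (36 * β + 2) := by
    intro k hk
    have h1 := sum_sq_trajDist_le_of_prod_le hG hM (hposk k) hε0 hε1 (hlen k) hβ
      (fun i => (prod_le_of_ratioSum_lt hG hgood hk i).2) (hz k hk).1
    have h2 : ((s.data.take (k * episodes U)).map fun x => (z k).1.trajDist M x.1 ^ 2).sum =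
        ∑ i ∈ Finset.range k,
          ((exploreAll U (z i).2).map fun π => (z k).1.trajDist M π ^ 2).sum := by
      have h3 : (s.data.take (k * episodes U)).map Prod.fst =
          (s.plans.take k).flatMap fun x => exploreAll U x.2 := by
        rw [List.map_take, hfst, List.take_flatMap_of_length]
        intro x
        rw [length_exploreAll, episodes]
      have h4 : (s.data.take (k * episodes U)).map (fun x => (z k).1.trajDist M x.1 ^ 2) =
          ((s.data.take (k * episodes U)).map Prod.fst).map
            fun π => (z k).1.trajDist M π ^ 2 := by
        rw [List.map_map]; rfl
      rw [h4, h3, List.map_flatMap, ← List.sum_map_take_eq s.plans _ (fun x =>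
        ((exploreAll U x.2).map fun π => (z k).1.trajDist M π ^ 2).sum) (hplen ▸ hk.le),
        List.sum_flatMap_eq]
    rw [h2] at h1
    refine le_trans ?_ (mul_le_mul_of_nonneg_left h1 (by positivity))
    rw [Finset.mul_sum]
    refine Finset.sum_le_sum fun i _ => (List.sq_sum_map_le _ _).trans ?_
    refine mul_le_mul_of_nonneg_right ?_ (List.sum_nonneg fun a ha => ?_)
    · exact_mod_cast length_exploreAll_le U _
    · obtain ⟨π, -, rfl⟩ := List.mem_map.1 ha
      exact sq_nonneg _
  have hregret := sum_trajDist_le (a := 1 / α) (by positivity) hH hU hU0 (hcore M hM)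
    (fun n => ((hreg M hM n).nonempty_predictor (hcore M hM n)).some)
    (fun k => (z k).1)
    (fun k n => ((hreg _ (hzF k) n).nonempty_predictor (hcore _ (hzF k) n)).some)
    (fun k => (z k).2) K (by positivity) hdata
  have hK' : (0 : ℝ) < K := by exact_mod_cast hK
  have hround : ∀ k < K, M.optValue r - M.value r (z k).2 ≤ H * (z k).1.trajDist M (z k).2 := by
    intro k hk
    have h1 : M.optValue r ≤ (z k).1.value r (z k).2 := by
      have : Nonempty (Policy O A) := ⟨fun _ _ => PMF.uniformOfFintype A⟩
      exact ciSup_le fun π => (hz k hk).2 M (hMk k hk) π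
    have h2 := (abs_le.1 (abs_value_sub_le hr (z k).1 M (z k).2)).2
    linarith
  have hmix : M.mixValue r (s.plans.map Prod.snd) =
      (∑ k ∈ Finset.range K, M.value r (z k).2) / K := by
    rw [mixValue_eq, List.length_map, hplen, List.map_map, ← List.sum_map_take_eq s.plans _
      (fun x => M.value r x.2) hplen.ge, List.take_of_length_le hplen.le]
    rfl
  rw [hmix, le_div_iff₀ hK', sub_mul, div_mul_cancel₀ _ hK'.ne']
  calc M.optValue r * K - ∑ k ∈ Finset.range K, M.value r (z k).2
      = ∑ k ∈ Finset.range K, (M.optValue r - M.value r (z k).2) := by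
        rw [Finset.sum_sub_distrib]
        simp [mul_comm]
    _ ≤ ∑ k ∈ Finset.range K, H * (z k).1.trajDist M (z k).2 :=
        Finset.sum_le_sum fun k hk => hround k (Finset.mem_range.1 hk)
    _ ≤ _ := by
        rw [← Finset.mul_sum]
        exact mul_le_mul_of_nonneg_left hregret (Nat.cast_nonneg _)

end goodEvent

/-! ### The sample size -/

/-- The polynomial factor of the squared regret, in terms of the rank, the number of action
sequences, the inverse regularity, the horizon and the number of actions. -/
def regretFactor {R : Type*} [CommRing R] (d u a H A : R) : R :=
  H ^ 2 * (a + 1) ^ 2 * (H + 1) ^ 2 * d ^ 5 * (1 + d) *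
    (d * (2 * (A * u * (a * u) + u)) ^ 2 + 108 * (A ^ 2 * u * a + A) ^ 2 * (H * u))

/-- The number of rounds, up to the factor `1 / ε ^ 2`, that makes up for a regret factor `q`, an
additive logarithmic term `Q` and `l = log (1 / ε)`. -/
def sampleSize {R : Type*} [CommRing R] (q Q l : R) : R :=
  q * (8 * (Q + q) ^ 2 + 32 * l ^ 2 + 4096)

theorem sq_le_regretFactor {d u a H A : ℝ} (hd : 1 ≤ d) (hu : 1 ≤ u) (ha : 0 ≤ a) (hH : 1 ≤ H)
    (hA : 1 ≤ A) : H ^ 2 ≤ regretFactor d u a H A := by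
  have h1 : 1 ≤ (a + 1) ^ 2 := one_le_pow₀ (by linarith)
  have h2 : 1 ≤ (H + 1) ^ 2 := one_le_pow₀ (by linarith)
  have h3 : 1 ≤ d ^ 5 := one_le_pow₀ hd
  have h4 : 1 ≤ 1 + d := by linarith
  have h5 : 1 ≤ d * (2 * (A * u * (a * u) + u)) ^ 2 + 108 * (A ^ 2 * u * a + A) ^ 2 * (H * u) := by
    have h6 : 1 ≤ (A ^ 2 * u * a + A) ^ 2 := one_le_pow₀ (by
      have : 0 ≤ A ^ 2 * u * a := by positivity
      linarith)
    have h7 : 1 ≤ H * u := one_le_mul_of_one_le_of_one_le hH hu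
    have h8 : 1 ≤ (A ^ 2 * u * a + A) ^ 2 * (H * u) := one_le_mul_of_one_le_of_one_le h6 h7
    have h9 : 0 ≤ d * (2 * (A * u * (a * u) + u)) ^ 2 := by positivity
    linarith
  have hH2 : 0 ≤ H ^ 2 := sq_nonneg H
  unfold regretFactor
  calc H ^ 2 = H ^ 2 * 1 * 1 * 1 * 1 * 1 := by ring
    _ ≤ _ := by gcongr

/-- The inversion of the logarithm: a number of rounds that is polynomial in `log (1 / ε)` dominates
the corresponding power of its own logarithm. -/
theorem mul_sq_log_le {q Q ε K : ℝ} (hq : 1 ≤ q) (hQ : 0 ≤ Q) (hε : 0 < ε) (hK : 1 ≤ K)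
    (h : 1 / ε ^ 2 * sampleSize q Q (Real.log (1 / ε)) ≤ K) :
    q * (Q + Real.log K) ^ 2 ≤ K * ε ^ 2 := by
  set l := Real.log (1 / ε) with hl
  set y := K * ε ^ 2 / q with hy
  have hq0 : 0 < q := by linarith
  have hy1 : 8 * (Q + q) ^ 2 + 32 * l ^ 2 + 4096 ≤ y := by
    rw [hy, le_div_iff₀ hq0]
    rw [sampleSize, one_div, inv_mul_le_iff₀ (by positivity)] at h
    linarith
  have hy0 : 0 < y := by
    have : 0 ≤ 8 * (Q + q) ^ 2 + 32 * l ^ 2 := by positivity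
    linarith
  set z := √(√y) with hz
  have hz0 : 0 < z := Real.sqrt_pos.2 (Real.sqrt_pos.2 hy0)
  have hz2 : z ^ 2 = √y := Real.sq_sqrt (Real.sqrt_nonneg y)
  have hz4 : z ^ 4 = y := by
    rw [show 4 = 2 * 2 from rfl, pow_mul, hz2, Real.sq_sqrt hy0.le]
  have hlogK : Real.log K ≤ 4 * z + q + 2 * |l| := by
    have h1 : K = y * q * (1 / ε) ^ 2 := by
      rw [hy]
      field_simp
    have h2 : Real.log K = Real.log y + Real.log q + 2 * l := by
      conv_lhs => rw [h1]
      rw [Real.log_mul (by positivity) (by positivity), Real.log_mul hy0.ne' hq0.ne',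
        Real.log_pow]
      push_cast
      rfl
    have h3 : Real.log y = 4 * Real.log z := by
      rw [← hz4, Real.log_pow]
      push_cast
      rfl
    have h4 := Real.log_le_self hz0.le
    have h5 := Real.log_le_self hq0.le
    have h6 := le_abs_self l
    linarith
  have hlog0 : 0 ≤ Real.log K := Real.log_nonneg hK
  have hz64 : 64 ≤ z ^ 2 := by
    rw [hz2]
    refine Real.le_sqrt_of_sq_le ?_
    have : 0 ≤ 8 * (Q + q) ^ 2 + 32 * l ^ 2 := by positivity
    linarith
  have hfin : (Q + Real.log K) ^ 2 ≤ y := by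
    have h1 : (Q + Real.log K) ^ 2 ≤ ((Q + q) + 2 * |l| + 4 * z) ^ 2 :=
      pow_le_pow_left₀ (by linarith) (by linarith) 2
    have h2 : ((Q + q) + 2 * |l| + 4 * z) ^ 2 ≤
        4 * (Q + q) ^ 2 + 16 * l ^ 2 + 32 * z ^ 2 := by
      rw [← sq_abs l]
      nlinarith [sq_nonneg ((Q + q) + 2 * |l| - 4 * z), sq_nonneg ((Q + q) - 2 * |l|)]
    have h3 : 64 * z ^ 2 ≤ y := by
      rw [← hz4]
      nlinarith [sq_nonneg z]
    linarith
  calc q * (Q + Real.log K) ^ 2 ≤ q * y := by gcongr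
    _ = K * ε ^ 2 := by rw [hy]; field_simp

/-- The average of an eluder sum, times a factor `M`, is at most `ε` if the number of rounds
dominates the square of the logarithmic terms, all of which are bounded by `t`. -/
theorem eluderBound_mul_le {d R C u H β t ε K M : ℝ} (hd : 1 ≤ d) (hu : 1 ≤ u) (hH : 1 ≤ H)
    (hK : 0 < K) (ht : 1 ≤ t) (hε : 0 < ε) (hM : 0 < M) (hβ : 36 * β + 2 ≤ 108 * t)
    (_ : 0 ≤ β) (hL : d + Real.log (1 + K) ≤ t)
    (h : M ^ 2 * d ^ 5 * (1 + d) * (d * R ^ 2 + 108 * C ^ 2 * (H * u)) * t ^ 2 ≤ K * ε ^ 2) :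
    M * (d ^ 2 * √(K * ((d * R ^ 2 + C ^ 2 * (H * u * (36 * β + 2))) *
      ((1 + d) * (d * (d + Real.log (1 + K))))))) ≤ ε * K := by
  have hlog : 0 ≤ Real.log (1 + K) := Real.log_nonneg (by linarith)
  have hW : d * R ^ 2 + C ^ 2 * (H * u * (36 * β + 2)) ≤
      (d * R ^ 2 + 108 * C ^ 2 * (H * u)) * t := by
    rw [add_mul]
    refine add_le_add (le_mul_of_one_le_right (by positivity) ht) ?_
    calc C ^ 2 * (H * u * (36 * β + 2)) ≤ C ^ 2 * (H * u * (108 * t)) := by gcongr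
      _ = _ := by ring
  have hsqrt : √(K * ((d * R ^ 2 + C ^ 2 * (H * u * (36 * β + 2))) *
      ((1 + d) * (d * (d + Real.log (1 + K)))))) ≤ ε * K / (M * d ^ 2) := by
    refine Real.sqrt_le_iff.2 ⟨by positivity, ?_⟩
    rw [div_pow, le_div_iff₀ (by positivity)]
    calc _ ≤ K * ((d * R ^ 2 + 108 * C ^ 2 * (H * u)) * t * ((1 + d) * (d * t))) *
          (M * d ^ 2) ^ 2 := by gcongr
      _ = K * (M ^ 2 * d ^ 5 * (1 + d) * (d * R ^ 2 + 108 * C ^ 2 * (H * u)) * t ^ 2) := by ring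
      _ ≤ K * (K * ε ^ 2) := by gcongr
      _ = (ε * K) ^ 2 := by ring
  rw [le_div_iff₀ (by positivity)] at hsqrt
  linarith

/-- For the sample size of the theorem, the bound on the average regret is at most `ε`. -/
theorem regret_bound_le {d u a H A lN lδ ε β : ℝ} {K : ℕ} (hd : 1 ≤ d) (hu : 1 ≤ u) (ha : 0 ≤ a)
    (hH : 1 ≤ H) (hA : 1 ≤ A) (hlN : 0 ≤ lN) (hlδ : 0 ≤ lδ) (hε : 0 < ε) (hK : 0 < K)
    (hβ0 : 0 ≤ β) (hβ : β ≤ 3 * (lN + Real.log K + H + u + lδ))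
    (h : 1 / ε ^ 2 * sampleSize (regretFactor d u a H A) (lN + H + u + lδ + 1 + d)
      (Real.log (1 / ε)) ≤ K) :
    H * ((a + 1) * ((H + 1) * eluderBound d (2 * (A * u * (a * u) + u))
      ((A ^ 2 * u * a + A) ^ 2 * (H * u * (36 * β + 2))) K)) / K ≤ ε := by
  have hK1 : (1 : ℝ) ≤ K := by exact_mod_cast hK
  have hK0 : (0 : ℝ) < K := by linarith
  have hq1 : 1 ≤ regretFactor d u a H A :=
    (one_le_pow₀ hH).trans (sq_le_regretFactor hd hu ha hH hA)
  have hmain := mul_sq_log_le hq1 (by linarith) hε hK1 h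
  have hlog0 : 0 ≤ Real.log K := Real.log_nonneg hK1
  have hlog1 : Real.log (1 + K) ≤ 1 + Real.log K := by
    calc Real.log (1 + K) ≤ Real.log (2 * K) := Real.log_le_log (by positivity) (by linarith)
      _ = Real.log 2 + Real.log K := Real.log_mul (by norm_num) hK0.ne'
      _ ≤ 1 + Real.log K := by linarith [Real.log_two_lt_d9]
  rw [div_le_iff₀ hK0, eluderBound]
  refine le_trans (le_of_eq (by ring)) (eluderBound_mul_le (M := H * (a + 1) * (H + 1)) hd hu hH hK0
    (t := lN + H + u + lδ + 1 + d + Real.log K) (by linarith) hε (by positivity) (by linarith) hβ0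
    (by linarith) (R := 2 * (A * u * (a * u) + u)) (C := A ^ 2 * u * a + A) ?_)
  rwa [regretFactor, ← mul_pow, ← mul_pow] at hmain

theorem numActionSeqs_pos {O A : Type*} {H : ℕ} (hH : 0 < H) (o : O)
    {U : Fin H → Finset (Test O A)}
    (hU : ∀ h : Fin H, (h : ℕ) + 1 = H → ∀ o : O, (([], o) : Test O A) ∈ U h) :
    0 < numActionSeqs U := by
  classical
  let n : Fin H := ⟨H - 1, by omega⟩
  have hmem : (([], o) : Test O A) ∈ U n := hU n (Nat.sub_add_cancel hH) o
  have hcard : 0 < (actionSeqs (U n)).card := by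
    rw [Finset.card_pos, actionSeqs, Finset.image_nonempty]
    exact ⟨_, hmem⟩
  exact hcard.trans_le (card_actionSeqs_le U n)

theorem corollary1 :
    ∃ (c : ℝ) (P : MvPolynomial (Fin 9) ℝ), 0 < c ∧
      ∀ (O A : Type*) [Fintype O] [Fintype A] [Nonempty A] (H : ℕ) (_ : 0 < H) (oDum : O)
        -- the known rewards, the core test sets, the model class and the true model
        (r : Fin H → O → A → ℝ) (_ : ∀ h o a, r h o a ∈ Set.Icc (0 : ℝ) 1)
        (U : Fin H → Finset (Test O A))
        (F : Set (System O A H oDum)) (fstar : System O A H oDum) (α : ℝ) (_ : 0 < α)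
        -- all one-step observations are core tests at the last step
        (_ : ∀ h : Fin H, (h : ℕ) + 1 = H → ∀ o : O, (([], o) : Test O A) ∈ U h)
        -- realizability, validity and regularity of the model class (hence of the true model)
        (_ : fstar ∈ F)
        (_ : ∀ f ∈ F, ∀ h : Fin H, f.IsCoreTestSet h (U h))
        (_ : ∀ f ∈ F, ∀ h : Fin H, f.RegularAt α h (U h))
        (δ ε : ℝ) (_ : 0 < δ) (_ : δ ≤ 1) (_ : 0 < ε)
        (K N : ℕ) (β : ℝ) (_ : 0 < K)
        (_ : N = bracketNumber F (1 / ((K : ℝ) * H * numActionSeqs U)))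
        (_ : β = c * Real.log ((N : ℝ) * K * H * numActionSeqs U / δ))
        (_ : 1 / ε ^ 2 * MvPolynomial.eval
            ![(fstar.psrRank : ℝ), (numActionSeqs U : ℝ), 1 / α, Real.log N, (H : ℝ),
              (Fintype.card A : ℝ), Real.log (Fintype.card O), Real.log (1 / δ),
              Real.log (1 / ε)] P ≤ (K : ℝ))
        (plan : CraneState O A H oDum → PMF (System O A H oDum × Policy O A))
        (_ : IsCranePlanner fstar U r F β K plan),
        ENNReal.ofReal (1 - δ) ≤ (craneRun fstar U plan K).toOuterMeasure
          {s | s.data.length ≤ K * H * numActionSeqs U ∧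
            fstar.optValue r - ε ≤ fstar.mixValue r (s.plans.map Prod.snd)} := by
  -- The rank is increased by one, so that it is positive and the initial error is covered as well.
  refine ⟨3, sampleSize (regretFactor (.X 0 + 1) (.X 1) (.X 2) (.X 4) (.X 5))
    (.X 3 + .X 4 + .X 1 + .X 7 + 1 + (.X 0 + 1)) (.X 8), by norm_num, ?_⟩
  intro O A _ _ _ H hH oDum r hr U F fstar α hα hU hfF hcore hreg δ ε hδ hδ1 hε K N β hK hN hβ hKP
    plan hplan
  have hU0 : 0 < numActionSeqs U := numActionSeqs_pos hH oDum hU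
  have hlen : ∀ s ∈ (craneRun fstar U plan K).support,
      s.data.length ≤ K * H * numActionSeqs U := by
    intro s hs
    rw [length_data_of_mem_support hs, mul_assoc]
    exact Nat.mul_le_mul_left _ (episodes_le U)
  rcases le_or_gt (H : ℝ) ε with hHε | hHε
  -- If the accuracy is at least the horizon, then all policies are good enough.
  · refine le_trans (ENNReal.ofReal_le_one.2 (by linarith)) (le_of_eq ?_)
    symm
    rw [PMF.toOuterMeasure_apply_eq_one_iff]
    intro s hs
    refine ⟨hlen s hs, ?_⟩
    have : Nonempty (Policy O A) := ⟨fun _ _ => PMF.uniformOfFintype A⟩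
    have h1 : fstar.optValue r ≤ H := ciSup_le fun π => value_le hr fstar π
    have h2 : 0 ≤ fstar.mixValue r (s.plans.map Prod.snd) := by
      rw [mixValue_eq]
      refine div_nonneg (List.sum_nonneg fun a ha => ?_) (Nat.cast_nonneg _)
      obtain ⟨π, -, rfl⟩ := List.mem_map.1 ha
      exact value_nonneg hr fstar π
    linarith
  have hK0 : (0 : ℝ) < K := by exact_mod_cast hK
  have hH1 : (1 : ℝ) ≤ H := by exact_mod_cast hH
  have hu1 : (1 : ℝ) ≤ numActionSeqs U := by exact_mod_cast hU0
  have hA1 : (1 : ℝ) ≤ Fintype.card A := by exact_mod_cast Fintype.card_pos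
  have hd1 : (1 : ℝ) ≤ fstar.psrRank + 1 := by simp
  have ha0 : 0 ≤ 1 / α := by positivity
  subst hN
  obtain ⟨G, hG⟩ := exists_isUpperBracketing F
    (show 0 < 1 / ((K : ℝ) * H * numActionSeqs U) by positivity)
  set N := bracketNumber F (1 / ((K : ℝ) * H * numActionSeqs U)) with hN
  have hN1 : (1 : ℝ) ≤ N := by
    obtain ⟨i, -⟩ := hG.exists_bracket fstar hfF
    exact_mod_cast (Fin.pos i : 0 < N)
  have hP : 1 / ε ^ 2 * sampleSize
      (regretFactor (fstar.psrRank + 1 : ℝ) (numActionSeqs U) (1 / α) H (Fintype.card A))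
      (Real.log N + H + numActionSeqs U + Real.log (1 / δ) + 1 + (fstar.psrRank + 1))
      (Real.log (1 / ε)) ≤ K := by
    refine le_trans (le_of_eq ?_) hKP
    simp [sampleSize, regretFactor]
  have hq := sq_le_regretFactor hd1 hu1 ha0 hH1 hA1
  -- The polynomial is at least `3 * H ^ 2`, and `ε < H`. So there are at least three rounds, and
  -- `log K` absorbs the constants in the confidence level.
  have hK3 : 3 ≤ (K : ℝ) := by
    refine le_trans ?_ hP
    rw [sampleSize, one_div, ← div_eq_inv_mul, le_div_iff₀ (by positivity)]
    have h1 : ε ^ 2 ≤ (H : ℝ) ^ 2 := pow_le_pow_left₀ hε.le hHε.le 2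
    have h2 : ∀ Q q l : ℝ, (3 : ℝ) ≤ 8 * (Q + q) ^ 2 + 32 * l ^ 2 + 4096 := by
      intro Q q l
      nlinarith [sq_nonneg (Q + q), sq_nonneg l]
    rw [mul_comm]
    exact mul_le_mul (h1.trans hq) (h2 _ _ _) (by norm_num) ((sq_nonneg _).trans hq)
  have hlδ : 0 ≤ Real.log (1 / δ) := Real.log_nonneg (by rw [le_div_iff₀ hδ]; linarith)
  have hβL : β = 3 * (Real.log N + Real.log K + Real.log H + Real.log (numActionSeqs U) +
      Real.log (1 / δ)) := by
    rw [hβ, div_eq_mul_one_div, Real.log_mul (by positivity) (by positivity),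
      Real.log_mul (by positivity) (by positivity), Real.log_mul (by positivity) (by positivity),
      Real.log_mul (by positivity) (by positivity)]
  have hlN := Real.log_nonneg hN1
  have hlH := Real.log_nonneg hH1
  have hlu := Real.log_nonneg hu1
  have hlK : 1 ≤ Real.log K := by
    rw [Real.le_log_iff_exp_le hK0]
    linarith [Real.exp_one_lt_d9]
  set c := Real.log (2 * N * K / δ) with hc
  have hcβ : c + 1 ≤ β := by
    have h1 : c = Real.log 2 + Real.log N + Real.log K + Real.log (1 / δ) := by
      rw [hc, div_eq_mul_one_div, Real.log_mul (by positivity) (by positivity),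
        Real.log_mul (by positivity) (by positivity), Real.log_mul (by positivity) (by positivity)]
    have h2 := Real.log_two_lt_d9
    linarith
  have hexp : Real.exp c = 2 * N * K / δ := Real.exp_log (by positivity)
  refine PMF.ofReal_le_toOuterMeasure (C := 2 * N * K) (by positivity) hδ
    (expect_ratioSum_le hG K) fun s hs hgood => ⟨hlen s hs, ?_⟩
  rw [← hexp] at hgood
  have h1 := optValue_sub_mixValue_le hr hα hH hU hU0 hfF hcore hreg hK (by linarith) hcβ hplan hG
    hs hgood
  have h2 := regret_bound_le (β := β) hd1 hu1 ha0 hH1 hA1 hlN hlδ hε hK (by linarith) (by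
    have h3 := Real.log_le_self (show (0 : ℝ) ≤ H by linarith)
    have h4 := Real.log_le_self (show (0 : ℝ) ≤ numActionSeqs U by linarith)
    linarith) hP
  linarith
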